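/- Let $T>0$, $\alpha\in(1/3,1)$, and let $(\zeta,\zeta^2)$ be a geometric $\alpha$-Hölder rough path on $[0,T]$ in $\mathbb R^d$: $\zeta_0=0$, $|\zeta_t-\zeta_s|\lesssim|t-s|^{\alpha}$, $|\zeta^2_{st}|\lesssim|t-s|^{2\alpha}$, $\zeta^{2;ij}_{st}-\zeta^{2;ij}_{su}-\zeta^{2;ij}_{ut}=(\zeta^i_u-\zeta^i_s)(\zeta^j_t-\zeta^j_u)$ and $\zeta^{2;ij}_{st}+\zeta^{2;ji}_{st}=(\zeta^i_t-\zeta^i_s)(\zeta^j_t-\zeta^j_s)$ for $0\le s\le u\le t\le T$. Let $U$ be a separable metric space, let $\mathcal P_2(U)$ be the set of Borel probability measures on $U$ with finite second moment, with the Wasserstein distance $W_2$, and let $\mathcal K\subset\mathcal P_2(U)$ be compact and non-empty. For $\varepsilon,L>0$ and $s\in[0,T]$ let $\mathcal V^{\varepsilon,L}([s,T])$ be the set of all $\gamma:[s,T]\to\mathcal K$ with $W_2(\gamma_r,\gamma_t)\le L|t-r|^{\varepsilon}$ for all $r,t\in[s,T]$. Assume: * $b:[0,T]\times\mathbb R^m\times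 U\to\mathbb R^m$ is bounded and continuous, it is differentiable in $x\in\mathbb R^m$ with $\partial_x b$ bounded and continuous on $[0,T]\times\mathbb R^m\times U$, and for each $x$ the maps $t\mapsto b(t,x,a)$ are uniformly continuous, uniformly in $a\in U$; * $\sigma\in\mathcal C^{1,3}_b([0,T]\times\mathbb R^m;\mathbb R^{m,d})$, that is, $\sigma$, $\partial_t\sigma$ and $\nabla^k\sigma$ ($k\le 3$) exist and are bounded and continuous on $[0,T]\times\mathbb R^m$; * $F:[0,T]\times\mathbb R^m\times\mathcal K\to\mathbb R$ is bounded, measurable in $t$, Lipschitz in $x$ uniformly in $(t,\gamma)$, and Lipschitz in $\gamma$ for $W_2$; * $G:\mathbb R^m\to\mathbb R$ is bounded and Lipschitz. For $s\in[0,T]$, $y\in\mathbb R^m$ and $\gamma\in\mathcal V^{\varepsilon,L}([s,T])$ let $x^{s,y,\gamma}$ be the solution on $[s,T]$ of the rough differential equation $$x_t=y+\int_s^t\int_U b(r,x_r,a)\,\gamma_r(da)\,dr+\int_s^t\sigma(r,x_r)\,d\zeta_r$$ in the sense of paths weakly controlled by $\zeta$: for some $\kappa\in(1/3,\alpha)$,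 $x$ is controlled of regularity $\kappa$ with derivative $\sigma(\cdot,x)$, and the last integral is the rough integral of $\sigma(\cdot,x)$, controlled with derivative $\nabla\sigma(\cdot,x)\sigma(\cdot,x)$, against $(\zeta,\zeta^2)$. Let $$V(s,y)=\sup\Big\{\int_s^T F(r,x^{s,y,\gamma}_r,\gamma_r)\,dr+G(x^{s,y,\gamma}_T)\;:\;\gamma\in\mathcal V^{\varepsilon,L}([s,T])\Big\}.$$ Then $V(s,y)$ is a well-defined real number (the supremum is over a non-empty set that is bounded above), and there is a constant $C$, which does not depend on $\varepsilon$ and $L$, such that for all $(s_1,y_1),(s_2,y_2)\in[0,T]\times\mathbb R^m$ $$|V(s_2,y_2)-V(s_1,y_1)|\le C\big(|y_1-y_2|+(1+|y_1|+|y_2|)\,|s_1-s_2|^{\alpha}\big).$$ So $V$ is Lipschitz in space (take $s_1=s_2$) and, locally uniformly in space, $\alpha$-Hölder in time (take $y_1=y_2$). -/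

import Mathlib

open Set Filter Topology MeasureTheory
open scoped ENNReal

noncomputable section

namespace RoughControl

/-- Euclidean space `ℝⁿ`. -/
abbrev Vec (n : ℕ) := EuclideanSpace ℝ (Fin n)

/-! ### Increments on `[a, b]` -/

section Increments

variable {V : Type*} [NormedAddCommGroup V]

/-- The increment `(δ f)_{st} = f_t - f_s` of a path. -/
def inc (f : ℝ → V) (s t : ℝ) : V := f t - f s

/-- The increment `(δ g)_{sut} = g_{st} - g_{su} - g_{ut}` of a two-index map. -/
def inc₂ (g : ℝ → ℝ → V) (s u t : ℝ) : V := g s t - g s u - g u t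

/-- `g ∈ 𝒞₂^μ` on `[a, b]`: the quotients `|g_{st}| / |t - s|^μ`, `a ≤ s ≤ t ≤ b`, are bounded. -/
def IsHolder₂ (μ a b : ℝ) (g : ℝ → ℝ → V) : Prop :=
  ∃ C : ℝ, ∀ s t, a ≤ s → s ≤ t → t ≤ b → ‖g s t‖ ≤ C * (t - s) ^ μ

/-- `f ∈ 𝒞₁^μ` on `[a, b]`: the path `f` is `μ`-Hölder on `[a, b]`. -/
def IsHolder₁ (μ a b : ℝ) (f : ℝ → V) : Prop := IsHolder₂ μ a b (inc f)

/-- `g = Λ(h)` on `[a, b]`, where `Λ` is the sewing map with target `𝒞₂^μ` (`μ > 1`):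
`g` is the element of `𝒞₂^μ` with `δ g = h`. -/
def IsSewing (μ a b : ℝ) (h : ℝ → ℝ → ℝ → V) (g : ℝ → ℝ → V) : Prop :=
  IsHolder₂ μ a b g ∧
    ∀ s u t, a ≤ s → s ≤ u → u ≤ t → t ≤ b → inc₂ g s u t = h s u t

end Increments

/-! ### Rough paths, controlled paths and rough integrals -/

/-- `(ζ, Z)` is a geometric `α`-Hölder rough path on `[0, T]` starting from `0`; the two-index map
`Z` is the Lévy area (second level) of `ζ`. -/
structure IsGeometricRoughPath {d : ℕ} (T α : ℝ) (ζ : ℝ → Vec d)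
    (Z : ℝ → ℝ → Fin d → Fin d → ℝ) : Prop where
  zero : ζ 0 = 0
  holder : IsHolder₁ α 0 T ζ
  holder_area : IsHolder₂ (2 * α) 0 T Z
  chen : ∀ s u t, 0 ≤ s → s ≤ u → u ≤ t → t ≤ T → ∀ i j,
    inc₂ Z s u t i j = inc ζ s u i * inc ζ u t j
  geometric : ∀ s t, 0 ≤ s → s ≤ t → t ≤ T → ∀ i j,
    Z s t i j + Z s t j i = inc ζ s t i * inc ζ s t j

section Integral

variable {d : ℕ} {V : Type*} [NormedAddCommGroup V] [NormedSpace ℝ V]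

/-- The remainder `ρ_{st} = (δ z)_{st} - z'_s (δ ζ)_{st}`. -/
def remainder (ζ : ℝ → Vec d) (z : ℝ → V) (z' : ℝ → Vec d →L[ℝ] V) (s t : ℝ) : V :=
  inc z s t - z' s (inc ζ s t)

/-- The couple `(z, z')` is a path weakly controlled by `ζ` on `[a, b]`, of regularity `κ`. -/
structure IsControlled (ζ : ℝ → Vec d) (κ a b : ℝ) (z : ℝ → V) (z' : ℝ → Vec d →L[ℝ] V) :
    Prop where
  holder : IsHolder₁ κ a b z
  holder_deriv : IsHolder₁ κ a b z'
  holder_remainder : IsHolder₂ (2 * κ) a b (remainder ζ z z')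

/-- The contraction `∑_{i,j} A(e_i)(e_j) M^{ij}` of `A` with a `d × d` matrix `M`. For the
derivative `A = μ'` of a controlled integrand `μ`, the first argument of `A` is the direction of
differentiation and the second one is the direction of integration. -/
def contract (A : Vec d →L[ℝ] Vec d →L[ℝ] V) (M : Fin d → Fin d → ℝ) : V :=
  ∑ i, ∑ j, M i j • A (EuclideanSpace.single i 1) (EuclideanSpace.single j 1)

/-- The increments of `z` on `[a, b]` are `∫_s^t μ_u dζ_u + ∫_s^t η_u du`, where `(μ, μ')` is a
path controlled by `ζ` of regularity `κ`, and the first integral is the rough integral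
`μ δζ + μ' Z + Λ(ρ δζ + δμ' Z)`, with `ρ` the remainder of `(μ, μ')`. -/
def IsRoughIntegral (ζ : ℝ → Vec d) (Z : ℝ → ℝ → Fin d → Fin d → ℝ) (κ a b : ℝ)
    (μ : ℝ → Vec d →L[ℝ] V) (μ' : ℝ → Vec d →L[ℝ] Vec d →L[ℝ] V) (η : ℝ → V)
    (z : ℝ → V) : Prop :=
  IsControlled ζ κ a b μ μ' ∧
  ∃ Λ : ℝ → ℝ → V,
    IsSewing (3 * κ) a b
      (fun s u t => remainder ζ μ μ' s u (inc ζ u t) + contract (inc μ' s u) (Z u t)) Λ ∧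
    ∀ s t, a ≤ s → s ≤ t → t ≤ b →
      inc z s t = μ s (inc ζ s t) + contract (μ' s) (Z s t) + (∫ u in s..t, η u) + Λ s t

end Integral

/-! ### Measures with finite second moment and the Wasserstein distance -/

section Wasserstein

variable (U : Type*) [MetricSpace U] [MeasurableSpace U]

/-- `𝒫₂(U)`: the probability measures on `U` with finite second moment. -/
def P2 : Type _ :=
  {μ : Measure U // IsProbabilityMeasure μ ∧ ∃ a₀ : U, ∫⁻ a, edist a a₀ ^ 2 ∂μ < ∞}

variable {U}

/-- The underlying measure of an element of `𝒫₂(U)`. -/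
def P2.toMeasure (μ : P2 U) : Measure U := μ.1

/-- The couplings of two elements of `𝒫₂(U)`. -/
def couplings (μ ν : P2 U) : Set (Measure (U × U)) :=
  {π | π.map Prod.fst = μ.toMeasure ∧ π.map Prod.snd = ν.toMeasure}

/-- The Wasserstein distance of order two. -/
def W₂ (μ ν : P2 U) : ℝ≥0∞ :=
  ⨅ π ∈ couplings μ ν, (∫⁻ p, edist p.1 p.2 ^ 2 ∂π) ^ (1 / 2 : ℝ)

/-- The topology of the distance `W₂`: a set is open if it contains a `W₂`-ball around each of
its points. -/
instance : TopologicalSpace (P2 U) where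
  IsOpen O := ∀ μ ∈ O, ∃ r : ℝ≥0∞, 0 < r ∧ ∀ ν, W₂ μ ν < r → ν ∈ O
  isOpen_univ := fun _ _ => ⟨1, one_pos, fun _ _ => mem_univ _⟩
  isOpen_inter := by
    rintro O O' h h' μ ⟨hμ, hμ'⟩
    obtain ⟨r, hr, hO⟩ := h μ hμ
    obtain ⟨r', hr', hO'⟩ := h' μ hμ'
    exact ⟨min r r', lt_min hr hr', fun ν hν =>
      ⟨hO ν (hν.trans_le (min_le_left _ _)), hO' ν (hν.trans_le (min_le_right _ _))⟩⟩
  isOpen_sUnion := by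
    rintro 𝒪 h μ ⟨O, hO, hμ⟩
    obtain ⟨r, hr, hr'⟩ := h O hO μ hμ
    exact ⟨r, hr, fun ν hν => ⟨O, hO, hr' ν hν⟩⟩

/-- `𝒱^{ε,L}([s, T])`: the paths `γ : [s, T] → K` with `W₂(γ_r, γ_t) ≤ L |t - r|^ε`. (Values of
`γ` outside `[s, T]` are irrelevant.) -/
def admissible (K : Set (P2 U)) (ε L s T : ℝ) : Set (ℝ → P2 U) :=
  {γ | (∀ r ∈ Icc s T, γ r ∈ K) ∧
    ∀ r ∈ Icc s T, ∀ t ∈ Icc s T, W₂ (γ r) (γ t) ≤ ENNReal.ofReal (L * |t - r| ^ ε)}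

end Wasserstein

/-! ### Conditions on the coefficients and on the rewards -/

/-- `σ ∈ 𝒞_b^{1,3}([0, T] × ℝᵐ; ℝ^{m,d})`: `σ`, its time derivative and its space derivatives up
to order three exist and are bounded and continuous on `[0, T] × ℝᵐ`. -/
structure IsCb13 {m d : ℕ} (T : ℝ) (σ : ℝ → Vec m → Vec d →L[ℝ] Vec m) : Prop where
  differentiable_time : ∀ x, DifferentiableOn ℝ (fun t => σ t x) (Icc 0 T)
  contDiff_space : ∀ t ∈ Icc 0 T, ContDiff ℝ 3 (σ t)
  continuous_time : ContinuousOn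
    (fun p : ℝ × Vec m => derivWithin (fun t => σ t p.2) (Icc 0 T) p.1) (Icc 0 T ×ˢ univ)
  continuous_space : ∀ k ≤ 3, ContinuousOn
    (fun p : ℝ × Vec m => iteratedFDeriv ℝ k (σ p.1) p.2) (Icc 0 T ×ˢ univ)
  bounded_time : ∃ C : ℝ, ∀ t ∈ Icc 0 T, ∀ x,
    ‖derivWithin (fun t => σ t x) (Icc 0 T) t‖ ≤ C
  bounded_space : ∃ C : ℝ, ∀ k ≤ 3, ∀ t ∈ Icc 0 T, ∀ x, ‖iteratedFDeriv ℝ k (σ t) x‖ ≤ C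

section Coefficients

variable {m : ℕ} {U : Type*} [MetricSpace U] [MeasurableSpace U]

/-- The conditions on the drift `b : [0, T] × ℝᵐ × U → ℝᵐ`: `b` and its space derivative are
bounded and continuous, and `t ↦ b(t, x, a)` is uniformly continuous, uniformly in `a`. As to the
control variable `a`, which lies in a metric space, only continuity is demanded. -/
structure IsDrift (T : ℝ) (b : ℝ → Vec m → U → Vec m) : Prop where
  differentiable_space : ∀ t ∈ Icc 0 T, ∀ a, Differentiable ℝ (fun x => b t x a)
  continuous : ContinuousOn
    (fun p : ℝ × Vec m × U => b p.1 p.2.1 p.2.2) (Icc 0 T ×ˢ univ)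
  continuous_space : ContinuousOn
    (fun p : ℝ × Vec m × U => fderiv ℝ (fun x => b p.1 x p.2.2) p.2.1) (Icc 0 T ×ˢ univ)
  bounded : ∃ C : ℝ, ∀ t ∈ Icc 0 T, ∀ x a, ‖b t x a‖ ≤ C
  bounded_space : ∃ C : ℝ, ∀ t ∈ Icc 0 T, ∀ x a, ‖fderiv ℝ (fun x => b t x a) x‖ ≤ C
  uniform_time : ∀ x, ∀ e > 0, ∃ r > 0, ∀ t ∈ Icc 0 T, ∀ t' ∈ Icc 0 T, |t - t'| < r →
    ∀ a, ‖b t x a - b t' x a‖ < e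

/-- The conditions on the running reward `F : [0, T] × ℝᵐ × K → ℝ`: it is bounded, measurable in
time, Lipschitz in space with one constant for all times and controls, and Lipschitz in the
control for the distance `W₂`. -/
structure IsRunningReward (T : ℝ) (K : Set (P2 U)) (F : ℝ → Vec m → P2 U → ℝ) : Prop where
  bounded : ∃ C : ℝ, ∀ t ∈ Icc 0 T, ∀ x, ∀ γ ∈ K, |F t x γ| ≤ C
  measurable_time : ∀ x, ∀ γ ∈ K,
    AEMeasurable (fun t => F t x γ) (volume.restrict (Icc 0 T))
  lipschitz_space : ∃ C : ℝ, ∀ t ∈ Icc 0 T, ∀ γ ∈ K, ∀ x x',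
    |F t x γ - F t x' γ| ≤ C * ‖x - x'‖
  lipschitz_control : ∀ t ∈ Icc 0 T, ∀ x, ∃ C : ℝ, ∀ γ ∈ K, ∀ γ' ∈ K,
    ENNReal.ofReal |F t x γ - F t x γ'| ≤ ENNReal.ofReal C * W₂ γ γ'

/-- The conditions on the terminal reward: bounded and continuous. -/
structure IsTerminalReward (G : Vec m → ℝ) : Prop where
  bounded : ∃ C : ℝ, ∀ x, |G x| ≤ C
  continuous : Continuous G

end Coefficients

/-! ### The controlled equation and the value function -/

section Control

variable {m d : ℕ} {U : Type*} [MetricSpace U] [MeasurableSpace U]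

/-- `x` solves, on `[s, T]`, the rough differential equation
`dx_t = ∫_U b(t, x_t, a) γ_t(da) dt + σ(t, x_t) dζ_t` with `x_s = y`.
A solution is a fixed point in the space of weakly controlled paths of some regularity
`κ ∈ (1/3, α)`. The derivative of the right-hand side, as a controlled path, is `σ(t, x_t)`, so
this is also the derivative of `x`, and the integrand `σ(t, x_t)` has the derivative
`∇σ(t, x_t) σ(t, x_t)`. -/
def IsSolution (T α : ℝ) (ζ : ℝ → Vec d) (Z : ℝ → ℝ → Fin d → Fin d → ℝ)
    (b : ℝ → Vec m → U → Vec m) (σ : ℝ → Vec m → Vec d →L[ℝ] Vec m)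
    (s : ℝ) (y : Vec m) (γ : ℝ → P2 U) (x : ℝ → Vec m) : Prop :=
  x s = y ∧ ∃ κ : ℝ, 1 / 3 < κ ∧ κ < α ∧
    IsControlled ζ κ s T x (fun t => σ t (x t)) ∧
    IsRoughIntegral ζ Z κ s T
      (fun t => σ t (x t))
      (fun t => (fderiv ℝ (σ t) (x t)).comp (σ t (x t)))
      (fun t => ∫ a, b t (x t) a ∂(γ t).toMeasure)
      x

/-- The set of the values `J_{sT}(γ, y) = ∫_s^T F(r, x_r, γ_r) dr + G(x_T)`, where `γ` runs over
the admissible controls on `[s, T]` and `x = x^{s,y,γ}` is the controlled state. -/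
def rewards (T α ε L : ℝ) (ζ : ℝ → Vec d) (Z : ℝ → ℝ → Fin d → Fin d → ℝ)
    (b : ℝ → Vec m → U → Vec m) (σ : ℝ → Vec m → Vec d →L[ℝ] Vec m)
    (K : Set (P2 U)) (F : ℝ → Vec m → P2 U → ℝ) (G : Vec m → ℝ)
    (s : ℝ) (y : Vec m) : Set ℝ :=
  {J | ∃ γ ∈ admissible K ε L s T, ∃ x : ℝ → Vec m,
    IsSolution T α ζ Z b σ s y γ x ∧ J = (∫ r in s..T, F r (x r) (γ r)) + G (x T)}

/-- The value function `V(s, y)`. -/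
def value (T α ε L : ℝ) (ζ : ℝ → Vec d) (Z : ℝ → ℝ → Fin d → Fin d → ℝ)
    (b : ℝ → Vec m → U → Vec m) (σ : ℝ → Vec m → Vec d →L[ℝ] Vec m)
    (K : Set (P2 U)) (F : ℝ → Vec m → P2 U → ℝ) (G : Vec m → ℝ)
    (s : ℝ) (y : Vec m) : ℝ :=
  sSup (rewards T α ε L ζ Z b σ K F G s y)

end Control

end RoughControl

end

/-!
For a fixed control, the Euler map `x ↦ σ_s(x) δζ_{st} + (∇σ_s σ_s)(x) Z_{st}` is an almost flow:
its defect of additivity is of order `|t - s|^(2/3 + α)`, both as a bounded and as a Lipschitz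
function of `x`. The exponent `2/3` comes from interpolating between one derivative of `σ` in time
and three in space, which makes `∇σ` `2/3`-Hölder in time. Solutions of the controlled equation are
the paths that follow the Euler map and the frozen drift up to an error of order larger than one.
Comparing an interval with its two halves bounds this error, and the difference of the errors of two
solutions, by constants that see the control only through the bounds of the drift. So solutions
exist, are unique and depend Lipschitz continuously on the initial value, uniformly in the control
and hence in `ε` and `L`.

For initial data `(s, y)` and `(s', y')` with `s ≤ s'`, the rewards of one and the same control are
compared: during `[s, s']` the first solution moves by `O(|s' - s|^α)`, and afterwards stability
applies. A control on `[s', T]` extends to `[s, T]` by a constant, so the suprema are as close as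
the rewards.
-/

namespace RoughControl

set_option maxSynthPendingDepth 3

/-! ### Bounded Lipschitz maps and second differences -/

section BoundedLipschitz

/-- `f` is bounded by `K` and Lipschitz with the same constant `K`. -/
structure IsBL {E F : Type*} [NormedAddCommGroup E] [NormedAddCommGroup F] (K : ℝ) (f : E → F) :
    Prop where
  bound : ∀ x, ‖f x‖ ≤ K
  lip : ∀ x y, ‖f x - f y‖ ≤ K * ‖x - y‖

/-- `f` is bounded, Lipschitz, and its second differences satisfy the inequality that holds when
the derivative of `f` is also bounded and Lipschitz; the three constants are the same `K`. Unlike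
the condition on the derivative, this one is stable under the operations of this section without
any differentiation. -/
structure IsBL₂ {E F : Type*} [NormedAddCommGroup E] [NormedAddCommGroup F] (K : ℝ) (f : E → F) :
    Prop extends IsBL K f where
  second : ∀ x y v w, ‖(f (x + v) - f x) - (f (y + w) - f y)‖ ≤ K * (‖v - w‖ + ‖v‖ * ‖x - y‖)

section Group

variable {E F G : Type*} [NormedAddCommGroup E] [NormedAddCommGroup F] [NormedAddCommGroup G]
  {K K' V : ℝ} {f g : E → F}

lemma IsBL.nonneg (hf : IsBL K f) : 0 ≤ K :=
  (norm_nonneg _).trans (hf.bound 0)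

lemma IsBL.mono (hf : IsBL K f) (hK : K ≤ K') : IsBL K' f :=
  ⟨fun x => (hf.bound x).trans hK, fun x y => (hf.lip x y).trans (by gcongr)⟩

lemma IsBL₂.mono (hf : IsBL₂ K f) (hK : K ≤ K') : IsBL₂ K' f :=
  ⟨hf.toIsBL.mono hK, fun x y v w => (hf.second x y v w).trans (by gcongr)⟩

lemma IsBL.add (hf : IsBL K f) (hg : IsBL K' g) : IsBL (K + K') (fun x => f x + g x) where
  bound x := (norm_add_le _ _).trans (add_le_add (hf.bound x) (hg.bound x))
  lip x y := by
    rw [add_sub_add_comm, add_mul]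
    exact (norm_add_le _ _).trans (add_le_add (hf.lip x y) (hg.lip x y))

lemma IsBL₂.add (hf : IsBL₂ K f) (hg : IsBL₂ K' g) : IsBL₂ (K + K') (fun x => f x + g x) where
  toIsBL := hf.toIsBL.add hg.toIsBL
  second x y v w := by
    rw [add_sub_add_comm, add_sub_add_comm (f (y + w)), add_sub_add_comm, add_mul]
    exact (norm_add_le _ _).trans (add_le_add (hf.second x y v w) (hg.second x y v w))

lemma IsBL.neg (hf : IsBL K f) : IsBL K (fun x => -f x) where
  bound x := by rw [norm_neg]; exact hf.bound x
  lip x y := by rw [← norm_neg, neg_sub_neg, neg_sub]; exact hf.lip x y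

lemma IsBL.sub (hf : IsBL K f) (hg : IsBL K' g) : IsBL (K + K') (fun x => f x - g x) := by
  simpa only [sub_eq_add_neg] using hf.add hg.neg

lemma IsBL.comp {c : ℝ} {f : F → G} (hf : IsBL K f) (hc : 1 ≤ c) {φ : E → F}
    (hφ : ∀ x y, ‖φ x - φ y‖ ≤ c * ‖x - y‖) : IsBL (c * K) (fun x => f (φ x)) where
  bound x := (hf.bound _).trans (le_mul_of_one_le_left hf.nonneg hc)
  lip x y :=
    calc _ ≤ K * ‖φ x - φ y‖ := hf.lip _ _
      _ ≤ K * (c * ‖x - y‖) := mul_le_mul_of_nonneg_left (hφ x y) hf.nonneg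
      _ = c * K * ‖x - y‖ := by ring

lemma IsBL₂.increment {v : E → E} (hf : IsBL₂ K f) (hv : IsBL V v) :
    IsBL (2 * (K * V)) (fun x => f (x + v x) - f x) where
  bound x := by
    have hV := mul_nonneg hf.nonneg hv.nonneg
    have h := (hf.lip (x + v x) x).trans (mul_le_mul_of_nonneg_left
      ((add_sub_cancel_left x (v x)).symm ▸ hv.bound x) hf.nonneg)
    linarith
  lip x y := by
    have hK := hf.nonneg
    calc _ ≤ K * (‖v x - v y‖ + ‖v x‖ * ‖x - y‖) := hf.second x y (v x) (v y)
      _ ≤ K * (V * ‖x - y‖ + V * ‖x - y‖) := by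
        gcongr
        · exact hv.lip x y
        · exact hv.bound x
      _ = 2 * (K * V) * ‖x - y‖ := by ring

end Group

section Multilinear

variable {E F G H : Type*} [NormedAddCommGroup E] [NormedAddCommGroup F] [NormedSpace ℝ F]
  [NormedAddCommGroup G] [NormedSpace ℝ G] [NormedAddCommGroup H] [NormedSpace ℝ H] {K K' : ℝ}

lemma IsBL.clm {f : E → F} (hf : IsBL K f) (L : F →L[ℝ] G) :
    IsBL (‖L‖ * K) (fun x => L (f x)) where
  bound x := L.le_opNorm_of_le (hf.bound x)
  lip x y := by
    rw [← map_sub, mul_assoc]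
    exact L.le_opNorm_of_le (hf.lip x y)

lemma IsBL₂.clm {f : E → F} (hf : IsBL₂ K f) (L : F →L[ℝ] G) :
    IsBL₂ (‖L‖ * K) (fun x => L (f x)) where
  toIsBL := hf.toIsBL.clm L
  second x y v w := by
    rw [← map_sub, ← map_sub, ← map_sub, mul_assoc]
    exact L.le_opNorm_of_le (hf.second x y v w)

lemma IsBL.bilin {f : E → F} {g : E → G} (L : F →L[ℝ] G →L[ℝ] H) (hf : IsBL K f)
    (hg : IsBL K' g) : IsBL (2 * (‖L‖ * K * K')) (fun x => L (f x) (g x)) where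
  bound x := by
    have := L.le_of_opNorm₂_le_of_le le_rfl (hf.bound x) (hg.bound x)
    linarith [(norm_nonneg _).trans this]
  lip x y := by
    have e : L (f x) (g x) - L (f y) (g y) = L (f x - f y) (g x) + L (f y) (g x - g y) := by
      simp only [map_sub, sub_apply]; abel
    rw [e]
    exact (norm_add_le_of_le (L.le_of_opNorm₂_le_of_le le_rfl (hf.lip x y) (hg.bound x))
      (L.le_of_opNorm₂_le_of_le le_rfl (hf.bound y) (hg.lip x y))).trans_eq (by ring)

lemma IsBL₂.bilin {f : E → F} {g : E → G} (L : F →L[ℝ] G →L[ℝ] H) (hf : IsBL₂ K f)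
    (hg : IsBL₂ K' g) : IsBL₂ (6 * (‖L‖ * K * K')) (fun x => L (f x) (g x)) := by
  have hK := hf.nonneg
  have hK' := hg.nonneg
  have h0 : 0 ≤ ‖L‖ * K * K' := by positivity
  refine ⟨(hf.toIsBL.bilin L hg.toIsBL).mono (by linarith), fun x y v w => ?_⟩
  have e : (L (f (x + v)) (g (x + v)) - L (f x) (g x)) - (L (f (y + w)) (g (y + w)) - L (f y) (g y))
      = L ((f (x + v) - f x) - (f (y + w) - f y)) (g (y + w))
        + L (f (x + v) - f x) ((g (x + v) - g x) - (g (y + w) - g y))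
        + L (f (x + v) - f x) (g x - g y)
        + L (f x - f y) (g (x + v) - g x)
        + L (f y) ((g (x + v) - g x) - (g (y + w) - g y)) := by
    simp only [map_sub, sub_apply]; abel
  have hfv : ‖f (x + v) - f x‖ ≤ K * ‖v‖ := by
    simpa only [add_sub_cancel_left] using hf.lip (x + v) x
  have hgv : ‖g (x + v) - g x‖ ≤ K' * ‖v‖ := by
    simpa only [add_sub_cancel_left] using hg.lip (x + v) x
  have hfv' : ‖f (x + v) - f x‖ ≤ K + K := norm_sub_le_of_le (hf.bound (x + v)) (hf.bound x)
  have bd {u w} {a b : ℝ} (hu : ‖u‖ ≤ a) (hw : ‖w‖ ≤ b) := L.le_of_opNorm₂_le_of_le le_rfl hu hw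
  rw [e]
  refine (norm_add_le_of_le (norm_add_le_of_le (norm_add_le_of_le (norm_add_le_of_le
    (bd (hf.second x y v w) (hg.bound (y + w))) (bd hfv' (hg.second x y v w)))
    (bd hfv (hg.lip x y))) (bd (hf.lip x y) hgv)) (bd (hf.bound y) (hg.second x y v w))).trans ?_
  have h1 : 0 ≤ ‖L‖ * K * K' * ‖v - w‖ := by positivity
  linarith

lemma IsBL₂.clm_comp {f : E → F →L[ℝ] G} {g : E → H →L[ℝ] F} (hf : IsBL₂ K f)
    (hg : IsBL₂ K' g) : IsBL₂ (6 * (K * K')) (fun x => (f x).comp (g x)) := by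
  refine (hf.bilin (ContinuousLinearMap.compL ℝ H F G) hg).mono ?_
  rw [mul_assoc ‖_‖]
  exact mul_le_mul_of_nonneg_left (mul_le_of_le_one_left (mul_nonneg hf.nonneg hg.nonneg)
    (ContinuousLinearMap.norm_compL_le ℝ H F G)) (by norm_num)

end Multilinear

section Differentiable

variable {E F : Type*} [NormedAddCommGroup E] [NormedSpace ℝ E]
  [NormedAddCommGroup F] [NormedSpace ℝ F] {K C V : ℝ} {f : E → F} {f' : E → E →L[ℝ] F}

lemma norm_sub_le_of_hasFDerivAt_le (hf : ∀ x, HasFDerivAt f (f' x) x) (hC : ∀ x, ‖f' x‖ ≤ C)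
    (x y : E) : ‖f x - f y‖ ≤ C * ‖x - y‖ :=
  convex_univ.norm_image_sub_le_of_norm_hasFDerivWithin_le
    (fun z _ => (hf z).hasFDerivWithinAt) (fun z _ => hC z) (mem_univ y) (mem_univ x)

lemma IsBL₂.of_hasFDerivAt (hf : ∀ x, HasFDerivAt f (f' x) x) (hb : ∀ x, ‖f x‖ ≤ K)
    (hf' : IsBL K f') : IsBL₂ K f := by
  have hlip := norm_sub_le_of_hasFDerivAt_le hf hf'.bound
  refine ⟨⟨hb, hlip⟩, fun x y v w => ?_⟩
  have h1 : ‖(f (x + v) - f x) - (f (y + v) - f y)‖ ≤ K * ‖v‖ * ‖x - y‖ :=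
    norm_sub_le_of_hasFDerivAt_le (f := fun z => f (z + v) - f z)
      (fun z => ((hasFDerivAt_comp_add_right v).2 (hf (z + v))).sub (hf z))
      (fun z => by simpa only [add_sub_cancel_left] using hf'.lip (z + v) z) x y
  have h2 : ‖f (y + v) - f (y + w)‖ ≤ K * ‖v - w‖ := by
    simpa only [add_sub_add_left_eq_sub] using hlip (y + v) (y + w)
  have e : (f (x + v) - f x) - (f (y + w) - f y)
    = ((f (x + v) - f x) - (f (y + v) - f y)) + (f (y + v) - f (y + w)) := by abel
  rw [e]
  exact (norm_add_le_of_le h1 h2).trans_eq (by ring)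

lemma hasFDerivAt_taylor_remainder (hf : ∀ x, HasFDerivAt f (f' x) x) (x v : E) :
    HasFDerivAt (fun v => f (x + v) - f x - f' x v) (f' (x + v) - f' x) v :=
  (((hasFDerivAt_comp_add_left x).2 (hf (x + v))).sub_const (f x)).sub (f' x).hasFDerivAt

lemma IsBL₂.taylor {v : E → E} (hf : ∀ x, HasFDerivAt f (f' x) x) (hf' : IsBL₂ K f')
    (hv : IsBL V v) : IsBL (2 * (K * V ^ 2)) (fun x => f (x + v x) - f x - f' x (v x)) := by
  have hK := hf'.nonneg
  have hV := hv.nonneg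
  set R : E → E → F := fun x v => f (x + v) - f x - f' x v with hR
  have hR0 : ∀ x, R x 0 = 0 := fun x => by simp [hR]
  have hR' : ∀ x v, HasFDerivAt (R x) (f' (x + v) - f' x) v := hasFDerivAt_taylor_remainder hf
  have mem_ball : ∀ x, v x ∈ Metric.closedBall (0 : E) V := fun x =>
    mem_closedBall_zero_iff.2 (hv.bound x)
  have zero_mem : (0 : E) ∈ Metric.closedBall (0 : E) V := Metric.mem_closedBall_self hV
  have hdiff : ∀ x, ∀ u ∈ Metric.closedBall (0 : E) V, ∀ w ∈ Metric.closedBall (0 : E) V,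
      ‖R x u - R x w‖ ≤ K * V * ‖u - w‖ := fun x u hu w hw =>
    (convex_closedBall 0 V).norm_image_sub_le_of_norm_hasFDerivWithin_le
      (fun z _ => (hR' x z).hasFDerivWithinAt) (fun z hz => by
        refine (hf'.lip (x + z) x).trans ?_
        rw [add_sub_cancel_left]
        exact mul_le_mul_of_nonneg_left (mem_closedBall_zero_iff.1 hz) hK) hw hu
  have hbase : ∀ x y, ‖R x (v y) - R y (v y)‖ ≤ K * V * ‖x - y‖ * V := fun x y => by
    have h := (convex_closedBall 0 V).norm_image_sub_le_of_norm_hasFDerivWithin_le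
      (fun z _ => ((hR' x z).sub (hR' y z)).hasFDerivWithinAt) (C := K * V * ‖x - y‖)
      (fun z hz => by
        refine (hf'.second x y z z).trans ?_
        rw [sub_self, norm_zero, zero_add, mul_assoc K]
        gcongr
        exact mem_closedBall_zero_iff.1 hz) zero_mem (mem_ball y)
    simp only [Pi.sub_apply, hR0, sub_zero] at h
    exact h.trans (by gcongr; exact hv.bound y)
  refine ⟨fun x => ?_, fun x y => ?_⟩
  · have h := hdiff x (v x) (mem_ball x) 0 zero_mem
    rw [hR0, sub_zero, sub_zero] at h
    have h2 : K * V * ‖v x‖ ≤ K * V * V := by gcongr; exact hv.bound x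
    have h3 : 0 ≤ K * V ^ 2 := by positivity
    linarith
  · rw [← sub_add_sub_cancel _ (R x (v y))]
    refine (norm_add_le_of_le ((hdiff x _ (mem_ball x) _ (mem_ball y)).trans
      (mul_le_mul_of_nonneg_left (hv.lip x y) (by positivity))) (hbase x y)).trans_eq (by ring)

end Differentiable

end BoundedLipschitz

/-! ### Interpolation of derivatives -/

section Interpolation

lemma le_of_forall_improve {ι : Type*} {f : ι → ℝ} {θ b : ℝ} (hθ : θ < 1)
    (hf : BddAbove (range f)) (h : ∀ a, (∀ i, f i ≤ a) → ∀ i, f i ≤ θ * a + b) (i : ι) :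
    f i ≤ b / (1 - θ) := by
  have : Nonempty ι := ⟨i⟩
  have hsup : ⨆ i, f i ≤ θ * (⨆ i, f i) + b := ciSup_le (h _ (le_ciSup hf))
  refine (le_ciSup hf i).trans ((le_div_iff₀ (sub_pos.2 hθ)).2 ?_)
  linarith

variable {E F : Type*} [NormedAddCommGroup E] [NormedSpace ℝ E]
  [NormedAddCommGroup F] [NormedSpace ℝ F] {f : E → F} {f' : E → E →L[ℝ] F}
  {f'' : E → E →L[ℝ] E →L[ℝ] F} {A M r : ℝ}

/-- Landau's inequality. -/
lemma norm_fderiv_le_of_bound_of_lipschitz (hf : ∀ x, HasFDerivAt f (f' x) x)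
    (hA : ∀ x, ‖f x‖ ≤ A) (hM : ∀ x y, ‖f' x - f' y‖ ≤ M * ‖x - y‖) (hM₀ : 0 ≤ M) (hr : 0 < r)
    (x : E) : ‖f' x‖ ≤ 2 * A / r + M * r := by
  have hA₀ : 0 ≤ A := (norm_nonneg _).trans (hA x)
  refine ContinuousLinearMap.opNorm_le_of_unit_norm (by positivity) fun v hv => ?_
  have hrv : ‖r • v‖ = r := by rw [norm_smul, hv, mul_one, Real.norm_of_nonneg hr.le]
  have h1 : ‖f (x + r • v) - f x - f' x (x + r • v - x)‖ ≤ M * r * ‖x + r • v - x‖ := by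
    refine (convex_closedBall x r).norm_image_sub_le_of_norm_hasFDerivWithin_le'
      (fun z _ => (hf z).hasFDerivWithinAt) (fun z hz => ?_)
      (Metric.mem_closedBall_self hr.le) ?_
    · exact (hM z x).trans (mul_le_mul_of_nonneg_left (mem_closedBall_iff_norm.1 hz) hM₀)
    · rw [mem_closedBall_iff_norm, add_sub_cancel_left, hrv]
  rw [add_sub_cancel_left, hrv] at h1
  have h2 : r * ‖f' x v‖ ≤ A + A + M * r * r := by
    rw [← Real.norm_of_nonneg hr.le, ← norm_smul, ← map_smul, Real.norm_of_nonneg hr.le,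
      ← sub_sub_cancel (f (x + r • v) - f x) (f' x (r • v))]
    exact norm_sub_le_of_le (norm_sub_le_of_le (hA _) (hA _)) h1
  rw [div_add' _ _ _ hr.ne', le_div_iff₀ hr]
  linarith

lemma norm_fderiv_le_sq_and_norm_fderiv_fderiv_le (hf : ∀ x, HasFDerivAt f (f' x) x)
    (hf' : ∀ x, HasFDerivAt f' (f'' x) x) (hA : ∀ x, ‖f x‖ ≤ A * r ^ 3)
    (hb : ∃ a, ∀ x, ‖f' x‖ ≤ a) (hM : ∀ x y, ‖f'' x - f'' y‖ ≤ M * ‖x - y‖) (hM₀ : 0 ≤ M)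
    (hr : 0 < r) (x : E) :
    ‖f' x‖ ≤ (4 * A + 8 * M) * r ^ 2 ∧ ‖f'' x‖ ≤ (8 * A + 17 * M) * r := by
  have : 0 ≤ A := nonneg_of_mul_nonneg_left ((norm_nonneg _).trans (hA x)) (by positivity)
  have improve : ∀ a, (∀ x, ‖f' x‖ ≤ a) → ∀ x, ‖f' x‖ ≤ 1 / 2 * a + (2 * A + 4 * M) * r ^ 2 := by
    intro a h y
    have ha : 0 ≤ a := (norm_nonneg _).trans (h y)
    have h2 : ∀ x, ‖f'' x‖ ≤ 2 * a / (4 * r) + M * (4 * r) := fun x =>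
      norm_fderiv_le_of_bound_of_lipschitz hf' h hM hM₀ (by positivity) x
    refine (norm_fderiv_le_of_bound_of_lipschitz hf hA (norm_sub_le_of_hasFDerivAt_le hf' h2)
      (by positivity) hr y).trans_eq ?_
    field_simp
    ring
  have h1 : ∀ x, ‖f' x‖ ≤ (4 * A + 8 * M) * r ^ 2 := fun x => by
    obtain ⟨a, ha⟩ := hb
    refine (le_of_forall_improve (by norm_num) ⟨a, forall_mem_range.2 ha⟩ improve x).trans_eq ?_
    ring
  refine ⟨h1 x, (norm_fderiv_le_of_bound_of_lipschitz hf' h1 hM hM₀ hr x).trans_eq ?_⟩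
  field_simp
  ring

end Interpolation

/-! ### Regularity of the diffusion coefficient -/

section Coefficient

variable {E F : Type*} [NormedAddCommGroup E] [NormedSpace ℝ E]
  [NormedAddCommGroup F] [NormedSpace ℝ F] {f g : E → F} {T B C K : ℝ} {σ : ℝ → E → F}

/-- The space regularity of `σ` and of `∇σ` on `[0, T]`, and their regularity in time: the Hölder
exponents `2 / 3` and `1 / 3` are those given by the interpolation of a time derivative and of
three space derivatives. -/
structure IsRegularCoefficient (T C : ℝ) (σ : ℝ → E → F) : Prop where
  nonneg : 0 ≤ C
  differentiable : ∀ t ∈ Icc 0 T, Differentiable ℝ (σ t)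
  space : ∀ t ∈ Icc 0 T, IsBL₂ C (σ t)
  space_deriv : ∀ t ∈ Icc 0 T, IsBL₂ C (fderiv ℝ (σ t))
  time : ∀ s ∈ Icc 0 T, ∀ t ∈ Icc 0 T, s ≤ t → ∀ x, ‖σ t x - σ s x‖ ≤ C * (t - s)
  time_deriv : ∀ s ∈ Icc 0 T, ∀ t ∈ Icc 0 T, s ≤ t → ∀ x,
    ‖fderiv ℝ (σ t) x - fderiv ℝ (σ s) x‖ ≤ C * (t - s) ^ (2 / 3 : ℝ)
  time_deriv_lip : ∀ s ∈ Icc 0 T, ∀ t ∈ Icc 0 T, s ≤ t → ∀ x y,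
    ‖(fderiv ℝ (σ t) x - fderiv ℝ (σ s) x) - (fderiv ℝ (σ t) y - fderiv ℝ (σ s) y)‖
      ≤ C * (t - s) ^ (1 / 3 : ℝ) * ‖x - y‖

lemma IsBL.of_iteratedFDeriv (hf : ContDiff ℝ 1 f)
    (hC : ∀ k ≤ 1, ∀ x, ‖iteratedFDeriv ℝ k f x‖ ≤ C) : IsBL C f where
  bound x := by simpa only [norm_iteratedFDeriv_zero] using hC 0 zero_le_one x
  lip := norm_sub_le_of_hasFDerivAt_le
    (fun x => (hf.differentiable one_ne_zero x).hasFDerivAt) fun x => by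
      simpa only [← norm_iteratedFDeriv_fderiv, norm_iteratedFDeriv_zero] using hC 1 le_rfl x

lemma norm_iteratedFDeriv_fderiv_le {n : ℕ} (hC : ∀ k ≤ n + 1, ∀ x, ‖iteratedFDeriv ℝ k f x‖ ≤ C) :
    ∀ k ≤ n, ∀ x, ‖iteratedFDeriv ℝ k (fderiv ℝ f) x‖ ≤ C := fun k hk x => by
  simpa only [norm_iteratedFDeriv_fderiv] using hC (k + 1) (by lia) x

lemma IsBL₂.of_iteratedFDeriv (hf : ContDiff ℝ 2 f)
    (hC : ∀ k ≤ 2, ∀ x, ‖iteratedFDeriv ℝ k f x‖ ≤ C) : IsBL₂ C f :=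
  .of_hasFDerivAt (fun x => (hf.differentiable two_ne_zero x).hasFDerivAt)
    (fun x => by simpa only [norm_iteratedFDeriv_zero] using hC 0 zero_le_two x)
    (.of_iteratedFDeriv (hf.fderiv_right (by norm_num)) (norm_iteratedFDeriv_fderiv_le hC))

lemma IsBL₂.fderiv_of_iteratedFDeriv (hf : ContDiff ℝ 3 f)
    (hC : ∀ k ≤ 3, ∀ x, ‖iteratedFDeriv ℝ k f x‖ ≤ C) : IsBL₂ C (fderiv ℝ f) :=
  .of_iteratedFDeriv (hf.fderiv_right (by norm_num)) (norm_iteratedFDeriv_fderiv_le hC)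

lemma IsBL.fderiv_fderiv_of_iteratedFDeriv (hf : ContDiff ℝ 3 f)
    (hC : ∀ k ≤ 3, ∀ x, ‖iteratedFDeriv ℝ k f x‖ ≤ C) : IsBL C (fderiv ℝ (fderiv ℝ f)) :=
  .of_iteratedFDeriv ((hf.fderiv_right (m := 2) (by norm_num)).fderiv_right (by norm_num))
    (norm_iteratedFDeriv_fderiv_le (norm_iteratedFDeriv_fderiv_le hC))

lemma hasFDerivAt_fderiv_of_contDiff (hf : ContDiff ℝ 2 f) (x : E) :
    HasFDerivAt (fderiv ℝ f) (fderiv ℝ (fderiv ℝ f) x) x :=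
  ((hf.fderiv_right (m := 1) (by norm_num)).differentiable one_ne_zero x).hasFDerivAt

lemma norm_fderiv_sub_le_of_norm_sub_le {τ : ℝ} (hf : ContDiff ℝ 3 f) (hg : ContDiff ℝ 3 g)
    (hf₃ : ∀ k ≤ 3, ∀ x, ‖iteratedFDeriv ℝ k f x‖ ≤ C)
    (hg₃ : ∀ k ≤ 3, ∀ x, ‖iteratedFDeriv ℝ k g x‖ ≤ C) (hτ : 0 ≤ τ)
    (hfg : ∀ x, ‖f x - g x‖ ≤ B * τ) (x : E) :
    ‖fderiv ℝ f x - fderiv ℝ g x‖ ≤ (4 * B + 16 * C) * τ ^ (2 / 3 : ℝ) ∧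
      ‖fderiv ℝ (fderiv ℝ f) x - fderiv ℝ (fderiv ℝ g) x‖
        ≤ (8 * B + 34 * C) * τ ^ (1 / 3 : ℝ) := by
  rcases hτ.eq_or_lt with rfl | hτ
  · obtain rfl : f = g := funext fun x => sub_eq_zero.1 (norm_le_zero_iff.1 (by simpa using hfg x))
    rw [sub_self, sub_self, Real.zero_rpow (by norm_num), Real.zero_rpow (by norm_num), mul_zero,
      mul_zero]
    exact ⟨norm_zero.le, ContinuousLinearMap.opNorm_zero.le⟩
  have hC : 0 ≤ C := (norm_nonneg _).trans (hf₃ 0 (by norm_num) x)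
  have hτ_pow (n : ℕ) : (τ ^ (1 / 3 : ℝ)) ^ n = τ ^ (n / 3 : ℝ) := by
    rw [← Real.rpow_natCast, ← Real.rpow_mul hτ.le]; ring_nf
  have hasFDerivAt_sub (x : E) :=
    (hf.differentiable three_ne_zero x).hasFDerivAt.sub
      (hg.differentiable three_ne_zero x).hasFDerivAt
  have hasFDerivAt_fderiv_sub (x : E) :=
    (hasFDerivAt_fderiv_of_contDiff (hf.of_le (by norm_num)) x).sub
      (hasFDerivAt_fderiv_of_contDiff (hg.of_le (by norm_num)) x)
  have interpolation := norm_fderiv_le_sq_and_norm_fderiv_fderiv_le (A := B) hasFDerivAt_sub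
    hasFDerivAt_fderiv_sub (fun x => by rw [hτ_pow]; simpa using hfg x)
    ⟨_, ((IsBL₂.fderiv_of_iteratedFDeriv hf hf₃).toIsBL.sub
      (IsBL₂.fderiv_of_iteratedFDeriv hg hg₃).toIsBL).bound⟩
    ((IsBL.fderiv_fderiv_of_iteratedFDeriv hf hf₃).sub
      (.fderiv_fderiv_of_iteratedFDeriv hg hg₃)).lip (by positivity)
    (Real.rpow_pos_of_pos hτ (1 / 3)) x
  rw [hτ_pow] at interpolation
  exact ⟨interpolation.1.trans_eq (by push_cast; ring), interpolation.2.trans_eq (by ring)⟩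

lemma exists_isRegularCoefficient (hσ : ∀ t ∈ Icc 0 T, ContDiff ℝ 3 (σ t))
    (hσ_time : ∀ x, DifferentiableOn ℝ (fun t => σ t x) (Icc 0 T))
    (hb_time : ∃ C : ℝ, ∀ t ∈ Icc 0 T, ∀ x, ‖derivWithin (fun t => σ t x) (Icc 0 T) t‖ ≤ C)
    (hb : ∃ C : ℝ, ∀ k ≤ 3, ∀ t ∈ Icc 0 T, ∀ x, ‖iteratedFDeriv ℝ k (σ t) x‖ ≤ C) :
    ∃ C, IsRegularCoefficient T C σ := by
  obtain ⟨B, hB⟩ := hb_time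
  obtain ⟨C, hC⟩ := hb
  rcases (Icc 0 T).eq_empty_or_nonempty with hT | ⟨t₀, ht₀⟩
  · refine ⟨0, ⟨le_rfl, ?_, ?_, ?_, ?_, ?_, ?_⟩⟩ <;> simp [hT]
  have hC₀ : 0 ≤ C := (norm_nonneg _).trans (hC 0 (by norm_num) t₀ ht₀ 0)
  have hB₀ : 0 ≤ B := (norm_nonneg _).trans (hB t₀ ht₀ 0)
  have hC' : ∀ t ∈ Icc 0 T, ∀ k ≤ 3, ∀ x, ‖iteratedFDeriv ℝ k (σ t) x‖ ≤ C :=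
    fun t ht k hk x => hC k hk t ht x
  have time : ∀ s ∈ Icc 0 T, ∀ t ∈ Icc 0 T, s ≤ t → ∀ x, ‖σ t x - σ s x‖ ≤ B * (t - s) := by
    intro s hs t ht hst x
    have := (convex_Icc 0 T).norm_image_sub_le_of_norm_derivWithin_le
      (hσ_time x) (fun r hr => hB r hr x) hs ht
    rwa [Real.norm_of_nonneg (sub_nonneg.2 hst)] at this
  have interp : ∀ s ∈ Icc 0 T, ∀ t ∈ Icc 0 T, s ≤ t → ∀ x, _ := fun s hs t ht hst =>
    norm_fderiv_sub_le_of_norm_sub_le (hσ t ht) (hσ s hs) (hC' t ht) (hC' s hs)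
      (sub_nonneg.2 hst) (time s hs t ht hst)
  have hCK : C ≤ 8 * B + 34 * C := by linarith
  have hBK : B ≤ 8 * B + 34 * C := by linarith
  have hBK' : 4 * B + 16 * C ≤ 8 * B + 34 * C := by linarith
  refine ⟨8 * B + 34 * C, by positivity, fun t ht => (hσ t ht).differentiable three_ne_zero,
    fun t ht => ?_, fun t ht => ?_, fun s hs t ht hst x => ?_, fun s hs t ht hst x => ?_,
    fun s hs t ht hst => ?_⟩
  · exact (IsBL₂.of_iteratedFDeriv ((hσ t ht).of_le (by norm_num))
      fun k hk => hC' t ht k (by lia)).mono hCK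
  · exact (IsBL₂.fderiv_of_iteratedFDeriv (hσ t ht) (hC' t ht)).mono hCK
  · exact (time s hs t ht hst x).trans (by gcongr)
  · exact (interp s hs t ht hst x).1.trans (by gcongr)
  · exact norm_sub_le_of_hasFDerivAt_le
      (fun x => (hasFDerivAt_fderiv_of_contDiff ((hσ t ht).of_le (by norm_num)) x).sub
        (hasFDerivAt_fderiv_of_contDiff ((hσ s hs).of_le (by norm_num)) x))
      fun x => (interp s hs t ht hst x).2

namespace IsRegularCoefficient

variable {s t : ℝ}

lemma hasFDerivAt (hσ : IsRegularCoefficient T C σ) (ht : t ∈ Icc 0 T) (x : E) :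
    HasFDerivAt (σ t) (fderiv ℝ (σ t) x) x :=
  (hσ.differentiable t ht x).hasFDerivAt

lemma isBL_time_sub (hσ : IsRegularCoefficient T C σ) (hs : s ∈ Icc 0 T) (ht : t ∈ Icc 0 T)
    (hst : s ≤ t) (hst' : t - s ≤ 1) :
    IsBL (C * (t - s) ^ (2 / 3 : ℝ)) (fun x => σ t x - σ s x) where
  bound x := (hσ.time s hs t ht hst x).trans (mul_le_mul_of_nonneg_left
    (Real.self_le_rpow_of_le_one (sub_nonneg.2 hst) hst' (by norm_num)) hσ.nonneg)
  lip := norm_sub_le_of_hasFDerivAt_le (fun x => (hσ.hasFDerivAt ht x).sub (hσ.hasFDerivAt hs x))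
    (hσ.time_deriv s hs t ht hst)

lemma isBL_time_fderiv_sub (hσ : IsRegularCoefficient T C σ) (hs : s ∈ Icc 0 T)
    (ht : t ∈ Icc 0 T) (hst : s ≤ t) (hst' : t - s ≤ 1) :
    IsBL (C * (t - s) ^ (1 / 3 : ℝ)) (fun x => fderiv ℝ (σ t) x - fderiv ℝ (σ s) x) where
  bound x := (hσ.time_deriv s hs t ht hst x).trans (mul_le_mul_of_nonneg_left
    (Real.rpow_le_rpow_of_exponent_ge' (sub_nonneg.2 hst) hst' (by norm_num) (by norm_num))
    hσ.nonneg)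
  lip := hσ.time_deriv_lip s hs t ht hst

end IsRegularCoefficient

end Coefficient

section Families

variable {ι E F G H : Type*} [NormedAddCommGroup E] [NormedAddCommGroup F] {w w' : ι → ℝ}

/-- Calculus of orders of magnitude: the functions `f i` are bounded and Lipschitz with constants
of the order of `w i`, uniformly in `i`. -/
def IsBLO (w : ι → ℝ) (f : ι → E → F) : Prop := ∃ C, 0 ≤ C ∧ ∀ i, IsBL (C * w i) (f i)

namespace IsBLO

lemma add {f g : ι → E → F} (hf : IsBLO w f) (hg : IsBLO w g) :
    IsBLO w (fun i x => f i x + g i x) := by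
  obtain ⟨C, hC, hf⟩ := hf
  obtain ⟨C', hC', hg⟩ := hg
  exact ⟨C + C', by positivity, fun i => by rw [add_mul]; exact (hf i).add (hg i)⟩

lemma neg {f : ι → E → F} (hf : IsBLO w f) : IsBLO w (fun i x => -f i x) := by
  obtain ⟨C, hC, hf⟩ := hf
  exact ⟨C, hC, fun i => (hf i).neg⟩

lemma mono {f : ι → E → F} (hf : IsBLO w f) (h : w ≤ w') : IsBLO w' f := by
  obtain ⟨C, hC, hf⟩ := hf
  exact ⟨C, hC, fun i => (hf i).mono (mul_le_mul_of_nonneg_left (h i) hC)⟩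

lemma comp_id_add {f : ι → E → F} {v : ι → E → E} (hf : IsBLO w f) (hv : IsBLO w' v)
    (hw' : w' ≤ 1) : IsBLO w (fun i x => f i (x + v i x)) := by
  obtain ⟨C, hC, hf⟩ := hf
  obtain ⟨C', hC', hv⟩ := hv
  refine ⟨(1 + C') * C, by positivity, fun i => ?_⟩
  refine ((hf i).comp (le_add_of_nonneg_right hC') fun x y => ?_).mono
    (mul_assoc (1 + C') C (w i)).ge
  rw [add_sub_add_comm, add_mul, one_mul]
  exact norm_add_le_of_le le_rfl (((hv i).mono (mul_le_of_le_one_right hC' (hw' i))).lip x y)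

lemma increment {f : ι → E → F} {v : ι → E → E} (hv : IsBLO w v) {K : ℝ} (hK : 0 ≤ K)
    (hf : ∀ i, IsBL₂ K (f i)) : IsBLO w (fun i x => f i (x + v i x) - f i x) := by
  obtain ⟨C, hC, hv⟩ := hv
  exact ⟨2 * (K * C), by positivity, fun i =>
    ((hf i).increment (hv i)).mono (le_of_eq (by ring))⟩

variable [NormedSpace ℝ F] [NormedAddCommGroup G] [NormedSpace ℝ G] [NormedAddCommGroup H]
  [NormedSpace ℝ H]

lemma clm {f : ι → E → F} (hf : IsBLO w f) {c : ℝ} (hc : 0 ≤ c)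
    {L : ι → F →L[ℝ] G} (hL : ∀ i, ‖L i‖ ≤ c * w' i) :
    IsBLO (w * w') (fun i x => L i (f i x)) := by
  obtain ⟨C, hC, hf⟩ := hf
  refine ⟨C * c, by positivity, fun i => ((hf i).clm (L i)).mono ?_⟩
  exact (mul_le_mul_of_nonneg_right (hL i) (hf i).nonneg).trans_eq
    (by rw [Pi.mul_apply]; ring)

lemma bilin {f : ι → E → F} {g : ι → E → G} (L : F →L[ℝ] G →L[ℝ] H) (hf : IsBLO w f)
    (hg : IsBLO w' g) : IsBLO (w * w') (fun i x => L (f i x) (g i x)) := by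
  obtain ⟨C, hC, hf⟩ := hf
  obtain ⟨C', hC', hg⟩ := hg
  exact ⟨2 * (‖L‖ * (C * C')), by positivity, fun i =>
    ((hf i).bilin L (hg i)).mono (le_of_eq (by rw [Pi.mul_apply]; ring))⟩

lemma clm_apply {f : ι → E → F →L[ℝ] G} {g : ι → E → F} (hf : IsBLO w f)
    (hg : IsBLO w' g) : IsBLO (w * w') (fun i x => f i x (g i x)) :=
  hf.bilin (ContinuousLinearMap.id ℝ (F →L[ℝ] G)) hg

lemma clm_comp {f : ι → E → F →L[ℝ] G} {g : ι → E → H →L[ℝ] F} (hf : IsBLO w f)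
    (hg : IsBLO w' g) : IsBLO (w * w') (fun i x => (f i x).comp (g i x)) :=
  hf.bilin (ContinuousLinearMap.compL ℝ H F G) hg

lemma taylor [NormedSpace ℝ E] {f : ι → E → F} {f' : ι → E → E →L[ℝ] F} {v : ι → E → E}
    (hv : IsBLO w v) {K : ℝ} (hK : 0 ≤ K) (hf : ∀ i x, HasFDerivAt (f i) (f' i x) x)
    (hf' : ∀ i, IsBL₂ K (f' i)) :
    IsBLO (w * w) (fun i x => f i (x + v i x) - f i x - f' i x (v i x)) := by
  obtain ⟨C, -, hv⟩ := hv
  exact ⟨2 * (K * C ^ 2), by positivity, fun i =>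
    (IsBL₂.taylor (hf i) (hf' i) (hv i)).mono (le_of_eq (by rw [Pi.mul_apply]; ring))⟩

end IsBLO

end Families

/-! ### The germ of a rough differential equation -/

section Contract

variable {d : ℕ} {V : Type*} [NormedAddCommGroup V] [NormedSpace ℝ V]

lemma norm_contract_le (A : Vec d →L[ℝ] Vec d →L[ℝ] V) (M : Fin d → Fin d → ℝ) :
    ‖contract A M‖ ≤ (d : ℝ) ^ 2 * ‖M‖ * ‖A‖ := by
  have h : ∀ i j, ‖M i j • A (EuclideanSpace.single i 1) (EuclideanSpace.single j 1)‖
      ≤ ‖M‖ * ‖A‖ := by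
    intro i j
    rw [norm_smul]
    have h1 : ‖M i j‖ ≤ ‖M‖ := (norm_le_pi_norm (M i) j).trans (norm_le_pi_norm M i)
    have h2 := A.le_opNorm₂ (EuclideanSpace.single i 1) (EuclideanSpace.single j 1)
    simp only [PiLp.norm_single, norm_one, mul_one] at h2
    gcongr
  calc ‖contract A M‖ ≤ ∑ _i : Fin d, ∑ _j : Fin d, ‖M‖ * ‖A‖ :=
        (norm_sum_le _ _).trans (Finset.sum_le_sum fun i _ =>
          (norm_sum_le _ _).trans (Finset.sum_le_sum fun j _ => h i j))
    _ = _ := by simp; ring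

lemma contract_add (A : Vec d →L[ℝ] Vec d →L[ℝ] V) (M N : Fin d → Fin d → ℝ) :
    contract A (M + N) = contract A M + contract A N := by
  simp [contract, add_smul, Finset.sum_add_distrib]

/-- The contraction with a fixed matrix, as a continuous linear map. -/
noncomputable def contractCLM (M : Fin d → Fin d → ℝ) :
    (Vec d →L[ℝ] Vec d →L[ℝ] V) →L[ℝ] V :=
  LinearMap.mkContinuous (E := Vec d →L[ℝ] Vec d →L[ℝ] V)
    { toFun := fun A => contract A M
      map_add' := fun A B => by simp [contract, Finset.sum_add_distrib]
      map_smul' := fun c A => by simp [contract, Finset.smul_sum, smul_comm c] }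
    ((d : ℝ) ^ 2 * ‖M‖) fun A => norm_contract_le A M

@[simp] lemma contractCLM_apply (M : Fin d → Fin d → ℝ) (A : Vec d →L[ℝ] Vec d →L[ℝ] V) :
    contractCLM M A = contract A M := rfl

lemma norm_contractCLM_le (M : Fin d → Fin d → ℝ) :
    ‖(contractCLM M : (Vec d →L[ℝ] Vec d →L[ℝ] V) →L[ℝ] V)‖ ≤ (d : ℝ) ^ 2 * ‖M‖ :=
  LinearMap.mkContinuous_norm_le _ (by positivity) _

lemma contract_sub_left (A B : Vec d →L[ℝ] Vec d →L[ℝ] V) (M : Fin d → Fin d → ℝ) :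
    contract (A - B) M = contract A M - contract B M :=
  map_sub (contractCLM M) A B

lemma contract_tensor (A : Vec d →L[ℝ] Vec d →L[ℝ] V) (u v : Vec d) :
    contract A (fun i j => u i * v j) = A u v := by
  have expand : ∀ u : Vec d, u = ∑ i, u i • EuclideanSpace.single i (1 : ℝ) := fun u => by
    simpa using ((EuclideanSpace.basisFun (Fin d) ℝ).sum_repr u).symm
  conv_rhs => rw [expand u, expand v]
  simp only [contract, map_sum, map_smul, sum_apply, smul_apply, Finset.smul_sum, smul_smul]
  rw [Finset.sum_comm]
  simp only [mul_comm]

end Contract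

section RoughPath

variable {d : ℕ} {T α : ℝ} {ζ : ℝ → Vec d} {Z : ℝ → ℝ → Fin d → Fin d → ℝ}

/-- `(ζ, Z)` is an `α`-Hölder rough path on `[0, T]`: as a geometric one, but without a condition
on the symmetric part of `Z` and without a condition on the starting point. -/
structure IsRoughPath (T α : ℝ) (ζ : ℝ → Vec d) (Z : ℝ → ℝ → Fin d → Fin d → ℝ) : Prop where
  holder : IsHolder₁ α 0 T ζ
  holder_area : IsHolder₂ (2 * α) 0 T Z
  chen : ∀ s u t, 0 ≤ s → s ≤ u → u ≤ t → t ≤ T → ∀ i j,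
    inc₂ Z s u t i j = inc ζ s u i * inc ζ u t j

lemma IsGeometricRoughPath.isRoughPath (hζ : IsGeometricRoughPath T α ζ Z) :
    IsRoughPath T α ζ Z :=
  ⟨hζ.holder, hζ.holder_area, hζ.chen⟩

lemma inc_add {V : Type*} [NormedAddCommGroup V] (f : ℝ → V) (s u t : ℝ) :
    inc f s t = inc f s u + inc f u t :=
  (sub_add_sub_cancel' _ _ _).symm

lemma IsRoughPath.area_eq (hζ : IsRoughPath T α ζ Z) {s u t : ℝ} (hs : 0 ≤ s) (hsu : s ≤ u)
    (hut : u ≤ t) (ht : t ≤ T) :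
    Z s t = Z s u + Z u t + fun i j => inc ζ s u i * inc ζ u t j := by
  ext i j
  have := hζ.chen s u t hs hsu hut ht i j
  simp only [inc₂, Pi.sub_apply] at this
  simp only [Pi.add_apply]
  linarith

lemma IsHolder₂.exists_nonneg {V : Type*} [NormedAddCommGroup V] {μ a b : ℝ} {g : ℝ → ℝ → V}
    (hg : IsHolder₂ μ a b g) :
    ∃ C, 0 ≤ C ∧ ∀ s t, a ≤ s → s ≤ t → t ≤ b → ‖g s t‖ ≤ C * (t - s) ^ μ := by
  obtain ⟨C, hC⟩ := hg
  refine ⟨max C 0, le_max_right _ _, fun s t hs hst ht => (hC s t hs hst ht).trans ?_⟩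
  exact mul_le_mul_of_nonneg_right (le_max_left _ _) (Real.rpow_nonneg (sub_nonneg.2 hst) _)

lemma IsRoughPath.exists_bound (hζ : IsRoughPath T α ζ Z) :
    ∃ C, 0 ≤ C ∧ ∀ s t, 0 ≤ s → s ≤ t → t ≤ T →
      ‖inc ζ s t‖ ≤ C * (t - s) ^ α ∧ ‖Z s t‖ ≤ C * (t - s) ^ (2 * α) := by
  obtain ⟨C, hC, hCζ⟩ := IsHolder₂.exists_nonneg hζ.holder
  obtain ⟨C', hC', hCZ⟩ := hζ.holder_area.exists_nonneg
  refine ⟨C + C', by positivity, fun s t hs hst ht =>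
    ⟨(hCζ s t hs hst ht).trans ?_, (hCZ s t hs hst ht).trans ?_⟩⟩
  all_goals refine mul_le_mul_of_nonneg_right ?_ (Real.rpow_nonneg (sub_nonneg.2 hst) _)
  exacts [le_add_of_nonneg_right hC', le_add_of_nonneg_left hC]

end RoughPath

section Germ

variable {E : Type*} [NormedAddCommGroup E] [NormedSpace ℝ E] {d : ℕ}

/-- The derivative `∇σ_s σ_s` of the integrand `σ(s, x_s)` as a path controlled by `ζ`. -/
noncomputable def gubinelliDeriv (σ : ℝ → E → Vec d →L[ℝ] E) (s : ℝ) (x : E) :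
    Vec d →L[ℝ] Vec d →L[ℝ] E :=
  (fderiv ℝ (σ s) x).comp (σ s x)

/-- The one-step map `x ↦ σ_s(x) δζ_{st} + (∇σ_s σ_s)(x) Z_{st}` of the second order Euler
scheme. -/
noncomputable def roughGerm (ζ : ℝ → Vec d) (Z : ℝ → ℝ → Fin d → Fin d → ℝ)
    (σ : ℝ → E → Vec d →L[ℝ] E) (s t : ℝ) (x : E) : E :=
  σ s x (inc ζ s t) + contract (gubinelliDeriv σ s x) (Z s t)

/-- `x ↦ x + A s t x` is an almost flow: the one-step maps `A s t` are regular of order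
`(t - s) ^ α`, and they are additive along the flow up to an error of order
`(t - s) ^ (2 / 3 + α)`, whose exponent is larger than one in the applications. -/
structure IsAlmostFlow {E : Type*} [NormedAddCommGroup E] (T α C : ℝ) (A : ℝ → ℝ → E → E) :
    Prop where
  nonneg : 0 ≤ C
  regular : ∀ s t, 0 ≤ s → s ≤ t → t ≤ T → t - s ≤ 1 → IsBL₂ (C * (t - s) ^ α) (A s t)
  almost : ∀ s u t, 0 ≤ s → s ≤ u → u ≤ t → t ≤ T → t - s ≤ 1 →
    IsBL (C * (t - s) ^ (2 / 3 + α)) (fun x => A s t x - A s u x - A u t (x + A s u x))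

lemma IsAlmostFlow.mono {E : Type*} [NormedAddCommGroup E] {T α C C' : ℝ} {A : ℝ → ℝ → E → E}
    (hA : IsAlmostFlow T α C A) (h : C ≤ C') : IsAlmostFlow T α C' A :=
  ⟨hA.nonneg.trans h,
    fun s t hs hst ht h1 => (hA.regular s t hs hst ht h1).mono
      (mul_le_mul_of_nonneg_right h (Real.rpow_nonneg (sub_nonneg.2 hst) _)),
    fun s u t hs hsu hut ht h1 => (hA.almost s u t hs hsu hut ht h1).mono
      (mul_le_mul_of_nonneg_right h (Real.rpow_nonneg (sub_nonneg.2 (hsu.trans hut)) _))⟩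

variable {T α K : ℝ} {ζ : ℝ → Vec d} {Z : ℝ → ℝ → Fin d → Fin d → ℝ} {σ : ℝ → E → Vec d →L[ℝ] E}

lemma gubinelliDeriv_apply (σ : ℝ → E → Vec d →L[ℝ] E) (s : ℝ) (x : E) (v : Vec d) :
    gubinelliDeriv σ s x v = fderiv ℝ (σ s) x (σ s x v) := rfl

lemma IsRegularCoefficient.isBL₂_gubinelliDeriv (hσ : IsRegularCoefficient T K σ) {s : ℝ}
    (hs : s ∈ Icc 0 T) : IsBL₂ (6 * (K * K)) (gubinelliDeriv σ s) :=
  (hσ.space_deriv s hs).clm_comp (hσ.space s hs)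

lemma roughGerm_defect (hζ : IsRoughPath T α ζ Z) (σ : ℝ → E → Vec d →L[ℝ] E) {s u t : ℝ}
    (hs : 0 ≤ s) (hsu : s ≤ u) (hut : u ≤ t) (ht : t ≤ T) (x y : E) :
    roughGerm ζ Z σ s t x - roughGerm ζ Z σ s u x - roughGerm ζ Z σ u t y
      = -((σ u y - σ s x - fderiv ℝ (σ s) x (σ s x (inc ζ s u))) (inc ζ u t)
        + contract (gubinelliDeriv σ u y - gubinelliDeriv σ s x) (Z u t)) := by
  simp only [roughGerm, hζ.area_eq hs hsu hut ht, inc_add ζ s u t, contract_add, contract_tensor,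
    contract_sub_left, map_add, sub_apply, gubinelliDeriv_apply]
  abel

lemma exists_isBL₂_roughGerm (hα : 0 ≤ α) (hζ : IsRoughPath T α ζ Z)
    (hσ : IsRegularCoefficient T K σ) :
    ∃ C, 0 ≤ C ∧ ∀ s t, 0 ≤ s → s ≤ t → t ≤ T → t - s ≤ 1 →
      IsBL₂ (C * (t - s) ^ α) (roughGerm ζ Z σ s t) := by
  obtain ⟨c, hc, hcζ⟩ := hζ.exists_bound
  have hK := hσ.nonneg
  refine ⟨c * K + (d : ℝ) ^ 2 * c * (6 * (K * K)), by positivity, fun s t hs hst ht h1 => ?_⟩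
  have hs' : s ∈ Icc 0 T := ⟨hs, hst.trans ht⟩
  obtain ⟨hζst, hZst⟩ := hcζ s t hs hst ht
  have hZst' : ‖Z s t‖ ≤ c * (t - s) ^ α := hZst.trans (mul_le_mul_of_nonneg_left
    (Real.rpow_le_rpow_of_exponent_ge' (sub_nonneg.2 hst) h1 hα (by linarith)) hc)
  have first : IsBL₂ (c * (t - s) ^ α * K) (fun x => σ s x (inc ζ s t)) :=
    ((hσ.space s hs').clm (ContinuousLinearMap.apply ℝ E (inc ζ s t))).mono
      (mul_le_mul_of_nonneg_right ((ContinuousLinearMap.opNorm_le_bound _ (norm_nonneg _)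
        fun L => by rw [mul_comm]; exact L.le_opNorm _).trans hζst) hK)
  have second : IsBL₂ ((d : ℝ) ^ 2 * (c * (t - s) ^ α) * (6 * (K * K)))
      (fun x => contract (gubinelliDeriv σ s x) (Z s t)) :=
    ((hσ.isBL₂_gubinelliDeriv hs').clm (contractCLM (Z s t))).mono
      (mul_le_mul_of_nonneg_right ((norm_contractCLM_le _).trans (by gcongr)) (by positivity))
  exact (first.add second).mono (le_of_eq (by ring))

end Germ

section ShortTriple

/-- Times `0 ≤ s ≤ u ≤ t ≤ T` with `t - s ≤ 1`: the index set of the orders of magnitude of the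
defect of additivity of a germ. -/
structure ShortTriple (T : ℝ) where
  (s u t : ℝ)
  nonneg : 0 ≤ s
  le_mid : s ≤ u
  mid_le : u ≤ t
  le_end : t ≤ T
  short : t - s ≤ 1

namespace ShortTriple

variable {T : ℝ}

/-- The order of magnitude `(t - s) ^ p`. -/
noncomputable def gauge (T p : ℝ) (i : ShortTriple T) : ℝ := (i.t - i.s) ^ p

variable {p q : ℝ} (i : ShortTriple T)

lemma left_mem : i.s ∈ Icc 0 T := ⟨i.nonneg, i.le_mid.trans (i.mid_le.trans i.le_end)⟩

lemma mid_mem : i.u ∈ Icc 0 T := ⟨i.nonneg.trans i.le_mid, i.mid_le.trans i.le_end⟩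

lemma sub_nonneg : 0 ≤ i.t - i.s := _root_.sub_nonneg.2 (i.le_mid.trans i.mid_le)

lemma left_short : i.u - i.s ≤ 1 := (sub_le_sub_right i.mid_le _).trans i.short

lemma left_rpow_le (hq : 0 ≤ q) (hqp : q ≤ p) : (i.u - i.s) ^ p ≤ gauge T q i :=
  (Real.rpow_le_rpow_of_exponent_ge' (_root_.sub_nonneg.2 i.le_mid) i.left_short hq hqp).trans
    (Real.rpow_le_rpow (_root_.sub_nonneg.2 i.le_mid) (sub_le_sub_right i.mid_le _) hq)

lemma right_rpow_le (hq : 0 ≤ q) (hqp : q ≤ p) : (i.t - i.u) ^ p ≤ gauge T q i :=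
  (Real.rpow_le_rpow_of_exponent_ge' (_root_.sub_nonneg.2 i.mid_le)
    ((sub_le_sub_left i.le_mid _).trans i.short) hq hqp).trans
    (Real.rpow_le_rpow (_root_.sub_nonneg.2 i.mid_le) (sub_le_sub_left i.le_mid _) hq)

lemma gauge_le_gauge (hq : 0 ≤ q) (hqp : q ≤ p) : gauge T p ≤ gauge T q := fun i =>
  Real.rpow_le_rpow_of_exponent_ge' i.sub_nonneg i.short hq hqp

lemma gauge_zero : gauge T 0 = 1 := funext fun _ => Real.rpow_zero _

lemma gauge_mul_gauge (hp : 0 ≤ p) (hq : 0 ≤ q) : gauge T p * gauge T q = gauge T (p + q) :=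
  funext fun i => (Real.rpow_add_of_nonneg i.sub_nonneg hp hq).symm

end ShortTriple

end ShortTriple

section AlmostFlow

open ShortTriple

variable {E : Type*} [NormedAddCommGroup E] [NormedSpace ℝ E] {d : ℕ} {T α K c : ℝ}
  {ζ : ℝ → Vec d} {Z : ℝ → ℝ → Fin d → Fin d → ℝ}

section TimeIncrements

variable {F : Type*} [NormedAddCommGroup F] [NormedSpace ℝ F] {σ : ℝ → E → F}

lemma IsRegularCoefficient.isBLO (hσ : IsRegularCoefficient T K σ) {r : ShortTriple T → ℝ}
    (hr : ∀ i, r i ∈ Icc 0 T) : IsBLO 1 (fun i => σ (r i)) :=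
  ⟨K, hσ.nonneg, fun i => by simpa using (hσ.space _ (hr i)).toIsBL⟩

lemma IsRegularCoefficient.isBLO_fderiv (hσ : IsRegularCoefficient T K σ) :
    IsBLO 1 (fun i : ShortTriple T => fderiv ℝ (σ i.s)) :=
  ⟨K, hσ.nonneg, fun i => by simpa using (hσ.space_deriv _ i.left_mem).toIsBL⟩

lemma IsRegularCoefficient.isBLO_time_sub (hσ : IsRegularCoefficient T K σ) :
    IsBLO (gauge T (2 / 3)) (fun i x => σ i.u x - σ i.s x) :=
  ⟨K, hσ.nonneg, fun i => (hσ.isBL_time_sub i.left_mem i.mid_mem i.le_mid i.left_short).mono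
    (mul_le_mul_of_nonneg_left (i.left_rpow_le (by norm_num) le_rfl) hσ.nonneg)⟩

lemma IsRegularCoefficient.isBLO_time_fderiv_sub (hσ : IsRegularCoefficient T K σ) :
    IsBLO (gauge T (1 / 3)) (fun i x => fderiv ℝ (σ i.u) x - fderiv ℝ (σ i.s) x) :=
  ⟨K, hσ.nonneg, fun i => (hσ.isBL_time_fderiv_sub i.left_mem i.mid_mem i.le_mid
    i.left_short).mono (mul_le_mul_of_nonneg_left (i.left_rpow_le (by norm_num) le_rfl) hσ.nonneg)⟩

end TimeIncrements

variable {σ : ℝ → E → Vec d →L[ℝ] E}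

lemma IsRegularCoefficient.isBLO_time_gubinelliDeriv_sub (hσ : IsRegularCoefficient T K σ) :
    IsBLO (gauge T (1 / 3)) (fun i x => gubinelliDeriv σ i.u x - gubinelliDeriv σ i.s x) := by
  have h1 := hσ.isBLO_time_fderiv_sub.clm_comp (hσ.isBLO fun i => i.mid_mem)
  have h2 := (hσ.isBLO_fderiv.clm_comp hσ.isBLO_time_sub).mono (w' := gauge T (1 / 3)) (by
    rw [one_mul]
    exact gauge_le_gauge (by norm_num) (by norm_num))
  rw [mul_one] at h1
  convert h1.add h2 using 3 with i x
  ext a b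
  simp [gubinelliDeriv]

lemma isBLO_roughGerm (hα : 1 / 3 < α) (hζ : IsRoughPath T α ζ Z)
    (hσ : IsRegularCoefficient T K σ) :
    IsBLO (gauge T (1 / 3)) (fun i => roughGerm ζ Z σ i.s i.u) := by
  obtain ⟨C, hC, hgerm⟩ := exists_isBL₂_roughGerm (by linarith) hζ hσ
  exact ⟨C, hC, fun i => (hgerm _ _ i.nonneg i.le_mid i.mid_mem.2 i.left_short).toIsBL.mono
    (mul_le_mul_of_nonneg_left (i.left_rpow_le (by norm_num) hα.le) hC)⟩

/-- The first order term of the defect: a time increment, a Taylor remainder, and the term with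
the area over `[s, u]`, which is not compensated. -/
lemma isBLO_first_order_defect (hα : 1 / 3 < α) (hζ : IsRoughPath T α ζ Z)
    (hσ : IsRegularCoefficient T K σ) :
    IsBLO (gauge T (2 / 3)) (fun i x => σ i.u (x + roughGerm ζ Z σ i.s i.u x) - σ i.s x
      - fderiv ℝ (σ i.s) x (σ i.s x (inc ζ i.s i.u))) := by
  obtain ⟨c, hc, hcζ⟩ := hζ.exists_bound
  have hv := isBLO_roughGerm hα hζ hσ
  have time : IsBLO (gauge T (2 / 3)) (fun i x => σ i.u (x + roughGerm ζ Z σ i.s i.u x)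
      - σ i.s (x + roughGerm ζ Z σ i.s i.u x)) :=
    hσ.isBLO_time_sub.comp_id_add hv
      ((gauge_le_gauge le_rfl (by norm_num)).trans_eq gauge_zero)
  have taylor := hv.taylor hσ.nonneg (fun i x => hσ.hasFDerivAt i.left_mem x)
    fun i => hσ.space_deriv _ i.left_mem
  have area : IsBLO (gauge T (2 / 3)) (fun i x => fderiv ℝ (σ i.s) x
      (contract (gubinelliDeriv σ i.s x) (Z i.s i.u))) := by
    have hS : IsBLO 1 (fun i : ShortTriple T => gubinelliDeriv σ i.s) := by
      rw [← one_mul 1]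
      exact hσ.isBLO_fderiv.clm_comp (hσ.isBLO fun i => i.left_mem)
    have hZ (i : ShortTriple T) : ‖Z i.s i.u‖ ≤ c * gauge T (2 / 3) i :=
      (hcζ _ _ i.nonneg i.le_mid i.mid_mem.2).2.trans
        (mul_le_mul_of_nonneg_left (i.left_rpow_le (by norm_num) (by linarith)) hc)
    simpa only [one_mul, contractCLM_apply] using hσ.isBLO_fderiv.clm_apply
      (hS.clm (c := (d : ℝ) ^ 2 * c) (by positivity) fun i =>
        (norm_contractCLM_le (V := E) _).trans (by rw [mul_assoc]; gcongr; exact hZ i))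
  rw [gauge_mul_gauge (by norm_num) (by norm_num)] at taylor
  norm_num only at taylor
  convert (time.add taylor).add area using 3 with i x
  rw [roughGerm, map_add]
  abel

lemma isBLO_gubinelliDeriv_defect (hα : 1 / 3 < α) (hζ : IsRoughPath T α ζ Z)
    (hσ : IsRegularCoefficient T K σ) :
    IsBLO (gauge T (1 / 3)) (fun i x =>
      gubinelliDeriv σ i.u (x + roughGerm ζ Z σ i.s i.u x) - gubinelliDeriv σ i.s x) := by
  have hv := isBLO_roughGerm hα hζ hσ
  have hK := hσ.nonneg
  have time := hσ.isBLO_time_gubinelliDeriv_sub.comp_id_add hv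
    ((gauge_le_gauge le_rfl (by norm_num)).trans_eq gauge_zero)
  have space := hv.increment (by positivity) fun i => hσ.isBL₂_gubinelliDeriv i.left_mem
  simpa only [sub_add_sub_cancel] using time.add space

lemma isBLO_roughGerm_defect (hα : 1 / 3 < α) (hζ : IsRoughPath T α ζ Z)
    (hσ : IsRegularCoefficient T K σ) :
    IsBLO (gauge T (2 / 3 + α)) (fun i x => roughGerm ζ Z σ i.s i.t x
      - roughGerm ζ Z σ i.s i.u x - roughGerm ζ Z σ i.u i.t (x + roughGerm ζ Z σ i.s i.u x)) := by
  obtain ⟨c, hc, hcζ⟩ := hζ.exists_bound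
  have hζ_ut (i : ShortTriple T) :
      ‖ContinuousLinearMap.apply ℝ E (inc ζ i.u i.t)‖ ≤ c * gauge T α i :=
    (ContinuousLinearMap.opNorm_le_bound _ (norm_nonneg _)
      fun L => by rw [mul_comm]; exact L.le_opNorm _).trans
      ((hcζ _ _ i.mid_mem.1 i.mid_le i.le_end).1.trans
        (mul_le_mul_of_nonneg_left (i.right_rpow_le (by linarith) le_rfl) hc))
  have hZ_ut (i : ShortTriple T) : ‖Z i.u i.t‖ ≤ c * gauge T (1 / 3 + α) i :=
    (hcζ _ _ i.mid_mem.1 i.mid_le i.le_end).2.trans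
      (mul_le_mul_of_nonneg_left (i.right_rpow_le (by linarith) (by linarith)) hc)
  have first := (isBLO_first_order_defect hα hζ hσ).clm hc hζ_ut
  have second := (isBLO_gubinelliDeriv_defect hα hζ hσ).clm (c := (d : ℝ) ^ 2 * c)
    (by positivity) fun i => (norm_contractCLM_le (V := E) _).trans
      (by rw [mul_assoc]; gcongr; exact hZ_ut i)
  rw [gauge_mul_gauge (by norm_num) (by linarith)] at first second
  rw [← add_assoc] at second
  norm_num only at second
  convert (first.add second).neg using 3 with i x
  exact roughGerm_defect hζ σ i.nonneg i.le_mid i.mid_le i.le_end _ _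

lemma exists_isAlmostFlow_roughGerm (hα : 1 / 3 < α) (hζ : IsRoughPath T α ζ Z)
    (hσ : IsRegularCoefficient T K σ) : ∃ C, IsAlmostFlow T α C (roughGerm ζ Z σ) := by
  obtain ⟨C, hC, hgerm⟩ := exists_isBL₂_roughGerm (by linarith) hζ hσ
  obtain ⟨C', -, hdefect⟩ := isBLO_roughGerm_defect hα hζ hσ
  refine ⟨max C C', hC.trans (le_max_left _ _), fun s t hs hst ht h1 => ?_,
    fun s u t hs hsu hut ht h1 => ?_⟩
  · exact (hgerm s t hs hst ht h1).mono (mul_le_mul_of_nonneg_right (le_max_left _ _)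
      (Real.rpow_nonneg (sub_nonneg.2 hst) _))
  · exact (hdefect ⟨s, u, t, hs, hsu, hut, ht, h1⟩).mono (mul_le_mul_of_nonneg_right
      (le_max_right _ _) (Real.rpow_nonneg (sub_nonneg.2 (hsu.trans hut)) _))

end AlmostFlow

/-! ### Sewing -/

section Sewing

variable {E : Type*} [NormedAddCommGroup E] {J : ℝ → ℝ → E} {a b h θ θ' ε L M : ℝ}

lemma half_sub_rpow {s t : ℝ} (hst : s ≤ t) (θ : ℝ) :
    ((s + t) / 2 - s) ^ θ = (1 / 2) ^ θ * (t - s) ^ θ ∧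
      (t - (s + t) / 2) ^ θ = (1 / 2) ^ θ * (t - s) ^ θ := by
  rw [← Real.mul_rpow (by norm_num) (sub_nonneg.2 hst)]
  constructor <;> ring_nf

lemma two_add_mul_half_rpow_lt_one (hθ : 1 < θ) : (2 + 0) * (1 / 2 : ℝ) ^ θ < 1 := by
  have := Real.rpow_lt_rpow_of_exponent_gt (x := 1 / 2) (by norm_num) (by norm_num) hθ
  rw [Real.rpow_one] at this
  linarith

lemma norm_le_of_midpoint (hε : 0 ≤ ε) (hθ : (2 + ε) * (1 / 2) ^ θ < 1)
    (hθ' : (2 + ε) * (1 / 2) ^ θ' < 1) (hM : 0 ≤ M)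
    (hJ : ∀ s t, a ≤ s → s ≤ t → t ≤ b → t - s ≤ h → ‖J s t‖ ≤ L * (t - s) ^ θ')
    (hδ : ∀ s t, a ≤ s → s ≤ t → t ≤ b → t - s ≤ h →
      ‖J s t‖ ≤ (1 + ε) * ‖J s ((s + t) / 2)‖ + ‖J ((s + t) / 2) t‖ + M * (t - s) ^ θ)
    {s t : ℝ} (hs : a ≤ s) (hst : s ≤ t) (ht : t ≤ b) (hh : t - s ≤ h) :
    ‖J s t‖ ≤ M / (1 - (2 + ε) * (1 / 2) ^ θ) * (t - s) ^ θ := by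
  set ρ := (2 + ε) * (1 / 2 : ℝ) ^ θ with hρ
  set ρ' := (2 + ε) * (1 / 2 : ℝ) ^ θ' with hρ'
  have h1 : 0 < 1 - ρ := sub_pos.2 hθ
  have iterate : ∀ n : ℕ, ∀ s t, a ≤ s → s ≤ t → t ≤ b → t - s ≤ h →
      ‖J s t‖ ≤ M / (1 - ρ) * (t - s) ^ θ + ρ' ^ n * (L * (t - s) ^ θ') := by
    intro n
    induction n with
    | zero =>
      intro s t hs hst ht hh
      have : 0 ≤ M / (1 - ρ) * (t - s) ^ θ :=
        mul_nonneg (by positivity) (Real.rpow_nonneg (sub_nonneg.2 hst) _)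
      linarith [hJ s t hs hst ht hh, pow_zero ρ']
    | succ n ih =>
      intro s t hs hst ht hh
      have left := ih s ((s + t) / 2) hs (by linarith) (by linarith) (by linarith)
      have right := ih ((s + t) / 2) t (by linarith) (by linarith) ht (by linarith)
      rw [(half_sub_rpow hst θ).1, (half_sub_rpow hst θ').1] at left
      rw [(half_sub_rpow hst θ).2, (half_sub_rpow hst θ').2] at right
      calc ‖J s t‖ ≤ _ := hδ s t hs hst ht hh
        _ ≤ (1 + ε) * _ + _ + M * (t - s) ^ θ :=
          add_le_add_left (add_le_add (mul_le_mul_of_nonneg_left left (by positivity)) right) _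
        _ = M / (1 - ρ) * (ρ * (t - s) ^ θ) + ρ' ^ n * (L * (ρ' * (t - s) ^ θ'))
            + M * (t - s) ^ θ := by rw [hρ, hρ']; ring
        _ = _ := by field_simp; ring
  have hlim : Tendsto (fun n : ℕ => M / (1 - ρ) * (t - s) ^ θ + ρ' ^ n * (L * (t - s) ^ θ')) atTop
      (𝓝 (M / (1 - ρ) * (t - s) ^ θ + 0 * (L * (t - s) ^ θ'))) :=
    ((tendsto_pow_atTop_nhds_zero_of_lt_one (by positivity) hθ').mul_const _).const_add _
  simpa only [zero_mul, add_zero] using ge_of_tendsto' hlim fun n => iterate n s t hs hst ht hh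

lemma rpow_mul_le_rpow {τ α β γ : ℝ} (hτ : 0 ≤ τ) (h1 : τ ≤ 1) (hα : 0 ≤ α) (hβ : 0 ≤ β)
    (hγ : 0 ≤ γ) (h : γ ≤ α + β) : τ ^ α * τ ^ β ≤ τ ^ γ := by
  rw [← Real.rpow_add_of_nonneg hτ hα hβ]
  exact Real.rpow_le_rpow_of_exponent_ge' hτ h1 hγ h

/-- The first application of `norm_le_of_midpoint` shows that `J` is of order `θ`, with a constant
which involves `L`; the second one removes `L`. -/
lemma norm_le_of_midpoint_of_small {α C : ℝ} (hθ : 1 < θ) (hθ' : 1 < θ') (hα : 0 ≤ α)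
    (hθα : θ ≤ 1 + α) (h1 : h ≤ 1) (hC : 0 ≤ C) (hM : 0 ≤ M) (hL : 0 ≤ L) (hε : C * h ^ α ≤ ε)
    (hρ : (2 + ε) * (1 / 2) ^ θ < 1)
    (hJ : ∀ s t, a ≤ s → s ≤ t → t ≤ b → t - s ≤ h → ‖J s t‖ ≤ L * (t - s) ^ θ')
    (hδ : ∀ s u t, a ≤ s → s ≤ u → u ≤ t → t ≤ b → t - s ≤ h →
      ‖J s t‖ ≤ ‖J s u‖ + ‖J u t‖ + (M * (t - s) ^ θ + C * (t - s) ^ α * ‖J s u‖))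
    {s t : ℝ} (hs : a ≤ s) (hst : s ≤ t) (ht : t ≤ b) (hh : t - s ≤ h) :
    ‖J s t‖ ≤ M / (1 - (2 + ε) * (1 / 2) ^ θ) * (t - s) ^ θ := by
  have h0 : 0 ≤ h := (sub_nonneg.2 hst).trans hh
  have crude : ∀ s t, a ≤ s → s ≤ t → t ≤ b → t - s ≤ h →
      ‖J s t‖ ≤ (M + C * L) / (1 - (2 + 0) * (1 / 2) ^ θ) * (t - s) ^ θ := by
    refine fun s t hs hst ht hh => norm_le_of_midpoint le_rfl
      (two_add_mul_half_rpow_lt_one hθ) (two_add_mul_half_rpow_lt_one hθ') (by positivity) hJ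
      (fun s t hs hst ht hh => ?_) hs hst ht hh
    have hτ : 0 ≤ t - s := sub_nonneg.2 hst
    have hhalf : ‖J s ((s + t) / 2)‖ ≤ L * (t - s) ^ θ' :=
      (hJ s _ hs (by linarith) (by linarith) (by linarith)).trans (mul_le_mul_of_nonneg_left
        (Real.rpow_le_rpow (by linarith) (by linarith) (by linarith)) hL)
    have hdefect : C * (t - s) ^ α * ‖J s ((s + t) / 2)‖ ≤ C * L * (t - s) ^ θ := by
      calc _ ≤ C * (t - s) ^ α * (L * (t - s) ^ θ') := by gcongr
        _ = C * L * ((t - s) ^ α * (t - s) ^ θ') := by ring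
        _ ≤ _ := mul_le_mul_of_nonneg_left (rpow_mul_le_rpow hτ (hh.trans h1) hα (by linarith)
          (by linarith) (by linarith)) (by positivity)
    linarith [hδ s ((s + t) / 2) t hs (by linarith) (by linarith) ht hh]
  refine norm_le_of_midpoint ((by positivity : 0 ≤ C * h ^ α).trans hε) hρ hρ hM crude
    (fun s t hs hst ht hh => ?_) hs hst ht hh
  have : 0 ≤ t - s := sub_nonneg.2 hst
  have hsmall : C * (t - s) ^ α * ‖J s ((s + t) / 2)‖ ≤ ε * ‖J s ((s + t) / 2)‖ :=
    mul_le_mul_of_nonneg_right (le_trans (by gcongr) hε) (norm_nonneg _)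
  linarith [hδ s ((s + t) / 2) t hs (by linarith) (by linarith) ht hh]

lemma exists_pos_mul_rpow_le {α : ℝ} (hα : 0 < α) (C : ℝ) {c : ℝ} (hc : 0 < c) :
    ∃ h, 0 < h ∧ h ≤ 1 ∧ C * h ^ α ≤ c := by
  have hlim : Tendsto (fun h : ℝ => C * h ^ α) (𝓝[>] 0) (𝓝 (C * 0 ^ α)) :=
    ((Real.continuous_rpow_const hα.le).tendsto 0).mono_left nhdsWithin_le_nhds |>.const_mul C
  rw [Real.zero_rpow hα.ne', mul_zero] at hlim
  obtain ⟨h, hle, h0, h1⟩ := ((hlim.eventually (ge_mem_nhds hc)).and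
    (Ioc_mem_nhdsGT (zero_lt_one' ℝ))).exists
  exact ⟨h, h0, h1, hle⟩

lemma exists_sewing_step {α : ℝ} (hα : 1 / 3 < α) (C : ℝ) :
    ∃ h ε, 0 < h ∧ h ≤ 1 ∧ 0 ≤ ε ∧ C * h ^ α ≤ ε ∧ (2 + ε) * (1 / 2) ^ (2 / 3 + α) < 1 := by
  have hq := two_add_mul_half_rpow_lt_one (θ := 2 / 3 + α) (by linarith)
  rw [add_zero] at hq
  have hq0 : (0 : ℝ) < (1 / 2) ^ (2 / 3 + α) := by positivity
  obtain ⟨h, h0, h1, hh⟩ := exists_pos_mul_rpow_le (by linarith : 0 < α) C (sub_pos.2 hq)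
  exact ⟨h, _, h0, h1, (sub_pos.2 hq).le, hh, by nlinarith⟩

end Sewing

section ShortSteps

variable {a b h C : ℝ}

lemma forall_of_short_steps {P : ℕ → ℝ → Prop} (hh : 0 ≤ h) (ha : P 0 a)
    (step : ∀ n s t, a ≤ s → s ≤ t → t ≤ b → t - s ≤ h → P n s → P (n + 1) t) (n : ℕ) :
    ∀ t ∈ Icc a b, t ≤ a + n * h → P n t := by
  induction n with
  | zero =>
    intro t ht hta
    rwa [le_antisymm (by simpa using hta) ht.1]
  | succ n ih =>
    intro t ht hta
    push_cast at hta
    refine step n (max a (t - h)) t (le_max_left _ _) (max_le ht.1 (by linarith)) ht.2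
      (by linarith [le_max_right a (t - h)])
      (ih _ ⟨le_max_left _ _, max_le (ht.1.trans ht.2) (by linarith [ht.2])⟩
        (max_le (le_add_of_nonneg_right (by positivity)) (by linarith)))

lemma le_max_mul_rpow_of_short {μ τ c M : ℝ} (hμ : 0 ≤ μ) (hh : 0 < h) (hτ : 0 ≤ τ)
    (hM₀ : 0 ≤ M) (short : τ ≤ h → c ≤ C * τ ^ μ) (hM : c ≤ M) :
    c ≤ max C (M / h ^ μ) * τ ^ μ := by
  have hhμ : 0 < h ^ μ := Real.rpow_pos_of_pos hh _
  rcases le_total τ h with hτh | hτh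
  · exact (short hτh).trans (mul_le_mul_of_nonneg_right (le_max_left _ _) (Real.rpow_nonneg hτ _))
  · calc c ≤ M / h ^ μ * h ^ μ := by rwa [div_mul_cancel₀ _ hhμ.ne']
      _ ≤ max C (M / h ^ μ) * τ ^ μ := mul_le_mul (le_max_right _ _)
        (Real.rpow_le_rpow hh.le hτh hμ) hhμ.le (le_max_of_le_right (by positivity))

lemma isHolder₂_of_short {V : Type*} [NormedAddCommGroup V] {μ M : ℝ} {g : ℝ → ℝ → V}
    (hμ : 0 ≤ μ) (hh : 0 < h)
    (short : ∀ s t, a ≤ s → s ≤ t → t ≤ b → t - s ≤ h → ‖g s t‖ ≤ C * (t - s) ^ μ)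
    (hM : ∀ s t, a ≤ s → s ≤ t → t ≤ b → ‖g s t‖ ≤ M) : IsHolder₂ μ a b g :=
  ⟨max C (M / h ^ μ), fun s t hs hst ht => le_max_mul_rpow_of_short hμ hh (sub_nonneg.2 hst)
    ((norm_nonneg _).trans (hM s t hs hst ht)) (short s t hs hst ht) (hM s t hs hst ht)⟩

lemma continuousOn_of_short_holder {V : Type*} [NormedAddCommGroup V] {μ : ℝ} {x : ℝ → V}
    (hμ : 0 < μ) (hh : 0 < h)
    (hx : ∀ s t, a ≤ s → s ≤ t → t ≤ b → t - s ≤ h → ‖x t - x s‖ ≤ C * (t - s) ^ μ) :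
    ContinuousOn x (Icc a b) := by
  intro s hs
  have hlim : Tendsto (fun t => C * |t - s| ^ μ) (𝓝[Icc a b] s) (𝓝 0) := by
    have : Continuous fun t : ℝ => C * |t - s| ^ μ :=
      continuous_const.mul ((continuous_id.sub continuous_const).abs.rpow_const
        fun _ => Or.inr hμ.le)
    simpa [Real.zero_rpow hμ.ne'] using (this.tendsto s).mono_left nhdsWithin_le_nhds
  refine tendsto_iff_norm_sub_tendsto_zero.2
    (squeeze_zero' (Eventually.of_forall fun _ => norm_nonneg _) ?_ hlim)
  filter_upwards [nhdsWithin_le_nhds (Metric.closedBall_mem_nhds s hh), self_mem_nhdsWithin]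
    with t hts ht
  rw [Metric.mem_closedBall, Real.dist_eq] at hts
  rcases le_total s t with hst | hst
  · rw [abs_of_nonneg (sub_nonneg.2 hst)] at hts ⊢
    exact hx s t hs.1 hst ht.2 hts
  · rw [abs_sub_comm, abs_of_nonneg (sub_nonneg.2 hst)] at hts ⊢
    rw [norm_sub_rev]
    exact hx t s ht.1 hst hs.2 hts

lemma norm_sub_le_nat_mul_rpow_of_short {V : Type*} [NormedAddCommGroup V] {μ : ℝ} {x : ℝ → V}
    (hμ : 0 ≤ μ) (hh : 0 ≤ h) (hC : 0 ≤ C)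
    (hx : ∀ s t, a ≤ s → s ≤ t → t ≤ b → t - s ≤ h → ‖x t - x s‖ ≤ C * (t - s) ^ μ) (n : ℕ)
    {t : ℝ} (ht : t ∈ Icc a b) (hn : t ≤ a + n * h) : ‖x t - x a‖ ≤ n * (C * (t - a) ^ μ) := by
  refine forall_of_short_steps (b := t) (P := fun n r => ‖x r - x a‖ ≤ n * (C * (t - a) ^ μ)) hh
    (by simp) (fun n r r' hr hrr' hr' hτ hP => ?_) n t ⟨ht.1, le_rfl⟩ hn
  have hstep : ‖x r' - x r‖ ≤ C * (t - a) ^ μ := by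
    have := sub_nonneg.2 hrr'
    exact (hx r r' hr hrr' (hr'.trans ht.2) hτ).trans (by gcongr)
  rw [← sub_add_sub_cancel (x r') (x r) (x a)]
  refine (norm_add_le_of_le hstep hP).trans_eq ?_
  push_cast
  ring

end ShortSteps

/-! ### Flow lines -/

section WeakFlow

variable {E : Type*} [NormedAddCommGroup E]

/-- A version of `IsAlmostFlow` on `[a, T]`, with weaker regularity in space, which allows for a
Lipschitz drift. -/
structure IsWeakFlow (a T α C : ℝ) (G : ℝ → ℝ → E → E) : Prop where
  nonneg : 0 ≤ C
  bound : ∀ s t, a ≤ s → s ≤ t → t ≤ T → t - s ≤ 1 → ∀ x, ‖G s t x‖ ≤ C * (t - s) ^ α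
  lip : ∀ s t, a ≤ s → s ≤ t → t ≤ T → t - s ≤ 1 → ∀ x y,
    ‖G s t x - G s t y‖ ≤ C * (t - s) ^ α * ‖x - y‖
  defect : ∀ s u t, a ≤ s → s ≤ u → u ≤ t → t ≤ T → t - s ≤ 1 → ∀ x,
    ‖G s t x - G s u x - G u t (x + G s u x)‖ ≤ C * (t - s) ^ (2 / 3 + α)

/-- The error `x_t - x_s - G_{st}(x_s)` made by following `G` instead of the path `x`. -/
def flowError (G : ℝ → ℝ → E → E) (x : ℝ → E) (s t : ℝ) : E := x t - x s - G s t (x s)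

/-- The path `x` has the increments of the flow `G`, up to an error of order larger than one. -/
def IsFlowLine (a T : ℝ) (G : ℝ → ℝ → E → E) (x : ℝ → E) : Prop :=
  ∃ θ L : ℝ, 1 < θ ∧ 0 ≤ L ∧ ∀ s t, a ≤ s → s ≤ t → t ≤ T → t - s ≤ 1 →
    ‖flowError G x s t‖ ≤ L * (t - s) ^ θ

variable {a T α C h ε : ℝ} {G : ℝ → ℝ → E → E} {x : ℝ → E}

lemma IsFlowLine.mono {a' : ℝ} (hx : IsFlowLine a T G x) (h : a ≤ a') : IsFlowLine a' T G x := by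
  obtain ⟨θ, L, hθ, hL, hx⟩ := hx
  exact ⟨θ, L, hθ, hL, fun s t hs => hx s t (h.trans hs)⟩

lemma IsWeakFlow.norm_flowError_le (hG : IsWeakFlow a T α C G) (hα : 0 ≤ α) (x : ℝ → E)
    {s u t : ℝ} (hs : a ≤ s) (hsu : s ≤ u) (hut : u ≤ t) (ht : t ≤ T) (h : t - s ≤ 1) :
    ‖flowError G x s t‖ ≤ ‖flowError G x s u‖ + ‖flowError G x u t‖
      + (C * (t - s) ^ (2 / 3 + α) + C * (t - s) ^ α * ‖flowError G x s u‖) := by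
  have hC := hG.nonneg
  have split : flowError G x s t = flowError G x s u + flowError G x u t
      + (-(G s t (x s) - G s u (x s) - G u t (x s + G s u (x s)))
        + (G u t (x u) - G u t (x s + G s u (x s)))) := by
    simp only [flowError]
    abel
  have hlip := hG.lip u t (hs.trans hsu) hut ht (by linarith) (x u) (x s + G s u (x s))
  have hpow : (t - u) ^ α ≤ (t - s) ^ α := Real.rpow_le_rpow (by linarith) (by linarith) hα
  rw [split]
  refine (norm_add_le _ _).trans (add_le_add (norm_add_le _ _) ((norm_add_le _ _).trans
    (add_le_add ?_ (hlip.trans ?_))))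
  · rw [norm_neg]
    exact hG.defect s u t hs hsu hut ht h (x s)
  · rw [← sub_sub, ← flowError]
    gcongr

lemma IsWeakFlow.norm_increment_le (hG : IsWeakFlow a T α C G) {s t : ℝ} (hs : a ≤ s)
    (hst : s ≤ t) (ht : t ≤ T) (h : t - s ≤ 1) :
    ‖x t - x s‖ ≤ C * (t - s) ^ α + ‖flowError G x s t‖ := by
  have := norm_add_le (G s t (x s)) (flowError G x s t)
  rw [flowError, add_sub_cancel] at this
  exact this.trans (add_le_add_left (hG.bound s t hs hst ht h (x s)) _)

lemma IsWeakFlow.norm_increment_le_of_flowError_le (hG : IsWeakFlow a T α C G) (hα : 0 ≤ α)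
    {L s t : ℝ} (hL : 0 ≤ L) (hs : a ≤ s) (hst : s ≤ t) (ht : t ≤ T) (h : t - s ≤ 1)
    (hx : ‖flowError G x s t‖ ≤ L * (t - s) ^ (2 / 3 + α)) :
    ‖x t - x s‖ ≤ (C + L) * (t - s) ^ α := by
  have hpow : (t - s) ^ (2 / 3 + α) ≤ (t - s) ^ α :=
    Real.rpow_le_rpow_of_exponent_ge' (sub_nonneg.2 hst) h hα (by linarith)
  rw [add_mul]
  exact (hG.norm_increment_le hs hst ht h).trans
    (add_le_add_right (hx.trans (mul_le_mul_of_nonneg_left hpow hL)) _)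

lemma IsFlowLine.norm_flowError_le (hx : IsFlowLine a T G x) (hG : IsWeakFlow a T α C G)
    (hα : 1 / 3 < α) (h1 : h ≤ 1) (hε : C * h ^ α ≤ ε) (hρ : (2 + ε) * (1 / 2) ^ (2 / 3 + α) < 1)
    {s t : ℝ} (hs : a ≤ s) (hst : s ≤ t) (ht : t ≤ T) (hτ : t - s ≤ h) :
    ‖flowError G x s t‖
      ≤ C / (1 - (2 + ε) * (1 / 2) ^ (2 / 3 + α)) * (t - s) ^ (2 / 3 + α) := by
  obtain ⟨θ, L, hθ, hL, hx⟩ := hx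
  exact norm_le_of_midpoint_of_small (by linarith) hθ (by linarith) (by linarith) h1 hG.nonneg
    hG.nonneg hL hε hρ (fun s t hs hst ht hτ => hx s t hs hst ht (hτ.trans h1))
    (fun s u t hs hsu hut ht hτ =>
      hG.norm_flowError_le (by linarith) x hs hsu hut ht (hτ.trans h1)) hs hst ht hτ

lemma IsWeakFlow.isFlowLine_of_short (hG : IsWeakFlow a T α C G) (hα : 1 / 3 < α) {L : ℝ}
    (h0 : 0 < h) (h1 : h ≤ 1) (hL : 0 ≤ L)
    (hx : ∀ s t, a ≤ s → s ≤ t → t ≤ T → t - s ≤ h →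
      ‖flowError G x s t‖ ≤ L * (t - s) ^ (2 / 3 + α)) : IsFlowLine a T G x := by
  have hcont : ContinuousOn x (Icc a T) := continuousOn_of_short_holder (by linarith) h0
    fun s t hs hst ht hτ => hG.norm_increment_le_of_flowError_le (by linarith) hL hs hst ht
      (hτ.trans h1) (hx s t hs hst ht hτ)
  obtain ⟨M, hM⟩ := isCompact_Icc.exists_bound_of_continuousOn hcont
  have hbound : ∀ s t, a ≤ s → s ≤ t → t ≤ T → t - s ≤ 1 →
      ‖flowError G x s t‖ ≤ M + M + C := by
    intro s t hs hst ht hτ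
    refine (norm_sub_le _ _).trans (add_le_add ((norm_sub_le _ _).trans (add_le_add
      (hM t ⟨hs.trans hst, ht⟩) (hM s ⟨hs, hst.trans ht⟩))) ?_)
    exact (hG.bound s t hs hst ht hτ _).trans (mul_le_of_le_one_right hG.nonneg
      (Real.rpow_le_one (sub_nonneg.2 hst) hτ (by linarith)))
  exact ⟨2 / 3 + α, max L ((M + M + C) / h ^ (2 / 3 + α)), by linarith, le_max_of_le_left hL,
    fun s t hs hst ht hτ => le_max_mul_rpow_of_short (by linarith) h0 (sub_nonneg.2 hst)
      ((norm_nonneg _).trans (hbound s t hs hst ht hτ)) (hx s t hs hst ht)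
      (hbound s t hs hst ht hτ)⟩

end WeakFlow

/-! ### Existence of flow lines -/

section Euler

/-- The points `p < q` of the finite set `P` are neighbours: no point of `P` lies between them. -/
def IsConsecutive {ι : Type*} [LinearOrder ι] (P : Finset ι) (p q : ι) : Prop :=
  p ∈ P ∧ q ∈ P ∧ p < q ∧ ∀ r ∈ P, r ≤ p ∨ q ≤ r

lemma exists_isConsecutive {ι : Type*} [LinearOrder ι] {P : Finset ι} {s m t : ι} (hs : s ∈ P)
    (ht : t ∈ P) (hsm : s ≤ m) (hmt : m < t) :
    ∃ l r, IsConsecutive P l r ∧ s ≤ l ∧ l ≤ m ∧ m < r ∧ r ≤ t := by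
  have hs' : s ∈ P.filter (· ≤ m) := Finset.mem_filter.2 ⟨hs, hsm⟩
  have ht' : t ∈ P.filter (m < ·) := Finset.mem_filter.2 ⟨ht, hmt⟩
  obtain ⟨hlP, hlm⟩ := Finset.mem_filter.1 ((P.filter (· ≤ m)).max'_mem ⟨s, hs'⟩)
  obtain ⟨hrP, hmr⟩ := Finset.mem_filter.1 ((P.filter (m < ·)).min'_mem ⟨t, ht'⟩)
  refine ⟨_, _, ⟨hlP, hrP, hlm.trans_lt hmr, fun p hp => ?_⟩, Finset.le_max' _ s hs', hlm, hmr,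
    Finset.min'_le _ t ht'⟩
  exact (le_or_gt p m).imp (fun h => Finset.le_max' _ p (Finset.mem_filter.2 ⟨hp, h⟩))
    (fun h => Finset.min'_le _ p (Finset.mem_filter.2 ⟨hp, h⟩))

lemma card_filter_Ioc_lt {ι : Type*} [LinearOrder ι] {P : Finset ι} {s s' t t' p : ι}
    (hs : s ≤ s') (ht : t' ≤ t) (hp : p ∈ P) (hst : p ∈ Ioc s t) (hst' : p ∉ Ioc s' t') :
    (P.filter (· ∈ Ioc s' t')).card < (P.filter (· ∈ Ioc s t)).card :=
  Finset.card_lt_card <| (Finset.ssubset_iff_of_subset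
    (Finset.monotone_filter_right P fun _ _ h => Ioc_subset_Ioc hs ht h)).2
    ⟨p, Finset.mem_filter.2 ⟨hp, hst⟩, fun h => hst' (Finset.mem_filter.1 h).2⟩

lemma exists_euler_scheme {ι E : Type*} [LinearOrder ι] [Add E] (G : ι → ι → E → E) (a : ι)
    (y : E) (P : Finset ι) (hP : ∀ p ∈ P, a < p) :
    ∃ x : ι → E, x a = y ∧
      ∀ p q, IsConsecutive (insert a P) p q → x q = x p + G p q (x p) := by
  induction P using Finset.induction_on_max with
  | empty =>
    refine ⟨fun _ => y, rfl, fun p q ⟨hp, hq, hpq, _⟩ => absurd hpq ?_⟩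
    rw [insert_empty_eq, Finset.mem_singleton] at hp hq
    rw [hp, hq]
    exact lt_irrefl a
  | insert b P hb ih =>
    obtain ⟨x, hxa, hx⟩ := ih fun p hp => hP p (Finset.mem_insert_of_mem hp)
    have hab : a < b := hP b (Finset.mem_insert_self _ _)
    have hlt : ∀ p ∈ insert a P, p < b := Finset.forall_mem_insert _ _ _ |>.2 ⟨hab, hb⟩
    set c := (insert a P).max' (Finset.insert_nonempty _ _)
    have hc : c ∈ insert a P := Finset.max'_mem _ _
    refine ⟨Function.update x b (x c + G c b (x c)), by rw [Function.update_of_ne hab.ne, hxa],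
      ?_⟩
    rw [Finset.insert_comm]
    rintro p q ⟨hp, hq, hpq, hcons⟩
    rcases Finset.mem_insert.1 hq with rfl | hq
    · have hp' : p ∈ insert a P := (Finset.mem_insert.1 hp).resolve_left hpq.ne
      have hpc : p = c := le_antisymm (Finset.le_max' _ _ hp')
        ((hcons c (Finset.mem_insert_of_mem hc)).resolve_right (hlt c hc).not_ge)
      rw [Function.update_self, hpc, Function.update_of_ne (hlt c hc).ne]
    · have hp' : p ∈ insert a P := (Finset.mem_insert.1 hp).resolve_left (hpq.trans (hlt q hq)).ne
      rw [Function.update_of_ne (hlt q hq).ne, Function.update_of_ne (hlt p hp').ne]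
      exact hx p q ⟨hp', hq, hpq, fun r hr => hcons r (Finset.mem_insert_of_mem hr)⟩

/-- The discrete counterpart of `norm_le_of_midpoint`. The midpoint lies between two neighbours of
`P`, so that removing it costs the defect twice. -/
lemma norm_le_of_isConsecutive {E : Type*} [NormedAddCommGroup E] {J : ℝ → ℝ → E}
    {P : Finset ℝ} {h θ ε M : ℝ} (hθ₀ : 0 ≤ θ) (hε : 0 ≤ ε) (hθ : (2 + ε) * (1 / 2) ^ θ < 1)
    (hM : 0 ≤ M) (hdiag : ∀ s ∈ P, J s s = 0) (hJ : ∀ p q, IsConsecutive P p q → J p q = 0)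
    (hδ : ∀ s ∈ P, ∀ u ∈ P, ∀ t ∈ P, s ≤ u → u ≤ t → t - s ≤ h →
      ‖J s t‖ ≤ (1 + ε) * ‖J s u‖ + ‖J u t‖ + M * (t - s) ^ θ)
    {s t : ℝ} (hs : s ∈ P) (ht : t ∈ P) (hst : s ≤ t) (hτ : t - s ≤ h) :
    ‖J s t‖ ≤ 2 * M / (1 - (2 + ε) * (1 / 2) ^ θ) * (t - s) ^ θ := by
  set ρ := (2 + ε) * (1 / 2 : ℝ) ^ θ with hρ
  set K := 2 * M / (1 - ρ) with hK
  have hρ₁ : 0 < 1 - ρ := sub_pos.2 hθ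
  have hK₀ : 0 ≤ K := by positivity
  induction hn : (P.filter (· ∈ Ioc s t)).card using Nat.strong_induction_on
    generalizing s t with
  | h n ih =>
    rcases hst.eq_or_lt with rfl | hst'
    · rw [hdiag s hs, norm_zero]
      exact mul_nonneg hK₀ (Real.rpow_nonneg (sub_nonneg.2 le_rfl) _)
    obtain ⟨l, r, hlr, hsl, hlm, hmr, hrt⟩ := exists_isConsecutive (m := (s + t) / 2) hs ht
      (by linarith) (by linarith)
    have ⟨hl, hr, hlr', _⟩ := hlr
    have half : ∀ τ, 0 ≤ τ → τ ≤ (t - s) / 2 → τ ^ θ ≤ (1 / 2) ^ θ * (t - s) ^ θ := by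
      intro τ h0 hle
      rw [← Real.mul_rpow (by norm_num) (by linarith)]
      exact Real.rpow_le_rpow h0 (by linarith) hθ₀
    have left : ‖J s l‖ ≤ K * ((1 / 2) ^ θ * (t - s) ^ θ) :=
      (ih _ (hn ▸ card_filter_Ioc_lt le_rfl (hlr'.le.trans hrt) ht ⟨hst', le_rfl⟩
        fun h => (hlr'.trans_le hrt).not_ge h.2) hs hl hsl (by linarith) rfl).trans
        (mul_le_mul_of_nonneg_left (half _ (by linarith) (by linarith)) hK₀)
    have right : ‖J r t‖ ≤ K * ((1 / 2) ^ θ * (t - s) ^ θ) :=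
      (ih _ (hn ▸ card_filter_Ioc_lt (by linarith) le_rfl hr ⟨by linarith, hrt⟩
        fun h => lt_irrefl _ h.1) hr ht hrt (by linarith) rfl).trans
        (mul_le_mul_of_nonneg_left (half _ (by linarith) (by linarith)) hK₀)
    have hlt := hδ l hl r hr t ht hlr'.le hrt (by linarith)
    rw [hJ l r hlr, norm_zero, mul_zero, zero_add] at hlt
    have hpow : M * (t - l) ^ θ ≤ M * (t - s) ^ θ :=
      mul_le_mul_of_nonneg_left (Real.rpow_le_rpow (by linarith) (by linarith) hθ₀) hM
    calc ‖J s t‖ ≤ (1 + ε) * ‖J s l‖ + ‖J l t‖ + M * (t - s) ^ θ :=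
          hδ s hs l hl t ht hsl (by linarith) hτ
      _ ≤ (1 + ε) * (K * ((1 / 2) ^ θ * (t - s) ^ θ)) + (K * ((1 / 2) ^ θ * (t - s) ^ θ)
          + M * (t - s) ^ θ) + M * (t - s) ^ θ := by gcongr; linarith
      _ = (K * ρ + 2 * M) * (t - s) ^ θ := by rw [hρ]; ring
      _ = K * (t - s) ^ θ := by rw [hK]; field_simp; ring

variable {E : Type*} [NormedAddCommGroup E] {a T α C h ε : ℝ} {G : ℝ → ℝ → E → E}

lemma IsWeakFlow.norm_flowError_le_of_isConsecutive (hG : IsWeakFlow a T α C G) (hα : 1 / 3 < α)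
    (h1 : h ≤ 1) (hε₀ : 0 ≤ ε) (hε : C * h ^ α ≤ ε) (hρ : (2 + ε) * (1 / 2) ^ (2 / 3 + α) < 1)
    {P : Finset ℝ} (hP : ∀ p ∈ P, p ∈ Icc a T) {x : ℝ → E}
    (hx : ∀ p q, IsConsecutive P p q → x q = x p + G p q (x p))
    {s t : ℝ} (hs : s ∈ P) (ht : t ∈ P) (hst : s ≤ t) (hτ : t - s ≤ h) :
    ‖flowError G x s t‖
      ≤ 2 * C / (1 - (2 + ε) * (1 / 2) ^ (2 / 3 + α)) * (t - s) ^ (2 / 3 + α) := by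
  have hC := hG.nonneg
  refine norm_le_of_isConsecutive (by linarith) hε₀ hρ hC (fun s hs => ?_)
    (fun p q hpq => by rw [flowError, hx p q hpq]; abel)
    (fun s hs u _ t ht hsu hut hτ => ?_) hs ht hst hτ
  · have hG₀ := hG.bound s s (hP s hs).1 le_rfl (hP s hs).2 (by simp) (x s)
    rw [sub_self, Real.zero_rpow (by linarith), mul_zero, norm_le_zero_iff] at hG₀
    rw [flowError, hG₀, sub_self, sub_zero]
  · have hsmall : C * (t - s) ^ α * ‖flowError G x s u‖ ≤ ε * ‖flowError G x s u‖ := by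
      have : 0 ≤ t - s := by linarith
      refine mul_le_mul_of_nonneg_right (le_trans ?_ hε) (norm_nonneg _)
      gcongr
    linarith [hG.norm_flowError_le (by linarith) x (hP s hs).1 hsu hut (hP t ht).2
      (hτ.trans h1)]

lemma IsWeakFlow.continuous (hG : IsWeakFlow a T α C G) {s t : ℝ} (hs : a ≤ s) (hst : s ≤ t)
    (ht : t ≤ T) (h : t - s ≤ 1) : Continuous (G s t) := by
  refine continuous_iff_continuousAt.2 fun z => tendsto_iff_norm_sub_tendsto_zero.2
    (squeeze_zero (fun _ => norm_nonneg _) (fun w => hG.lip s t hs hst ht h w z) ?_)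
  have : Continuous fun w : E => C * (t - s) ^ α * ‖w - z‖ := by fun_prop
  simpa only [sub_self, norm_zero, mul_zero] using this.tendsto z

lemma exists_tendsto_ultrafilter [ProperSpace E] {ι : Type*} (U : Ultrafilter ι) {X : ι → E}
    {M : ℝ} (hX : ∀ᶠ i in U, ‖X i‖ ≤ M) : ∃ l, Tendsto X U (𝓝 l) := by
  obtain ⟨l, -, hl⟩ := (isCompact_closedBall (0 : E) M).ultrafilter_le_nhds (U.map X)
    (le_principal_iff.2 (hX.mono fun i hi => mem_closedBall_zero_iff.2 hi))
  exact ⟨l, hl⟩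

section Limit

variable {ι : Type*} {F : Filter ι} {X : ι → ℝ → E} {y : E} {L : ℝ}

lemma IsWeakFlow.exists_eventually_norm_le (hG : IsWeakFlow a T α C G) (hα : 0 ≤ α) (h0 : 0 < h)
    (h1 : h ≤ 1) (hL : 0 ≤ L) (hXa : ∀ i, X i a = y)
    (hX : ∀ s ∈ Icc a T, ∀ t ∈ Icc a T, s ≤ t → t - s ≤ h → ∀ᶠ i in F,
      ‖flowError G (X i) s t‖ ≤ L * (t - s) ^ (2 / 3 + α)) {t : ℝ} (ht : t ∈ Icc a T) :
    ∃ M, ∀ᶠ i in F, ‖X i t‖ ≤ M := by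
  obtain ⟨n, hn⟩ := exists_nat_ge ((t - a) / h)
  rw [div_le_iff₀ h0] at hn
  refine forall_of_short_steps (P := fun _ t => ∃ M, ∀ᶠ i in F, ‖X i t‖ ≤ M) h0.le
    ⟨‖y‖, Eventually.of_forall fun i => by rw [hXa]⟩ (fun _ s t hs hst ht hτ ⟨M, hM⟩ => ?_) n t ht
    (by linarith)
  refine ⟨M + (C + L) * (t - s) ^ α, ?_⟩
  filter_upwards [hM, hX s ⟨hs, hst.trans ht⟩ t ⟨hs.trans hst, ht⟩ hst hτ] with i hi herr
  linarith [norm_le_norm_add_norm_sub' (X i t) (X i s),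
    hG.norm_increment_le_of_flowError_le hα hL hs hst ht (hτ.trans h1) herr]

lemma IsWeakFlow.isFlowLine_of_tendsto [F.NeBot] (hG : IsWeakFlow a T α C G) (hα : 1 / 3 < α)
    (h0 : 0 < h) (h1 : h ≤ 1) (hL : 0 ≤ L)
    (hX : ∀ s ∈ Icc a T, ∀ t ∈ Icc a T, s ≤ t → t - s ≤ h → ∀ᶠ i in F,
      ‖flowError G (X i) s t‖ ≤ L * (t - s) ^ (2 / 3 + α))
    {x : ℝ → E} (hx : ∀ t ∈ Icc a T, Tendsto (fun i => X i t) F (𝓝 (x t))) :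
    IsFlowLine a T G x := by
  refine hG.isFlowLine_of_short hα h0 h1 hL fun s t hs hst ht hτ => ?_
  have hs' : s ∈ Icc a T := ⟨hs, hst.trans ht⟩
  have ht' : t ∈ Icc a T := ⟨hs.trans hst, ht⟩
  have hGx := ((hG.continuous hs hst ht (hτ.trans h1)).tendsto (x s)).comp (hx s hs')
  exact le_of_tendsto (((hx t ht').sub (hx s hs')).sub hGx).norm (hX s hs' t ht' hst hτ)

end Limit

/-- The flow line is a limit of Euler schemes along an ultrafilter of finite sets of times. -/
lemma IsWeakFlow.exists_isFlowLine [ProperSpace E] (hG : IsWeakFlow a T α C G) (hα : 1 / 3 < α)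
    (y : E) : ∃ x : ℝ → E, x a = y ∧ IsFlowLine a T G x := by
  rcases lt_or_ge T a with hTa | haT
  · exact ⟨fun _ => y, rfl, 2, 0, by norm_num, le_rfl, fun s t hs hst ht => by linarith⟩
  have hC := hG.nonneg
  obtain ⟨h, ε, h0, h1, hε₀, hε, hρ⟩ := exists_sewing_step hα C
  have hL : 0 ≤ 2 * C / (1 - (2 + ε) * (1 / 2) ^ (2 / 3 + α)) :=
    div_nonneg (by positivity) (sub_pos.2 hρ).le
  let P : Finset ℝ → Finset ℝ := fun S => S.filter (· ∈ Ioc a T)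
  choose X hXa hX using fun S => exists_euler_scheme G a y (P S) fun p hp =>
    (Finset.mem_filter.1 hp).2.1
  have hP : ∀ S, ∀ p ∈ insert a (P S), p ∈ Icc a T := fun S => (Finset.forall_mem_insert _ _ _).2
    ⟨⟨le_rfl, haT⟩, fun p hp => Ioc_subset_Icc_self (Finset.mem_filter.1 hp).2⟩
  have hmem : ∀ t ∈ Icc a T, ∀ᶠ S : Finset ℝ in atTop, t ∈ insert a (P S) := by
    intro t ht
    filter_upwards [eventually_ge_atTop {t}] with S hS
    rcases ht.1.eq_or_lt with rfl | hat
    · exact Finset.mem_insert_self _ _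
    · exact Finset.mem_insert_of_mem
        (Finset.mem_filter.2 ⟨hS (Finset.mem_singleton_self t), hat, ht.2⟩)
  let U : Ultrafilter (Finset ℝ) := Ultrafilter.of atTop
  have herr : ∀ s ∈ Icc a T, ∀ t ∈ Icc a T, s ≤ t → t - s ≤ h → ∀ᶠ S in (U : Filter (Finset ℝ)),
      ‖flowError G (X S) s t‖
        ≤ 2 * C / (1 - (2 + ε) * (1 / 2) ^ (2 / 3 + α)) * (t - s) ^ (2 / 3 + α) :=
    fun s hs t ht hst hτ => Ultrafilter.of_le atTop <| by
      filter_upwards [hmem s hs, hmem t ht] with S hsS htS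
      exact hG.norm_flowError_le_of_isConsecutive hα h1 hε₀ hε hρ (hP S) (hX S) hsS htS hst hτ
  have hlim : ∀ t ∈ Icc a T, ∃ l, Tendsto (fun S => X S t) U (𝓝 l) := fun t ht =>
    have ⟨_, hM⟩ := hG.exists_eventually_norm_le (by linarith) h0 h1 hL hXa herr ht
    exists_tendsto_ultrafilter U hM
  choose! x hx using hlim
  refine ⟨x, tendsto_nhds_unique (hx a ⟨le_rfl, haT⟩) ?_,
    hG.isFlowLine_of_tendsto hα h0 h1 hL herr hx⟩
  simpa only [hXa] using tendsto_const_nhds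

end Euler

/-! ### Flows with a drift -/

section Drift

/-- `B` is a drift on `[a, T]` which is bounded and Lipschitz in space with the same constant, and
continuous in time along continuous paths. -/
structure IsBoundedDrift {E : Type*} [NormedAddCommGroup E] (a T C : ℝ) (B : ℝ → E → E) :
    Prop where
  bound : ∀ t ∈ Icc a T, ∀ x, ‖B t x‖ ≤ C
  lip : ∀ t ∈ Icc a T, ∀ x y, ‖B t x - B t y‖ ≤ C * ‖x - y‖
  continuousOn : ∀ x : ℝ → E, ContinuousOn x (Icc a T) →
    ContinuousOn (fun t => B t (x t)) (Icc a T)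

lemma IsBoundedDrift.mono {E : Type*} [NormedAddCommGroup E] {a c T C : ℝ} {B : ℝ → E → E}
    (hB : IsBoundedDrift a T C B) (hc : a ≤ c) : IsBoundedDrift c T C B where
  bound t ht := hB.bound t ⟨hc.trans ht.1, ht.2⟩
  lip t ht := hB.lip t ⟨hc.trans ht.1, ht.2⟩
  continuousOn x hx := by
    rcases lt_or_ge T c with hT | hT
    · rw [Icc_eq_empty_of_lt hT]
      exact continuousOn_empty _
    have hext : ContinuousOn (fun t => x (max c t)) (Icc a T) :=
      hx.comp (by fun_prop) fun t ht => ⟨le_max_left _ _, max_le hT ht.2⟩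
    refine ((hB.continuousOn _ hext).mono (Icc_subset_Icc_left hc)).congr fun t ht => ?_
    simp only [max_eq_right ht.1]

lemma IsBoundedDrift.mono_const {E : Type*} [NormedAddCommGroup E] {a T C C' : ℝ}
    {B : ℝ → E → E} (hB : IsBoundedDrift a T C B) (h : C ≤ C') : IsBoundedDrift a T C' B :=
  ⟨fun t ht x => (hB.bound t ht x).trans h,
    fun t ht x y => (hB.lip t ht x y).trans (by gcongr), hB.continuousOn⟩

variable {E : Type*} [NormedAddCommGroup E] {a c T α C h ε L S : ℝ} {A : ℝ → ℝ → E → E}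
  {B : ℝ → E → E} {x x' : ℝ → E} {s u t : ℝ}

lemma IsBoundedDrift.intervalIntegrable (hB : IsBoundedDrift a T C B)
    (hx : ContinuousOn x (Icc a T)) (hs : a ≤ s) (hst : s ≤ t) (ht : t ≤ T) :
    IntervalIntegrable (fun r => B r (x r)) volume s t :=
  ((hB.continuousOn x hx).mono (uIcc_of_le hst ▸ Icc_subset_Icc hs ht)).intervalIntegrable

variable [NormedSpace ℝ E]

lemma norm_integral_le_of_forall_mem_Icc {f : ℝ → E} (hst : s ≤ t)
    (hf : ∀ r ∈ Icc s t, ‖f r‖ ≤ C) : ‖∫ r in s..t, f r‖ ≤ C * (t - s) := by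
  rw [← abs_of_nonneg (sub_nonneg.2 hst)]
  refine intervalIntegral.norm_integral_le_of_norm_le_const fun r hr => hf r ?_
  exact Ioc_subset_Icc_self (uIoc_of_le hst ▸ hr)

lemma IsBoundedDrift.norm_integral_le (hB : IsBoundedDrift a T C B) (x : ℝ → E) (hs : a ≤ s)
    (hst : s ≤ t) (ht : t ≤ T) : ‖∫ r in s..t, B r (x r)‖ ≤ C * (t - s) :=
  norm_integral_le_of_forall_mem_Icc hst fun r hr => hB.bound r (Icc_subset_Icc hs ht hr) _

lemma IsBoundedDrift.norm_integral_sub_le (hB : IsBoundedDrift a T C B) (hC : 0 ≤ C)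
    (hx : ContinuousOn x (Icc a T)) (hx' : ContinuousOn x' (Icc a T)) (hs : a ≤ s) (hst : s ≤ t)
    (ht : t ≤ T) (hS : ∀ r ∈ Icc s t, ‖x r - x' r‖ ≤ S) :
    ‖(∫ r in s..t, B r (x r)) - ∫ r in s..t, B r (x' r)‖ ≤ C * S * (t - s) := by
  rw [← intervalIntegral.integral_sub (hB.intervalIntegrable hx hs hst ht)
    (hB.intervalIntegrable hx' hs hst ht)]
  exact norm_integral_le_of_forall_mem_Icc hst fun r hr =>
    (hB.lip r (Icc_subset_Icc hs ht hr) _ _).trans (mul_le_mul_of_nonneg_left (hS r hr) hC)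

/-- The flow `A` with the additional drift `B`, frozen in space. -/
noncomputable def driftGerm (A : ℝ → ℝ → E → E) (B : ℝ → E → E) (s t : ℝ) (x : E) : E :=
  A s t x + ∫ r in s..t, B r x

lemma le_rpow_of_le_one {τ : ℝ} (hτ : 0 ≤ τ) (h1 : τ ≤ 1) (hα : 0 ≤ α) (hα' : α ≤ 1) :
    τ ≤ τ ^ α := by
  simpa only [Real.rpow_one] using Real.rpow_le_rpow_of_exponent_ge' hτ h1 hα hα'

lemma rpow_mul_self_le {τ γ : ℝ} (hτ : 0 ≤ τ) (h1 : τ ≤ 1) (hα : 0 ≤ α) (hγ : 0 ≤ γ)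
    (h : γ ≤ α + 1) : τ ^ α * τ ≤ τ ^ γ := by
  simpa only [Real.rpow_one] using rpow_mul_le_rpow hτ h1 hα zero_le_one hγ h

lemma norm_driftGerm_le (hA : IsAlmostFlow T α C A) (hB : IsBoundedDrift a T C B) (ha : 0 ≤ a)
    (hα : 0 ≤ α) (hα' : α ≤ 1) (hs : a ≤ s) (hst : s ≤ t) (ht : t ≤ T) (h1 : t - s ≤ 1) (x : E) :
    ‖driftGerm A B s t x‖ ≤ 2 * C * (t - s) ^ α := by
  have hpow := mul_le_mul_of_nonneg_left
    (le_rpow_of_le_one (sub_nonneg.2 hst) h1 hα hα') hA.nonneg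
  refine (norm_add_le_of_le ((hA.regular s t (ha.trans hs) hst ht h1).bound x)
    (hB.norm_integral_le (fun _ => x) hs hst ht)).trans ?_
  linarith

lemma norm_driftGerm_sub_le (hA : IsAlmostFlow T α C A) (hB : IsBoundedDrift a T C B)
    (ha : 0 ≤ a) (hα : 0 ≤ α) (hα' : α ≤ 1) (hs : a ≤ s) (hst : s ≤ t) (ht : t ≤ T)
    (h1 : t - s ≤ 1) (x y : E) :
    ‖driftGerm A B s t x - driftGerm A B s t y‖ ≤ 2 * C * (t - s) ^ α * ‖x - y‖ := by
  have hC := hA.nonneg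
  have hpow : C * ‖x - y‖ * (t - s) ≤ C * ‖x - y‖ * (t - s) ^ α := mul_le_mul_of_nonneg_left
    (le_rpow_of_le_one (sub_nonneg.2 hst) h1 hα hα') (by positivity)
  rw [driftGerm, driftGerm, add_sub_add_comm]
  refine (norm_add_le_of_le ((hA.regular s t (ha.trans hs) hst ht h1).lip x y)
    (hB.norm_integral_sub_le hC (x := fun _ => x) (x' := fun _ => y) continuousOn_const
      continuousOn_const hs hst ht fun _ _ => le_rfl)).trans ?_
  linarith

lemma driftGerm_defect (hB : IsBoundedDrift a T C B) (hs : a ≤ s) (hsu : s ≤ u) (hut : u ≤ t)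
    (ht : t ≤ T) (x y : E) :
    driftGerm A B s t x - driftGerm A B s u x - driftGerm A B u t y
      = (A s t x - A s u x - A u t (x + A s u x)) + (A u t (x + A s u x) - A u t y)
        + ((∫ r in u..t, B r x) - ∫ r in u..t, B r y) := by
  have := intervalIntegral.integral_add_adjacent_intervals
    (hB.intervalIntegrable (x := fun _ => x) continuousOn_const hs hsu (hut.trans ht))
    (hB.intervalIntegrable (x := fun _ => x) continuousOn_const (hs.trans hsu) hut ht)
  simp only [driftGerm, ← this]
  abel

lemma norm_driftGerm_defect_le (hA : IsAlmostFlow T α C A) (hB : IsBoundedDrift a T C B)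
    (ha : 0 ≤ a) (hα : 0 ≤ α) (hα' : α ≤ 1) (hs : a ≤ s) (hsu : s ≤ u) (hut : u ≤ t)
    (ht : t ≤ T) (h1 : t - s ≤ 1) (x : E) :
    ‖driftGerm A B s t x - driftGerm A B s u x - driftGerm A B u t (x + driftGerm A B s u x)‖
      ≤ (C + 3 * C ^ 2) * (t - s) ^ (2 / 3 + α) := by
  have hC := hA.nonneg
  have hτ : 0 ≤ t - s := by linarith
  set y := x + driftGerm A B s u x with hy
  have hpow : (t - s) ^ α * (t - s) ≤ (t - s) ^ (2 / 3 + α) :=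
    rpow_mul_self_le hτ h1 hα (by linarith) (by linarith)
  have hflow : ‖A u t (x + A s u x) - A u t y‖ ≤ C ^ 2 * (t - s) ^ (2 / 3 + α) :=
    calc _ ≤ C * (t - u) ^ α * ‖x + A s u x - y‖ :=
          (hA.regular u t (by linarith) hut ht (by linarith)).lip _ _
      _ ≤ C * (t - s) ^ α * (C * (t - s)) := by
        have hint := hB.norm_integral_le (fun _ => x) hs hsu (hut.trans ht)
        rw [hy, driftGerm, ← add_assoc, sub_add_cancel_left, norm_neg]
        have : C * (u - s) ≤ C * (t - s) := by gcongr
        gcongr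
        exact hint.trans this
      _ = C ^ 2 * ((t - s) ^ α * (t - s)) := by ring
      _ ≤ _ := by gcongr
  have hdrift : ‖(∫ r in u..t, B r x) - ∫ r in u..t, B r y‖
      ≤ 2 * C ^ 2 * (t - s) ^ (2 / 3 + α) :=
    calc _ ≤ C * (2 * C * (t - s) ^ α) * (t - u) := by
          refine hB.norm_integral_sub_le hC (x := fun _ => x) (x' := fun _ => y)
            continuousOn_const continuousOn_const (hs.trans hsu) hut ht fun _ _ => ?_
          rw [hy, sub_add_cancel_left, norm_neg]
          refine (norm_driftGerm_le hA hB ha hα hα' hs hsu (hut.trans ht) (by linarith) x).trans ?_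
          gcongr
      _ ≤ C * (2 * C * (t - s) ^ α) * (t - s) := by gcongr
      _ = 2 * C ^ 2 * ((t - s) ^ α * (t - s)) := by ring
      _ ≤ _ := by gcongr
  rw [driftGerm_defect hB hs hsu hut ht]
  refine (norm_add_le_of_le (norm_add_le_of_le
    ((hA.almost s u t (ha.trans hs) hsu hut ht h1).bound x) hflow) hdrift).trans_eq ?_
  ring

lemma IsAlmostFlow.isWeakFlow (hA : IsAlmostFlow T α C A) (hB : IsBoundedDrift a T C B)
    (ha : 0 ≤ a) (hα : 0 ≤ α) (hα' : α ≤ 1) :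
    IsWeakFlow a T α (2 * C + 3 * C ^ 2) (driftGerm A B) := by
  have hC := hA.nonneg
  refine ⟨by positivity, fun s t hs hst ht h1 x => ?_, fun s t hs hst ht h1 x y => ?_,
    fun s u t hs hsu hut ht h1 x => ?_⟩
  · have := Real.rpow_nonneg (sub_nonneg.2 hst) α
    refine (norm_driftGerm_le hA hB ha hα hα' hs hst ht h1 x).trans ?_
    gcongr
    exact le_add_of_nonneg_right (by positivity)
  · have := Real.rpow_nonneg (sub_nonneg.2 hst) α
    refine (norm_driftGerm_sub_le hA hB ha hα hα' hs hst ht h1 x y).trans ?_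
    gcongr
    exact le_add_of_nonneg_right (by positivity)
  · have := Real.rpow_nonneg (sub_nonneg.2 (hsu.trans hut)) (2 / 3 + α)
    refine (norm_driftGerm_defect_le hA hB ha hα hα' hs hsu hut ht h1 x).trans ?_
    gcongr
    linarith

/-- The error of the expansion `x_t - x_s = A_{st}(x_s) + ∫_s^t B_r(x_r) dr`, in which, unlike in
`driftGerm`, the drift is evaluated along the path. -/
noncomputable def davieError (A : ℝ → ℝ → E → E) (B : ℝ → E → E) (x : ℝ → E) (s t : ℝ) : E :=
  x t - x s - A s t (x s) - ∫ r in s..t, B r (x r)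

/-- Solutions in the sense of Davie, with explicit constants: on intervals of length at most `h`,
the path `x` has the increments of `A` and `B` up to an error of order `2 / 3 + α`. -/
structure IsDavieSolution (a T α h L : ℝ) (A : ℝ → ℝ → E → E) (B : ℝ → E → E) (x : ℝ → E) :
    Prop where
  continuousOn : ContinuousOn x (Icc a T)
  increment : ∀ s t, a ≤ s → s ≤ t → t ≤ T → t - s ≤ h → ‖x t - x s‖ ≤ L * (t - s) ^ α
  error : ∀ s t, a ≤ s → s ≤ t → t ≤ T → t - s ≤ h →
    ‖davieError A B x s t‖ ≤ L * (t - s) ^ (2 / 3 + α)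

lemma IsDavieSolution.mono {h' : ℝ} (hx : IsDavieSolution a T α h L A B x) (hh : h' ≤ h) :
    IsDavieSolution a T α h' L A B x :=
  ⟨hx.continuousOn, fun s t hs hst ht hτ => hx.increment s t hs hst ht (hτ.trans hh),
    fun s t hs hst ht hτ => hx.error s t hs hst ht (hτ.trans hh)⟩

lemma isDavieSolution_of_norm_flowError_le (hB : IsBoundedDrift a T C B) (hC : 0 ≤ C)
    (hα : 0 < α) (h0 : 0 < h) (h1 : h ≤ 1) {L' : ℝ} (hL : 0 ≤ L) (hL' : 0 ≤ L')
    (hinc : ∀ s t, a ≤ s → s ≤ t → t ≤ T → t - s ≤ h → ‖x t - x s‖ ≤ L * (t - s) ^ α)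
    (herr : ∀ s t, a ≤ s → s ≤ t → t ≤ T → t - s ≤ h →
      ‖flowError (driftGerm A B) x s t‖ ≤ L' * (t - s) ^ (2 / 3 + α)) :
    IsDavieSolution a T α h (L + L' + C * L) A B x := by
  have hcont := continuousOn_of_short_holder hα h0 hinc
  refine ⟨hcont, fun s t hs hst ht hτ => (hinc s t hs hst ht hτ).trans (mul_le_mul_of_nonneg_right
    (by linarith [mul_nonneg hC hL]) (Real.rpow_nonneg (sub_nonneg.2 hst) _)),
    fun s t hs hst ht hτ => ?_⟩
  have hτ₀ := sub_nonneg.2 hst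
  have hdrift : ‖(∫ r in s..t, B r (x s)) - ∫ r in s..t, B r (x r)‖
      ≤ C * L * (t - s) ^ (2 / 3 + α) :=
    calc _ ≤ C * (L * (t - s) ^ α) * (t - s) := by
          refine hB.norm_integral_sub_le hC (x := fun _ => x s) continuousOn_const hcont hs hst ht
            fun r ⟨hsr, hrt⟩ => ?_
          rw [norm_sub_rev]
          refine (hinc s r hs hsr (hrt.trans ht) (by linarith)).trans ?_
          gcongr
      _ = C * L * ((t - s) ^ α * (t - s)) := by ring
      _ ≤ _ := mul_le_mul_of_nonneg_left
        (rpow_mul_self_le hτ₀ (hτ.trans h1) hα.le (by linarith) (by linarith)) (by positivity)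
  have split : davieError A B x s t = flowError (driftGerm A B) x s t
      + ((∫ r in s..t, B r (x s)) - ∫ r in s..t, B r (x r)) := by
    simp only [davieError, flowError, driftGerm]
    abel
  rw [split]
  refine (norm_add_le_of_le (herr s t hs hst ht hτ) hdrift).trans ?_
  rw [← add_mul]
  exact mul_le_mul_of_nonneg_right (by linarith) (Real.rpow_nonneg hτ₀ _)

lemma exists_forall_isDavieSolution (hα : 1 / 3 < α) (hα' : α ≤ 1) (hC : 0 ≤ C) :
    ∃ h L, 0 < h ∧ h ≤ 1 ∧ 0 ≤ L ∧ ∀ (a T : ℝ) (A : ℝ → ℝ → E → E) (B : ℝ → E → E) (x : ℝ → E),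
      0 ≤ a → IsAlmostFlow T α C A → IsBoundedDrift a T C B → IsFlowLine a T (driftGerm A B) x →
      IsDavieSolution a T α h L A B x := by
  obtain ⟨h, ε, h0, h1, -, hε, hρ⟩ := exists_sewing_step hα (2 * C + 3 * C ^ 2)
  set C' := 2 * C + 3 * C ^ 2
  set L := C' / (1 - (2 + ε) * (1 / 2) ^ (2 / 3 + α))
  have hC'₀ : 0 ≤ C' := by positivity
  have hL : 0 ≤ L := div_nonneg hC'₀ (sub_pos.2 hρ).le
  refine ⟨h, C' + L + L + C * (C' + L), h0, h1, by positivity, fun a T A B x ha hA hB hx => ?_⟩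
  have hG : IsWeakFlow a T α C' _ := hA.isWeakFlow hB ha (by linarith) hα'
  have herr : ∀ s t, a ≤ s → s ≤ t → t ≤ T → t - s ≤ h →
      ‖flowError (driftGerm A B) x s t‖ ≤ L * (t - s) ^ (2 / 3 + α) :=
    fun s t hs hst ht hτ => hx.norm_flowError_le hG hα h1 hε hρ hs hst ht hτ
  exact isDavieSolution_of_norm_flowError_le hB hC (by linarith) h0 h1 (by positivity) hL
    (fun s t hs hst ht hτ => hG.norm_increment_le_of_flowError_le (by linarith) hL hs hst ht
      (hτ.trans h1) (herr s t hs hst ht hτ)) herr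

end Drift

section Stability

variable {E : Type*} [NormedAddCommGroup E] {a T α C h ε L S : ℝ} {A : ℝ → ℝ → E → E}
  {B : ℝ → E → E} {x x' : ℝ → E} {s u t : ℝ}

lemma IsAlmostFlow.norm_add_sub_add_le (hA : IsAlmostFlow T α C A) (hα : 0 ≤ α) (hs : 0 ≤ s)
    (hst : s ≤ t) (ht : t ≤ T) (h1 : t - s ≤ 1) (y y' : E) :
    ‖y + A s t y - (y' + A s t y')‖ ≤ (1 + C) * ‖y - y'‖ := by
  have hC := hA.nonneg
  have hpow : (t - s) ^ α ≤ 1 := Real.rpow_le_one (sub_nonneg.2 hst) h1 hα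
  have hlip : ‖A s t y - A s t y'‖ ≤ C * 1 * ‖y - y'‖ :=
    ((hA.regular s t hs hst ht h1).lip y y').trans (by gcongr)
  rw [add_sub_add_comm]
  exact (norm_add_le_of_le le_rfl hlip).trans_eq (by ring)

lemma IsAlmostFlow.norm_correction_sub_le (hA : IsAlmostFlow T α C A) (hα : 0 ≤ α) {D R : ℝ}
    (hs : 0 ≤ s) (hsu : s ≤ u) (hut : u ≤ t) (ht : t ≤ T) (h1 : t - s ≤ 1) (hD : 0 ≤ D)
    {y y' w w' : E} (hy : ‖y - y'‖ ≤ S) (hw : ‖w‖ ≤ D * (t - s) ^ (2 / 3 : ℝ))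
    (hww' : ‖w - w'‖ ≤ C * S * (t - s) + R) :
    ‖(-(A s t y - A s u y - A u t (y + A s u y))
          + (A u t (y + A s u y + w) - A u t (y + A s u y)))
        - (-(A s t y' - A s u y' - A u t (y' + A s u y'))
          + (A u t (y' + A s u y' + w') - A u t (y' + A s u y')))‖
      ≤ (C + C * (C + D * (1 + C))) * S * (t - s) ^ (2 / 3 + α) + C * (t - s) ^ α * R := by
  have hC := hA.nonneg
  have hτ₀ := sub_nonneg.2 (hsu.trans hut)
  have hS : 0 ≤ S := (norm_nonneg _).trans hy
  have hdefect : ‖(A s t y' - A s u y' - A u t (y' + A s u y'))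
      - (A s t y - A s u y - A u t (y + A s u y))‖ ≤ C * (t - s) ^ (2 / 3 + α) * S := by
    rw [norm_sub_rev]
    exact ((hA.almost s u t hs hsu hut ht h1).lip y y').trans (by gcongr)
  have hφ : ‖y + A s u y - (y' + A s u y')‖ ≤ (1 + C) * S :=
    (hA.norm_add_sub_add_le hα hs hsu (hut.trans ht) (by linarith) y y').trans (by gcongr)
  have hsecond : ‖(A u t (y + A s u y + w) - A u t (y + A s u y))
      - (A u t (y' + A s u y' + w') - A u t (y' + A s u y'))‖
      ≤ C * (t - s) ^ α * (C * S * (t - s) + R + D * (t - s) ^ (2 / 3 : ℝ) * ((1 + C) * S)) := by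
    have hpow : (t - u) ^ α ≤ (t - s) ^ α := by gcongr
    refine ((hA.regular u t (hs.trans hsu) hut ht (by linarith)).second _ _ w w').trans ?_
    gcongr
  have hpow₁ := mul_le_mul_of_nonneg_left (rpow_mul_self_le (γ := 2 / 3 + α) hτ₀ h1 hα
    (by linarith) (by linarith)) (by positivity : 0 ≤ C * C * S)
  have hpow₂ := mul_le_mul_of_nonneg_left (rpow_mul_le_rpow (β := 2 / 3) (γ := 2 / 3 + α) hτ₀ h1
    hα (by norm_num) (by linarith) (by linarith)) (by positivity : 0 ≤ C * D * (1 + C) * S)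
  rw [add_sub_add_comm, neg_sub_neg]
  refine (norm_add_le_of_le hdefect hsecond).trans ?_
  linarith

variable [NormedSpace ℝ E]

lemma davieError_eq_add (A : ℝ → ℝ → E → E) (hB : IsBoundedDrift a T C B)
    (hx : ContinuousOn x (Icc a T)) (hs : a ≤ s) (hsu : s ≤ u) (hut : u ≤ t) (ht : t ≤ T) :
    davieError A B x s t = davieError A B x s u + davieError A B x u t
      + (-(A s t (x s) - A s u (x s) - A u t (x s + A s u (x s)))
        + (A u t (x s + A s u (x s) + ((∫ r in s..u, B r (x r)) + davieError A B x s u))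
          - A u t (x s + A s u (x s)))) := by
  have hu : x s + A s u (x s) + ((∫ r in s..u, B r (x r)) + davieError A B x s u) = x u := by
    simp only [davieError]
    abel
  have hadd := intervalIntegral.integral_add_adjacent_intervals
    (hB.intervalIntegrable hx hs hsu (hut.trans ht))
    (hB.intervalIntegrable hx (hs.trans hsu) hut ht)
  rw [hu]
  simp only [davieError, ← hadd]
  abel

lemma IsDavieSolution.norm_integral_add_davieError_le (hx : IsDavieSolution a T α h L A B x)
    (hB : IsBoundedDrift a T C B) (hC : 0 ≤ C) (hL : 0 ≤ L) (hα : 0 ≤ α) (hs : a ≤ s)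
    (hst : s ≤ t) (ht : t ≤ T) (hτ : t - s ≤ h) (h1 : t - s ≤ 1) :
    ‖(∫ r in s..t, B r (x r)) + davieError A B x s t‖ ≤ (C + L) * (t - s) ^ (2 / 3 : ℝ) := by
  have hτ₀ := sub_nonneg.2 hst
  refine (norm_add_le_of_le (hB.norm_integral_le x hs hst ht) (hx.error s t hs hst ht hτ)).trans ?_
  rw [add_mul]
  gcongr ?_ + ?_
  · exact mul_le_mul_of_nonneg_left
      (le_rpow_of_le_one hτ₀ h1 (by norm_num) (by norm_num)) hC
  · exact mul_le_mul_of_nonneg_left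
      (Real.rpow_le_rpow_of_exponent_ge' hτ₀ h1 (by norm_num) (by linarith)) hL

lemma IsAlmostFlow.norm_davieError_sub_le (hA : IsAlmostFlow T α C A)
    (hB : IsBoundedDrift a T C B) (hx : IsDavieSolution a T α h L A B x)
    (hx' : IsDavieSolution a T α h L A B x') (ha : 0 ≤ a) (hα : 0 ≤ α) (hL : 0 ≤ L)
    (h1 : h ≤ 1) (hs : a ≤ s) (hsu : s ≤ u) (hut : u ≤ t) (ht : t ≤ T) (hτ : t - s ≤ h)
    (hS : ∀ r ∈ Icc s t, ‖x r - x' r‖ ≤ S) :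
    ‖davieError A B x s t - davieError A B x' s t‖
      ≤ ‖davieError A B x s u - davieError A B x' s u‖
        + ‖davieError A B x u t - davieError A B x' u t‖
        + ((C + C * (C + (C + L) * (1 + C))) * S * (t - s) ^ (2 / 3 + α)
          + C * (t - s) ^ α * ‖davieError A B x s u - davieError A B x' s u‖) := by
  have hC := hA.nonneg
  have hst := hsu.trans hut
  have hS₀ : 0 ≤ S := (norm_nonneg _).trans (hS s ⟨le_rfl, hst⟩)
  have hw : ‖(∫ r in s..u, B r (x r)) + davieError A B x s u‖
      ≤ (C + L) * (t - s) ^ (2 / 3 : ℝ) :=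
    (hx.norm_integral_add_davieError_le hB hC hL hα hs hsu (hut.trans ht) (by linarith)
      (by linarith)).trans (by gcongr)
  have hww' : ‖((∫ r in s..u, B r (x r)) + davieError A B x s u)
      - ((∫ r in s..u, B r (x' r)) + davieError A B x' s u)‖
      ≤ C * S * (t - s) + ‖davieError A B x s u - davieError A B x' s u‖ := by
    rw [add_sub_add_comm]
    refine norm_add_le_of_le ((hB.norm_integral_sub_le hC hx.continuousOn hx'.continuousOn hs hsu
      (hut.trans ht) fun r hr => hS r ⟨hr.1, hr.2.trans hut⟩).trans ?_) le_rfl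
    gcongr
  rw [davieError_eq_add A hB hx.continuousOn hs hsu hut ht,
    davieError_eq_add A hB hx'.continuousOn hs hsu hut ht, add_sub_add_comm,
    add_sub_add_comm (davieError A B x s u)]
  exact norm_add_le_of_le (norm_add_le _ _) (hA.norm_correction_sub_le hα (ha.trans hs) hsu hut ht
    (hτ.trans h1) (by positivity) (hS s ⟨le_rfl, hst⟩) hw hww')

lemma IsAlmostFlow.norm_davieError_sub_le_of_small (hA : IsAlmostFlow T α C A)
    (hB : IsBoundedDrift a T C B) (hx : IsDavieSolution a T α h L A B x)
    (hx' : IsDavieSolution a T α h L A B x') (ha : 0 ≤ a) (hα : 1 / 3 < α) (hL : 0 ≤ L)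
    (h1 : h ≤ 1) (hε : C * h ^ α ≤ ε) (hρ : (2 + ε) * (1 / 2) ^ (2 / 3 + α) < 1) {b : ℝ}
    (hb : b ≤ T) (hS₀ : 0 ≤ S) (hS : ∀ r ∈ Icc a b, ‖x r - x' r‖ ≤ S) (hs : a ≤ s)
    (hst : s ≤ t) (ht : t ≤ b) (hτ : t - s ≤ h) :
    ‖davieError A B x s t - davieError A B x' s t‖
      ≤ (C + C * (C + (C + L) * (1 + C))) * S / (1 - (2 + ε) * (1 / 2) ^ (2 / 3 + α))
        * (t - s) ^ (2 / 3 + α) := by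
  have hC := hA.nonneg
  refine norm_le_of_midpoint_of_small (a := a) (b := b)
    (J := fun s t => davieError A B x s t - davieError A B x' s t) (θ' := 2 / 3 + α)
    (by linarith) (by linarith) (by linarith) (by linarith) h1 hC (by positivity)
    (add_nonneg hL hL) hε hρ (fun s t hs hst ht hτ => ?_) (fun s u t hs hsu hut ht hτ => ?_)
    hs hst ht hτ
  · rw [add_mul]
    exact norm_sub_le_of_le (hx.error s t hs hst (ht.trans hb) hτ)
      (hx'.error s t hs hst (ht.trans hb) hτ)
  · exact hA.norm_davieError_sub_le hB hx hx' ha (by linarith) hL h1 hs hsu hut (ht.trans hb) hτ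
      fun r hr => hS r ⟨hs.trans hr.1, hr.2.trans ht⟩

lemma IsAlmostFlow.norm_sub_le_half_mul_add (hA : IsAlmostFlow T α C A)
    (hB : IsBoundedDrift a T C B) (hx : ContinuousOn x (Icc a T))
    (hx' : ContinuousOn x' (Icc a T)) (ha : 0 ≤ a) (hα : 0 ≤ α) (hα' : α ≤ 1) (h1 : h ≤ 1)
    (hL : 0 ≤ L) (hh : (2 * C + L) * h ^ α ≤ 1 / 2) (hat : a ≤ t) (ht : t ≤ T) (hτ : t - a ≤ h)
    (hS : ∀ r ∈ Icc a t, ‖x r - x' r‖ ≤ S)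
    (hJ : ‖davieError A B x a t - davieError A B x' a t‖ ≤ L * S * (t - a) ^ (2 / 3 + α)) :
    ‖x t - x' t‖ ≤ 1 / 2 * S + ‖x a - x' a‖ := by
  have hC := hA.nonneg
  have hτ₀ := sub_nonneg.2 hat
  have hS₀ : 0 ≤ S := (norm_nonneg _).trans (hS a ⟨le_rfl, hat⟩)
  have hpow : (t - a) ^ α ≤ h ^ α := by gcongr
  have hflow : ‖A a t (x a) - A a t (x' a)‖ ≤ C * h ^ α * S :=
    ((hA.regular a t ha hat ht (hτ.trans h1)).lip _ _).trans
      (mul_le_mul (by gcongr) (hS a ⟨le_rfl, hat⟩) (norm_nonneg _)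
        (mul_nonneg hC (Real.rpow_nonneg (hτ₀.trans hτ) _)))
  have hdrift : ‖(∫ r in a..t, B r (x r)) - ∫ r in a..t, B r (x' r)‖ ≤ C * S * h ^ α :=
    (hB.norm_integral_sub_le hC hx hx' le_rfl hat ht hS).trans (mul_le_mul_of_nonneg_left
      ((le_rpow_of_le_one hτ₀ (hτ.trans h1) hα hα').trans hpow) (by positivity))
  have herror : ‖davieError A B x a t - davieError A B x' a t‖ ≤ L * S * h ^ α :=
    hJ.trans (mul_le_mul_of_nonneg_left ((Real.rpow_le_rpow_of_exponent_ge' hτ₀ (hτ.trans h1) hα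
      (by linarith)).trans hpow) (by positivity))
  have split : x t - x' t = (x a - x' a) + (A a t (x a) - A a t (x' a))
      + ((∫ r in a..t, B r (x r)) - ∫ r in a..t, B r (x' r))
      + (davieError A B x a t - davieError A B x' a t) := by
    simp only [davieError]
    abel
  rw [split]
  refine (norm_add_le_of_le (norm_add_le_of_le (norm_add_le_of_le le_rfl hflow) hdrift)
    herror).trans ?_
  linarith [mul_le_mul_of_nonneg_right hh hS₀]

lemma exists_forall_isFlowLine_sub_le_of_short (hα : 1 / 3 < α) (hα' : α ≤ 1) (hC : 0 ≤ C) :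
    ∃ h, 0 < h ∧ ∀ (a T : ℝ) (A : ℝ → ℝ → E → E) (B : ℝ → E → E) (x x' : ℝ → E), 0 ≤ a →
      IsAlmostFlow T α C A → IsBoundedDrift a T C B → IsFlowLine a T (driftGerm A B) x →
      IsFlowLine a T (driftGerm A B) x' →
      ∀ t ∈ Icc a T, t - a ≤ h → ‖x t - x' t‖ ≤ 2 * ‖x a - x' a‖ := by
  obtain ⟨h₁, L, h₁0, h₁1, hL, hdavie⟩ := exists_forall_isDavieSolution (E := E) hα hα' hC
  obtain ⟨h₂, ε, h₂0, -, -, hε, hρ⟩ := exists_sewing_step hα C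
  set M := C + C * (C + (C + L) * (1 + C))
  set L' := M / (1 - (2 + ε) * (1 / 2) ^ (2 / 3 + α))
  obtain ⟨h₃, h₃0, -, hh₃⟩ :=
    exists_pos_mul_rpow_le (α := α) (by linarith) (2 * C + L') one_half_pos
  have hL' : 0 ≤ L' := div_nonneg (by positivity) (sub_pos.2 hρ).le
  set h := min h₁ (min h₂ h₃)
  have h0 : 0 < h := lt_min h₁0 (lt_min h₂0 h₃0)
  have hh₁ : h ≤ h₁ := min_le_left _ _
  have hh₂ : h ≤ h₂ := (min_le_right _ _).trans (min_le_left _ _)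
  have hh₃' : h ≤ h₃ := (min_le_right _ _).trans (min_le_right _ _)
  refine ⟨h, h0, fun a T A B x x' ha hA hB hx hx' t ht hτ => ?_⟩
  have hy := (hdavie a T A B x ha hA hB hx).mono hh₁
  have hy' := (hdavie a T A B x' ha hA hB hx').mono hh₁
  have hbdd : BddAbove (range fun r : Icc a t => ‖x r - x' r‖) := by
    have hcont : ContinuousOn (fun r => ‖x r - x' r‖) (Icc a t) :=
      (hy.continuousOn.sub hy'.continuousOn).norm.mono (Icc_subset_Icc_right ht.2)
    simpa only [image_eq_range] using isCompact_Icc.bddAbove_image hcont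
  refine (le_of_forall_improve (θ := 1 / 2) (b := ‖x a - x' a‖) (by norm_num) hbdd
    (fun S hS r => ?_) ⟨t, ht.1, le_rfl⟩).trans_eq (by ring)
  have hS' : ∀ r ∈ Icc a t, ‖x r - x' r‖ ≤ S := fun r hr => hS ⟨r, hr⟩
  have hS₀ : 0 ≤ S := (norm_nonneg _).trans (hS r)
  have hrτ : r - a ≤ h := by linarith [r.2.2]
  refine hA.norm_sub_le_half_mul_add hB hy.continuousOn hy'.continuousOn ha (by linarith) hα'
    (hh₁.trans h₁1) hL' (le_trans (by gcongr) hh₃) r.2.1 (r.2.2.trans ht.2) hrτ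
    (fun q hq => hS' q ⟨hq.1, hq.2.trans r.2.2⟩) ?_
  exact (hA.norm_davieError_sub_le_of_small hB hy hy' ha hα hL (hh₁.trans h₁1)
    (le_trans (by gcongr) hε) hρ ht.2 hS₀ hS' le_rfl r.2.1 r.2.2 hrτ).trans_eq (by ring)

lemma exists_forall_isFlowLine_sub_le (T : ℝ) (hα : 1 / 3 < α) (hα' : α ≤ 1) (hC : 0 ≤ C) :
    ∃ K, 0 ≤ K ∧ ∀ (a : ℝ) (A : ℝ → ℝ → E → E) (B : ℝ → E → E) (x x' : ℝ → E), 0 ≤ a →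
      IsAlmostFlow T α C A → IsBoundedDrift a T C B → IsFlowLine a T (driftGerm A B) x →
      IsFlowLine a T (driftGerm A B) x' → ∀ t ∈ Icc a T, ‖x t - x' t‖ ≤ K * ‖x a - x' a‖ := by
  obtain ⟨h, h0, hshort⟩ := exists_forall_isFlowLine_sub_le_of_short (E := E) hα hα' hC
  obtain ⟨n, hn⟩ := exists_nat_ge (T / h)
  rw [div_le_iff₀ h0] at hn
  refine ⟨2 ^ n, by positivity, fun a A B x x' ha hA hB hx hx' t ht => ?_⟩
  refine forall_of_short_steps (P := fun n t => ‖x t - x' t‖ ≤ 2 ^ n * ‖x a - x' a‖) h0.le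
    (by simp) (fun n s t hs hst ht hτ hP => ?_) n t ht (by linarith [ht.2])
  refine (hshort s T A B x x' (ha.trans hs) hA (hB.mono hs) (hx.mono hs) (hx'.mono hs) t
    ⟨hst, ht⟩ hτ).trans ?_
  rw [pow_succ]
  linarith

lemma exists_forall_isFlowLine_sub_initial_le (T : ℝ) (hα : 1 / 3 < α) (hα' : α ≤ 1)
    (hC : 0 ≤ C) :
    ∃ L, 0 ≤ L ∧ ∀ (a : ℝ) (A : ℝ → ℝ → E → E) (B : ℝ → E → E) (x : ℝ → E), 0 ≤ a →
      IsAlmostFlow T α C A → IsBoundedDrift a T C B → IsFlowLine a T (driftGerm A B) x →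
      ∀ t ∈ Icc a T, ‖x t - x a‖ ≤ L * (t - a) ^ α := by
  obtain ⟨h, L, h0, -, hL, hdavie⟩ := exists_forall_isDavieSolution (E := E) hα hα' hC
  obtain ⟨n, hn⟩ := exists_nat_ge (T / h)
  rw [div_le_iff₀ h0] at hn
  refine ⟨n * L, by positivity, fun a A B x ha hA hB hx t ht => ?_⟩
  rw [mul_assoc]
  exact norm_sub_le_nat_mul_rpow_of_short (by linarith) h0.le hL
    (hdavie a T A B x ha hA hB hx).increment n ht (by linarith [ht.2])

lemma exists_forall_isFlowLine_sub_isFlowLine_le (T : ℝ) (hα : 1 / 3 < α) (hα' : α ≤ 1)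
    (hC : 0 ≤ C) :
    ∃ D, 0 ≤ D ∧ ∀ (a a' : ℝ) (A : ℝ → ℝ → E → E) (B : ℝ → E → E) (x x' : ℝ → E), 0 ≤ a →
      a ≤ a' → IsAlmostFlow T α C A → IsBoundedDrift a T C B →
      IsFlowLine a T (driftGerm A B) x → IsFlowLine a' T (driftGerm A B) x' →
      ∀ t ∈ Icc a' T, ‖x t - x' t‖ ≤ D * (‖x a - x' a'‖ + (a' - a) ^ α) := by
  obtain ⟨L, hL, hinc⟩ := exists_forall_isFlowLine_sub_initial_le (E := E) T hα hα' hC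
  obtain ⟨K, hK, hstab⟩ := exists_forall_isFlowLine_sub_le (E := E) T hα hα' hC
  refine ⟨K * (1 + L), by positivity, fun a a' A B x x' ha haa' hA hB hx hx' t ht => ?_⟩
  have hpow := Real.rpow_nonneg (sub_nonneg.2 haa') α
  have hstart : ‖x a' - x' a'‖ ≤ (1 + L) * (‖x a - x' a'‖ + (a' - a) ^ α) :=
    calc ‖x a' - x' a'‖ ≤ ‖x a' - x a‖ + ‖x a - x' a'‖ := norm_sub_le_norm_sub_add_norm_sub _ _ _
      _ ≤ L * (a' - a) ^ α + ‖x a - x' a'‖ := by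
        gcongr
        exact hinc a A B x ha hA hB hx a' ⟨haa', ht.1.trans ht.2⟩
      _ ≤ _ := by linarith [mul_nonneg hL (norm_nonneg (x a - x' a'))]
  calc ‖x t - x' t‖ ≤ K * ‖x a' - x' a'‖ :=
        hstab a' A B x x' (ha.trans haa') hA (hB.mono haa') (hx.mono haa') hx' t ht
    _ ≤ K * ((1 + L) * (‖x a - x' a'‖ + (a' - a) ^ α)) := by gcongr
    _ = _ := (mul_assoc _ _ _).symm

end Stability

/-! ### Controls -/

section Wasserstein

variable {U : Type*} [MetricSpace U] [MeasurableSpace U]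

instance (μ : P2 U) : IsProbabilityMeasure μ.toMeasure := μ.2.1

/-- The measure underlying an element of `𝒫₂(U)`, with the topology of weak convergence on its
type. -/
def P2.toProbabilityMeasure (μ : P2 U) : ProbabilityMeasure U := ⟨μ.toMeasure, inferInstance⟩

lemma exists_lintegral_lt_of_W₂_lt {μ ν : P2 U} {r : ℝ≥0∞} (h : W₂ μ ν < r) :
    ∃ π ∈ couplings μ ν, ∫⁻ p, edist p.1 p.2 ^ 2 ∂π < r ^ 2 := by
  simp only [W₂, iInf_lt_iff] at h
  obtain ⟨π, hπ, h⟩ := h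
  refine ⟨π, hπ, ?_⟩
  rw [one_div, ENNReal.rpow_inv_lt_iff two_pos] at h
  exact_mod_cast h

variable [SecondCountableTopology U] [BorelSpace U]

lemma W₂_self (μ : P2 U) : W₂ μ μ = 0 := by
  have hm : Measurable fun a : U => (a, a) := measurable_id.prodMk measurable_id
  refine le_antisymm (iInf₂_le_of_le (μ.toMeasure.map fun a => (a, a)) ⟨?_, ?_⟩ ?_) bot_le
  · rw [Measure.map_map measurable_fst hm]
    exact Measure.map_id
  · rw [Measure.map_map measurable_snd hm]
    exact Measure.map_id
  · rw [lintegral_map (by fun_prop) hm]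
    simp

lemma levyProkhorovEDist_map_fst_map_snd_le {π : Measure (U × U)} {δ : ℝ≥0∞}
    (h : ∫⁻ p, edist p.1 p.2 ^ 2 ∂π ≤ δ ^ 3) :
    levyProkhorovEDist (π.map Prod.fst) (π.map Prod.snd) ≤ δ := by
  refine levyProkhorovEDist_le_of_forall _ _ _ fun ε B hδε hε hB => ?_
  have hε₀ : ε ≠ 0 := (bot_le.trans_lt hδε).ne'
  have markov : π {p | ε ≤ edist p.1 p.2} ≤ ε := by
    have hsub : {p : U × U | ε ≤ edist p.1 p.2} ⊆ {p | ε ^ 2 ≤ edist p.1 p.2 ^ 2} :=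
      fun p (hp : ε ≤ _) => pow_le_pow_left₀ zero_le hp 2
    refine (measure_mono hsub).trans ((meas_ge_le_lintegral_div (by fun_prop)
      (pow_ne_zero 2 hε₀) (ENNReal.pow_ne_top hε.ne)).trans ?_)
    refine ENNReal.div_le_of_le_mul ((h.trans (pow_le_pow_left₀ zero_le hδε.le 3)).trans_eq ?_)
    ring
  have hfar : ∀ {f g : U × U → U}, Measurable f → Measurable g →
      (∀ p, edist (f p) (g p) = edist p.1 p.2) →
      π.map f B ≤ π.map g (Metric.thickening ε.toReal B) + ε := by
    intro f g hf hg hfg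
    rw [Measure.map_apply hf hB, Measure.map_apply hg Metric.isOpen_thickening.measurableSet]
    refine (measure_mono fun p hp => ?_).trans ((measure_union_le _ _).trans
      (add_le_add_right markov _))
    by_contra hcon
    simp only [mem_union, mem_preimage, mem_ofPred_eq, not_or, not_le,
      Metric.mem_thickening_iff_exists_edist_lt, ENNReal.ofReal_toReal hε.ne] at hcon
    exact hcon.1 ⟨f p, hp, by rw [edist_comm, hfg]; exact hcon.2⟩
  exact ⟨hfar measurable_fst measurable_snd fun _ => rfl,
    hfar measurable_snd measurable_fst fun p => edist_comm _ _⟩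

lemma tendsto_toProbabilityMeasure_of_tendsto_W₂ {ι : Type*} {l : Filter ι} {μ : P2 U}
    {ν : ι → P2 U} (h : Tendsto (fun i => W₂ μ (ν i)) l (𝓝 0)) :
    Tendsto (fun i => (ν i).toProbabilityMeasure) l (𝓝 μ.toProbabilityMeasure) := by
  suffices hLP : Tendsto (fun i => levyProkhorovEDist μ.toMeasure (ν i).toMeasure) l (𝓝 0) by
    refine (LevyProkhorov.continuous_toMeasure_probabilityMeasure.tendsto
      (.ofMeasure μ.toProbabilityMeasure)).comp (tendsto_iff_edist_tendsto_0.2 ?_)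
      (f := fun i => .ofMeasure (ν i).toProbabilityMeasure)
    simp only [edist_comm _ (LevyProkhorov.ofMeasure μ.toProbabilityMeasure)]
    exact hLP
  rw [ENNReal.tendsto_nhds_zero] at h ⊢
  intro δ hδ
  rcases eq_or_ne δ ∞ with rfl | hδ'
  · exact Eventually.of_forall fun _ => le_top
  have hr : 0 < δ ^ (3 / 2 : ℝ) / 2 :=
    ENNReal.half_pos (ENNReal.rpow_pos hδ hδ').ne'
  filter_upwards [h _ hr] with i hi
  obtain ⟨π, ⟨hπ₁, hπ₂⟩, hπ⟩ := exists_lintegral_lt_of_W₂_lt (hi.trans_lt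
    (ENNReal.half_lt_self (ENNReal.rpow_pos hδ hδ').ne'
      (ENNReal.rpow_ne_top_of_nonneg (by norm_num) hδ')))
  rw [← ENNReal.rpow_mul_natCast] at hπ
  rw [← hπ₁, ← hπ₂]
  refine levyProkhorovEDist_map_fst_map_snd_le (hπ.le.trans_eq ?_)
  norm_num

lemma tendsto_integral_of_tendsto_W₂ {ι n : Type*} [Fintype n] {l : Filter ι} {μ : P2 U}
    {ν : ι → P2 U} (h : Tendsto (fun i => W₂ μ (ν i)) l (𝓝 0)) {f : U → EuclideanSpace ℝ n}
    (hf : Continuous f) {C : ℝ} (hC : ∀ a, ‖f a‖ ≤ C) :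
    Tendsto (fun i => ∫ a, f a ∂(ν i).toMeasure) l (𝓝 (∫ a, f a ∂μ.toMeasure)) := by
  have hint : ∀ κ : P2 U, Integrable f κ.toMeasure := fun κ =>
    .of_bound hf.aestronglyMeasurable C (Eventually.of_forall hC)
  have hcoord : ∀ (κ : P2 U) k, (∫ a, f a ∂κ.toMeasure) k = ∫ a, f a k ∂κ.toMeasure :=
    fun κ k => ((EuclideanSpace.proj k).integral_comp_comm (𝕜 := ℝ) (hint κ)).symm
  have hweak := ProbabilityMeasure.tendsto_iff_forall_integral_tendsto.1
    (tendsto_toProbabilityMeasure_of_tendsto_W₂ h)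
  refine (PiLp.homeomorph 2 _).isInducing.tendsto_nhds_iff.2 (tendsto_pi_nhds.2 fun k => ?_)
  have hk := hweak (.ofNormedAddCommGroup (fun a => f a k) (by fun_prop) C
    fun a => (PiLp.norm_apply_le _ _).trans (hC a))
  change Tendsto (fun i => (∫ a, f a ∂(ν i).toMeasure) k) l (𝓝 ((∫ a, f a ∂μ.toMeasure) k))
  simp only [hcoord]
  exact hk

end Wasserstein

lemma aemeasurable_apply_self {Ω β : Type*} [MeasurableSpace Ω] [PseudoEMetricSpace Ω]
    [OpensMeasurableSpace Ω] [MeasurableSpace β] [TopologicalSpace β]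
    [TopologicalSpace.PseudoMetrizableSpace β] [BorelSpace β] {S : Set Ω}
    [TopologicalSpace.SeparableSpace S] {μ : Measure Ω} {f : Ω → Ω → β} (hS : MeasurableSet S)
    (hf : ∀ u ∈ S, AEMeasurable (fun r => f r u) (μ.restrict S))
    (hf' : ∀ r ∈ S, ContinuousWithinAt (f r) S r) :
    AEMeasurable (fun r => f r r) (μ.restrict S) := by
  rcases S.eq_empty_or_nonempty with rfl | ⟨r₀, hr₀⟩
  · rw [Measure.restrict_empty]
    exact aemeasurable_zero_measure
  let φ := SimpleFunc.approxOn id measurable_id S r₀ hr₀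
  have hφ : ∀ n r, φ n r ∈ S := SimpleFunc.approxOn_mem measurable_id hr₀
  refine aemeasurable_of_tendsto_metrizable_ae' (f := fun n r => f r (φ n r)) (fun n => ?_) ?_
  · have hmk : ∀ u, ∃ g, Measurable g ∧ (u ∈ S → (fun r => f r u) =ᵐ[μ.restrict S] g) := fun u =>
      (em (u ∈ S)).elim (fun hu => ⟨_, (hf u hu).measurable_mk, fun _ => (hf u hu).ae_eq_mk⟩)
        fun hu => ⟨fun _ => f r₀ r₀, measurable_const, fun h => absurd h hu⟩
    choose g hg hfg using hmk
    refine ⟨_, (φ n).measurable_bind g hg, ?_⟩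
    have hae : ∀ᵐ r ∂μ.restrict S, ∀ u ∈ range (φ n), f r u = g u r :=
      (ae_ball_iff (φ n).finite_range.countable).2 fun u hu => by
        obtain ⟨r, rfl⟩ := hu
        exact hfg _ (hφ n r)
    filter_upwards [hae] with r hr using hr _ (mem_range_self r)
  · filter_upwards [ae_restrict_mem hS] with r hr
    exact (hf' r hr).tendsto.comp (tendsto_nhdsWithin_iff.2
      ⟨SimpleFunc.tendsto_approxOn measurable_id hr₀ (subset_closure hr),
        Eventually.of_forall fun n => hφ n r⟩)

section Coefficients

variable {m : ℕ} {U : Type*} [MetricSpace U] {T ε L s : ℝ} {b : ℝ → Vec m → U → Vec m}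
  {t C c : ℝ}

lemma IsDrift.exists_isBL (hb : IsDrift T b) :
    ∃ C, 0 ≤ C ∧ ∀ t ∈ Icc 0 T, ∀ a, IsBL C fun x => b t x a := by
  obtain ⟨C₁, hC₁⟩ := hb.bounded
  obtain ⟨C₂, hC₂⟩ := hb.bounded_space
  exact ⟨max (max C₁ C₂) 0, le_max_right _ _, fun t ht a =>
    ⟨fun x => (hC₁ t ht x a).trans ((le_max_left _ _).trans (le_max_left _ _)),
      norm_sub_le_of_hasFDerivAt_le
        (fun x => (hb.differentiable_space t ht a x).hasFDerivAt)
        fun x => (hC₂ t ht x a).trans ((le_max_right _ _).trans (le_max_left _ _))⟩⟩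

lemma IsDrift.continuous_control (hb : IsDrift T b) (ht : t ∈ Icc 0 T) (x : Vec m) :
    Continuous (b t x) :=
  hb.continuous.comp_continuous (f := fun a => (t, x, a)) (by fun_prop) fun _ => ⟨ht, mem_univ _⟩

variable [MeasurableSpace U] {K : Set (P2 U)} {γ : ℝ → P2 U}

lemma admissible_mono {s' : ℝ} (h : s ≤ s') : admissible K ε L s T ⊆ admissible K ε L s' T :=
  fun _ hγ => ⟨fun r hr => hγ.1 r ⟨h.trans hr.1, hr.2⟩,
    fun r hr t ht => hγ.2 r ⟨h.trans hr.1, hr.2⟩ t ⟨h.trans ht.1, ht.2⟩⟩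

lemma comp_max_mem_admissible {c : ℝ} (hL : 0 ≤ L) (hε : 0 ≤ ε) (hc : c ≤ T)
    (hγ : γ ∈ admissible K ε L c T) : (fun r => γ (max c r)) ∈ admissible K ε L s T := by
  have hmem : ∀ r ∈ Icc s T, max c r ∈ Icc c T := fun r hr => ⟨le_max_left _ _, max_le hc hr.2⟩
  refine ⟨fun r hr => hγ.1 _ (hmem r hr), fun r hr t ht =>
    (hγ.2 _ (hmem r hr) _ (hmem t ht)).trans (ENNReal.ofReal_le_ofReal ?_)⟩
  have : |max c t - max c r| ≤ |t - r| := by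
    simpa using abs_max_sub_max_le_max c t c r
  gcongr

lemma tendsto_W₂_of_mem_admissible (hε : 0 < ε) (hγ : γ ∈ admissible K ε L s T) {r : ℝ}
    (hr : r ∈ Icc s T) : Tendsto (fun t => W₂ (γ r) (γ t)) (𝓝[Icc s T] r) (𝓝 0) := by
  have hcont : Continuous fun t : ℝ => ENNReal.ofReal (L * |t - r| ^ ε) :=
    ENNReal.continuous_ofReal.comp (continuous_const.mul
      ((continuous_id.sub continuous_const).abs.rpow_const fun _ => Or.inr hε.le))
  have hlim := (hcont.tendsto r).mono_left (nhdsWithin_le_nhds (s := Icc s T))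
  simp only [sub_self, abs_zero, Real.zero_rpow hε.ne', mul_zero, ENNReal.ofReal_zero] at hlim
  exact tendsto_of_tendsto_of_tendsto_of_le_of_le' tendsto_const_nhds hlim
    (Eventually.of_forall fun _ => bot_le)
    (eventually_mem_nhdsWithin.mono fun t ht => hγ.2 r hr t ht)

/-- The drift `∫_U b(t, x, a) γ_t(da)`. -/
noncomputable def controlledDrift (b : ℝ → Vec m → U → Vec m) (γ : ℝ → P2 U) (t : ℝ) (x : Vec m) :
    Vec m :=
  ∫ a, b t x a ∂(γ t).toMeasure

lemma norm_integral_le_of_forall_norm_le (μ : P2 U) {f : U → Vec m} (hf : ∀ a, ‖f a‖ ≤ c) :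
    ‖∫ a, f a ∂μ.toMeasure‖ ≤ c := by
  have h := norm_integral_le_of_norm_le_const (μ := μ.toMeasure) (Eventually.of_forall hf)
  rwa [probReal_univ, mul_one] at h

variable {F : ℝ → Vec m → P2 U → ℝ}

lemma IsRunningReward.continuousWithinAt (hF : IsRunningReward T K F) (hε : 0 < ε)
    (hγ : γ ∈ admissible K ε L s T) {x : ℝ → Vec m} (ht : t ∈ Icc 0 T) {r : ℝ} (hr : r ∈ Icc s T)
    (hx : ContinuousWithinAt x (Icc s T) r) :
    ContinuousWithinAt (fun u => F t (x u) (γ u)) (Icc s T) r := by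
  obtain ⟨C, hC⟩ := hF.lipschitz_space
  obtain ⟨D, hD⟩ := hF.lipschitz_control t ht (x r)
  have hspace : Tendsto (fun u => F t (x u) (γ u) - F t (x r) (γ u)) (𝓝[Icc s T] r) (𝓝 0) := by
    refine squeeze_zero_norm' (a := fun u => C * ‖x u - x r‖)
      (eventually_mem_nhdsWithin.mono fun u hu => hC t ht _ (hγ.1 u hu) _ _) ?_
    simpa using (hx.tendsto.sub_const (x r)).norm.const_mul C
  have hcontrol : Tendsto (fun u => F t (x r) (γ u)) (𝓝[Icc s T] r) (𝓝 (F t (x r) (γ r))) := by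
    rw [tendsto_iff_edist_tendsto_0]
    have hW := ENNReal.Tendsto.const_mul (a := ENNReal.ofReal D)
      (tendsto_W₂_of_mem_admissible hε hγ hr) (Or.inr ENNReal.ofReal_ne_top)
    rw [mul_zero] at hW
    refine tendsto_of_tendsto_of_tendsto_of_le_of_le' tendsto_const_nhds hW
      (Eventually.of_forall fun _ => bot_le) (eventually_mem_nhdsWithin.mono fun u hu => ?_)
    rw [edist_comm, edist_dist, Real.dist_eq]
    exact hD _ (hγ.1 r hr) _ (hγ.1 u hu)
  simpa only [ContinuousWithinAt, sub_add_cancel, zero_add] using hspace.add hcontrol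

lemma IsRunningReward.intervalIntegrable (hF : IsRunningReward T K F) (hε : 0 < ε) (hs : 0 ≤ s)
    (hsT : s ≤ T) (hγ : γ ∈ admissible K ε L s T) {x : ℝ → Vec m}
    (hx : ContinuousOn x (Icc s T)) :
    IntervalIntegrable (fun r => F r (x r) (γ r)) volume s T := by
  have hI : Icc s T ⊆ Icc 0 T := Icc_subset_Icc_left hs
  have hmeas : AEMeasurable (fun r => F r (x r) (γ r)) (volume.restrict (Icc s T)) :=
    aemeasurable_apply_self (f := fun r u => F r (x u) (γ u)) measurableSet_Icc
      (fun u hu => (hF.measurable_time (x u) (γ u) (hγ.1 u hu)).mono_set hI)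
      fun r hr => hF.continuousWithinAt hε hγ (hI hr) hr (hx r hr)
  obtain ⟨C, hC⟩ := hF.bounded
  rw [intervalIntegrable_iff_integrableOn_Icc_of_le hsT]
  exact Integrable.of_bound hmeas.aestronglyMeasurable C
    ((ae_restrict_mem measurableSet_Icc).mono fun r hr => hC r (hI hr) _ _ (hγ.1 r hr))

variable [BorelSpace U]

lemma norm_integral_sub_integral_le (μ : P2 U) {f g : U → Vec m} (hf : Continuous f)
    (hg : Continuous g) (hfC : ∀ a, ‖f a‖ ≤ C) (hgC : ∀ a, ‖g a‖ ≤ C)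
    (h : ∀ a, ‖f a - g a‖ ≤ c) :
    ‖(∫ a, f a ∂μ.toMeasure) - ∫ a, g a ∂μ.toMeasure‖ ≤ c := by
  rw [← integral_sub
    (.of_bound hf.aestronglyMeasurable C (Eventually.of_forall hfC))
    (.of_bound hg.aestronglyMeasurable C (Eventually.of_forall hgC))]
  exact norm_integral_le_of_forall_norm_le μ h

lemma IsDrift.norm_controlledDrift_sub_le (hb : IsDrift T b)
    (hC : ∀ t ∈ Icc 0 T, ∀ a, IsBL C fun x => b t x a) (ht : t ∈ Icc 0 T) (γ : ℝ → P2 U)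
    (x x' : Vec m) : ‖controlledDrift b γ t x - controlledDrift b γ t x'‖ ≤ C * ‖x - x'‖ :=
  norm_integral_sub_integral_le _ (hb.continuous_control ht x) (hb.continuous_control ht x')
    (fun a => (hC t ht a).bound x) (fun a => (hC t ht a).bound x') fun a => (hC t ht a).lip x x'

variable [SecondCountableTopology U]

lemma const_mem_admissible {μ : P2 U} (hμ : μ ∈ K) : (fun _ => μ) ∈ admissible K ε L s T :=
  ⟨fun _ _ => hμ, fun _ _ _ _ => by rw [W₂_self]; exact bot_le⟩

lemma IsDrift.continuousOn_controlledDrift (hb : IsDrift T b)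
    (hC : ∀ t ∈ Icc 0 T, ∀ a, IsBL C fun x => b t x a) (hε : 0 < ε) (hs : 0 ≤ s)
    (hγ : γ ∈ admissible K ε L s T) {x : ℝ → Vec m} (hx : ContinuousOn x (Icc s T)) :
    ContinuousOn (fun t => controlledDrift b γ t (x t)) (Icc s T) := by
  intro r hr
  have hI : Icc s T ⊆ Icc 0 T := Icc_subset_Icc_left hs
  have hspace : Tendsto
      (fun t => controlledDrift b γ t (x t) - controlledDrift b γ t (x r))
      (𝓝[Icc s T] r) (𝓝 0) := by
    refine squeeze_zero_norm' (a := fun t => C * ‖x t - x r‖)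
      (eventually_mem_nhdsWithin.mono fun t ht =>
        hb.norm_controlledDrift_sub_le hC (hI ht) γ (x t) (x r)) ?_
    simpa using ((hx r hr).tendsto.sub_const (x r)).norm.const_mul C
  have htime : Tendsto
      (fun t => (∫ a, b t (x r) a ∂(γ t).toMeasure) - ∫ a, b r (x r) a ∂(γ t).toMeasure)
      (𝓝[Icc s T] r) (𝓝 0) := by
    rw [Metric.tendsto_nhds]
    intro e he
    obtain ⟨ρ, hρ, hbρ⟩ := hb.uniform_time (x r) (e / 2) (half_pos he)
    filter_upwards [eventually_mem_nhdsWithin, nhdsWithin_le_nhds (Metric.ball_mem_nhds r hρ)]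
      with t ht htr
    rw [dist_zero_right]
    exact (norm_integral_sub_integral_le _ (hb.continuous_control (hI ht) (x r))
      (hb.continuous_control (hI hr) (x r)) (fun a => (hC t (hI ht) a).bound _)
      (fun a => (hC r (hI hr) a).bound _)
      fun a => (hbρ t (hI ht) r (hI hr) htr a).le).trans_lt (half_lt_self he)
  have hcontrol := tendsto_integral_of_tendsto_W₂ (tendsto_W₂_of_mem_admissible hε hγ hr)
    (hb.continuous_control (hI hr) (x r)) fun a => (hC r (hI hr) a).bound _
  refine ((hspace.add (htime.add hcontrol)).congr fun t => ?_).trans_eq ?_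
  · simp only [controlledDrift]
    abel
  · simp only [controlledDrift, zero_add]

lemma IsDrift.exists_isBoundedDrift (hb : IsDrift T b) :
    ∃ C, 0 ≤ C ∧ ∀ (K : Set (P2 U)) (ε L s : ℝ) (γ : ℝ → P2 U), 0 < ε → 0 ≤ s →
      γ ∈ admissible K ε L s T → IsBoundedDrift s T C (controlledDrift b γ) := by
  obtain ⟨C, hC₀, hC⟩ := hb.exists_isBL
  refine ⟨C, hC₀, fun K ε L s γ hε hs hγ => ?_⟩
  have hI : Icc s T ⊆ Icc 0 T := Icc_subset_Icc_left hs
  exact ⟨fun t ht x => norm_integral_le_of_forall_norm_le _ fun a => (hC t (hI ht) a).bound x,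
    fun t ht => hb.norm_controlledDrift_sub_le hC (hI ht) γ,
    fun x hx => hb.continuousOn_controlledDrift hC hε hs hγ hx⟩

end Coefficients

/-! ### Flow lines are solutions -/

section HolderCalculus

variable {V W : Type*} [NormedAddCommGroup V] [NormedAddCommGroup W] {μ ν a a' b C : ℝ}
  {f g : ℝ → ℝ → V} {k : ℝ → ℝ → W}

lemma IsHolder₂.mono_left (hg : IsHolder₂ μ a b g) (h : a ≤ a') : IsHolder₂ μ a' b g := by
  obtain ⟨C, hC⟩ := hg
  exact ⟨C, fun s t hs hst ht => hC s t (h.trans hs) hst ht⟩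

lemma rpow_le_rpow_sub_mul_rpow {τ S : ℝ} (hτ : 0 ≤ τ) (hS : τ ≤ S) (hν : 0 ≤ ν) (h : ν ≤ μ) :
    τ ^ μ ≤ S ^ (μ - ν) * τ ^ ν :=
  calc τ ^ μ = τ ^ (μ - ν) * τ ^ ν := by
        rw [← Real.rpow_add_of_nonneg hτ (sub_nonneg.2 h) hν, sub_add_cancel]
    _ ≤ S ^ (μ - ν) * τ ^ ν := mul_le_mul_of_nonneg_right
        (Real.rpow_le_rpow hτ hS (sub_nonneg.2 h)) (Real.rpow_nonneg hτ _)

lemma IsHolder₂.mono_exponent (hg : IsHolder₂ μ a b g) (hν : 0 ≤ ν) (h : ν ≤ μ) :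
    IsHolder₂ ν a b g := by
  obtain ⟨C, hC₀, hC⟩ := hg.exists_nonneg
  refine ⟨C * (b - a) ^ (μ - ν), fun s t hs hst ht => (hC s t hs hst ht).trans ?_⟩
  rw [mul_assoc]
  exact mul_le_mul_of_nonneg_left
    (rpow_le_rpow_sub_mul_rpow (sub_nonneg.2 hst) (sub_le_sub ht hs) hν h) hC₀

lemma IsHolder₂.exists_norm_le (hg : IsHolder₂ μ a b g) (hμ : 0 ≤ μ) :
    ∃ M, ∀ s t, a ≤ s → s ≤ t → t ≤ b → ‖g s t‖ ≤ M := by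
  simpa only [IsHolder₂, Real.rpow_zero, mul_one] using hg.mono_exponent le_rfl hμ

lemma IsHolder₂.add (hf : IsHolder₂ μ a b f) (hg : IsHolder₂ μ a b g) :
    IsHolder₂ μ a b fun s t => f s t + g s t := by
  obtain ⟨C, hC⟩ := hf
  obtain ⟨D, hD⟩ := hg
  refine ⟨C + D, fun s t hs hst ht => (norm_add_le _ _).trans ?_⟩
  rw [add_mul]
  exact add_le_add (hC s t hs hst ht) (hD s t hs hst ht)

lemma IsHolder₂.congr (hf : IsHolder₂ μ a b f)
    (h : ∀ s t, a ≤ s → s ≤ t → t ≤ b → g s t = f s t) : IsHolder₂ μ a b g := by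
  obtain ⟨C, hC⟩ := hf
  exact ⟨C, fun s t hs hst ht => h s t hs hst ht ▸ hC s t hs hst ht⟩

lemma IsHolder₂.of_norm_le_mul (hg : IsHolder₂ μ a b g) (hC : 0 ≤ C)
    (h : ∀ s t, a ≤ s → s ≤ t → t ≤ b → ‖k s t‖ ≤ C * ‖g s t‖) : IsHolder₂ μ a b k := by
  obtain ⟨D, hD⟩ := hg
  refine ⟨C * D, fun s t hs hst ht => (h s t hs hst ht).trans ?_⟩
  rw [mul_assoc]
  exact mul_le_mul_of_nonneg_left (hD s t hs hst ht) hC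

lemma IsHolder₂.of_norm_le_mul_sq (hg : IsHolder₂ μ a b g) (hC : 0 ≤ C)
    (h : ∀ s t, a ≤ s → s ≤ t → t ≤ b → ‖k s t‖ ≤ C * ‖g s t‖ ^ 2) :
    IsHolder₂ (2 * μ) a b k := by
  obtain ⟨D, hD⟩ := hg
  refine ⟨C * D ^ 2, fun s t hs hst ht => (h s t hs hst ht).trans ?_⟩
  rw [mul_comm 2 μ, Real.rpow_mul (sub_nonneg.2 hst), Real.rpow_two, mul_assoc, ← mul_pow]
  exact mul_le_mul_of_nonneg_left
    (pow_le_pow_left₀ (norm_nonneg _) (hD s t hs hst ht) 2) hC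

variable [NormedSpace ℝ V] [NormedSpace ℝ W]

lemma IsHolder₂.clm_apply {A : ℝ → V →L[ℝ] W} (hg : IsHolder₂ μ a b g) (hC : 0 ≤ C)
    (hA : ∀ s ∈ Icc a b, ‖A s‖ ≤ C) : IsHolder₂ μ a b fun s t => A s (g s t) :=
  hg.of_norm_le_mul hC fun s _ hs hst ht => (A s).le_of_opNorm_le (hA s ⟨hs, hst.trans ht⟩) _

lemma IsHolder₂.contract {d : ℕ} {A : ℝ → Vec d →L[ℝ] Vec d →L[ℝ] V}
    {Z : ℝ → ℝ → Fin d → Fin d → ℝ} (hZ : IsHolder₂ μ a b Z) (hC : 0 ≤ C)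
    (hA : ∀ s ∈ Icc a b, ‖A s‖ ≤ C) : IsHolder₂ μ a b fun s t => contract (A s) (Z s t) := by
  refine hZ.of_norm_le_mul (C := (d : ℝ) ^ 2 * C) (by positivity) fun s t hs hst ht => ?_
  rw [mul_right_comm]
  exact (norm_contract_le _ _).trans
    (mul_le_mul_of_nonneg_left (hA s ⟨hs, hst.trans ht⟩) (by positivity))

lemma IsHolder₁.clm_comp {X : Type*} [NormedAddCommGroup X] [NormedSpace ℝ X]
    {A : ℝ → V →L[ℝ] W} {B : ℝ → X →L[ℝ] V} (hA : IsHolder₁ μ a b A) (hB : IsHolder₁ μ a b B)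
    (hC : 0 ≤ C) (hAC : ∀ s ∈ Icc a b, ‖A s‖ ≤ C) (hBC : ∀ s ∈ Icc a b, ‖B s‖ ≤ C) :
    IsHolder₁ μ a b fun t => (A t).comp (B t) := by
  have left : IsHolder₂ μ a b fun s t => (inc A s t).comp (B t) :=
    hA.of_norm_le_mul hC fun s t hs hst ht => ((inc A s t).opNorm_comp_le (B t)).trans
      (by rw [mul_comm]; gcongr; exact hBC t ⟨hs.trans hst, ht⟩)
  have right : IsHolder₂ μ a b fun s t => (A s).comp (inc B s t) :=
    hB.of_norm_le_mul hC fun s t hs hst ht => ((A s).opNorm_comp_le (inc B s t)).trans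
      (by gcongr; exact hAC s ⟨hs, hst.trans ht⟩)
  refine IsHolder₂.congr (left.add right) fun s t _ _ _ => ?_
  ext v
  simp [inc]

end HolderCalculus

section RegularCoefficient

variable {E F : Type*} [NormedAddCommGroup E] [NormedSpace ℝ E] [NormedAddCommGroup F]
  [NormedSpace ℝ F] {T K κ a : ℝ} {σ : ℝ → E → F} {x : ℝ → E}

lemma IsRegularCoefficient.isHolder₁_comp (hσ : IsRegularCoefficient T K σ) (ha : 0 ≤ a)
    (hκ : 0 ≤ κ) (hκ' : κ ≤ 1) (hx : IsHolder₁ κ a T x) :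
    IsHolder₁ κ a T fun t => σ t (x t) := by
  have time : IsHolder₂ 1 a T fun s t => σ t (x t) - σ s (x t) := ⟨K, fun s t hs hst ht => by
    rw [Real.rpow_one]
    exact hσ.time s ⟨ha.trans hs, hst.trans ht⟩ t ⟨ha.trans (hs.trans hst), ht⟩ hst _⟩
  have space : IsHolder₂ κ a T fun s t => σ s (x t) - σ s (x s) :=
    IsHolder₂.of_norm_le_mul hx hσ.nonneg fun s t hs hst ht =>
      (hσ.space s ⟨ha.trans hs, hst.trans ht⟩).lip _ _
  exact ((time.mono_exponent hκ hκ').add space).congr fun s t _ _ _ =>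
    (sub_add_sub_cancel _ _ _).symm

lemma IsRegularCoefficient.isHolder₁_fderiv_comp (hσ : IsRegularCoefficient T K σ) (ha : 0 ≤ a)
    (hκ : 0 ≤ κ) (hκ' : κ ≤ 2 / 3) (hx : IsHolder₁ κ a T x) :
    IsHolder₁ κ a T fun t => fderiv ℝ (σ t) (x t) := by
  have time : IsHolder₂ (2 / 3) a T fun s t => fderiv ℝ (σ t) (x t) - fderiv ℝ (σ s) (x t) :=
    ⟨K, fun s t hs hst ht =>
      hσ.time_deriv s ⟨ha.trans hs, hst.trans ht⟩ t ⟨ha.trans (hs.trans hst), ht⟩ hst _⟩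
  have space : IsHolder₂ κ a T fun s t => fderiv ℝ (σ s) (x t) - fderiv ℝ (σ s) (x s) :=
    IsHolder₂.of_norm_le_mul hx hσ.nonneg fun s t hs hst ht =>
      (hσ.space_deriv s ⟨ha.trans hs, hst.trans ht⟩).lip _ _
  exact ((time.mono_exponent hκ hκ').add space).congr fun s t _ _ _ =>
    (sub_add_sub_cancel _ _ _).symm

lemma IsRegularCoefficient.norm_taylor_remainder_le (hσ : IsRegularCoefficient T K σ) {t : ℝ}
    (ht : t ∈ Icc 0 T) (x y : E) :
    ‖σ t y - σ t x - fderiv ℝ (σ t) x (y - x)‖ ≤ 2 * K * ‖y - x‖ ^ 2 := by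
  have h := (IsBL₂.taylor (v := fun _ => y - x) (V := ‖y - x‖) (hσ.hasFDerivAt ht)
    (hσ.space_deriv t ht)
    ⟨fun _ => le_rfl, fun _ _ => by rw [sub_self, norm_zero]; positivity⟩).bound x
  rwa [add_sub_cancel, ← mul_assoc] at h

variable {d : ℕ} {ζ : ℝ → Vec d}

lemma IsRegularCoefficient.isHolder₂_remainder_comp (hσ : IsRegularCoefficient T K σ)
    (ha : 0 ≤ a) (hκ : 0 ≤ κ) (hκ' : 2 * κ ≤ 1) {x' : ℝ → Vec d →L[ℝ] E}
    (hx : IsHolder₁ κ a T x) (hx' : IsHolder₂ (2 * κ) a T (remainder ζ x x')) :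
    IsHolder₂ (2 * κ) a T
      (remainder ζ (fun t => σ t (x t)) fun t => (fderiv ℝ (σ t) (x t)).comp (x' t)) := by
  have time : IsHolder₂ 1 a T fun s t => σ t (x t) - σ s (x t) := ⟨K, fun s t hs hst ht => by
    rw [Real.rpow_one]
    exact hσ.time s ⟨ha.trans hs, hst.trans ht⟩ t ⟨ha.trans (hs.trans hst), ht⟩ hst _⟩
  have taylor : IsHolder₂ (2 * κ) a T
      fun s t => σ s (x t) - σ s (x s) - fderiv ℝ (σ s) (x s) (x t - x s) :=
    IsHolder₂.of_norm_le_mul_sq hx (mul_nonneg zero_le_two hσ.nonneg) fun s t hs hst ht =>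
      hσ.norm_taylor_remainder_le ⟨ha.trans hs, hst.trans ht⟩ _ _
  have linear : IsHolder₂ (2 * κ) a T
      fun s t => fderiv ℝ (σ s) (x s) (remainder ζ x x' s t) :=
    hx'.clm_apply hσ.nonneg fun s hs => (hσ.space_deriv s ⟨ha.trans hs.1, hs.2⟩).bound _
  refine (((time.mono_exponent (by positivity) hκ').add taylor).add linear).congr
    fun s t _ _ _ => ?_
  simp only [remainder, inc, map_sub, ContinuousLinearMap.comp_apply]
  abel

end RegularCoefficient

section Solutions

variable {E : Type*} [NormedAddCommGroup E] [NormedSpace ℝ E] {a T α C L h μ κ : ℝ}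
  {A : ℝ → ℝ → E → E} {B : ℝ → E → E} {x : ℝ → E}

lemma IsBoundedDrift.isHolder₂_integral (hB : IsBoundedDrift a T C B) (x : ℝ → E) :
    IsHolder₂ 1 a T fun s t => ∫ r in s..t, B r (x r) :=
  ⟨C, fun s t hs hst ht => by rw [Real.rpow_one]; exact hB.norm_integral_le x hs hst ht⟩

lemma IsDavieSolution.isHolder₁ (hx : IsDavieSolution a T α h L A B x) (hα : 0 ≤ α)
    (hh : 0 < h) : IsHolder₁ α a T x := by
  obtain ⟨R, hR⟩ := isCompact_Icc.exists_bound_of_continuousOn hx.continuousOn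
  exact isHolder₂_of_short hα hh hx.increment fun s t hs hst ht =>
    (norm_sub_le _ _).trans (add_le_add (hR t ⟨hs.trans hst, ht⟩) (hR s ⟨hs, hst.trans ht⟩))

lemma IsDavieSolution.isHolder₂_davieError (hx : IsDavieSolution a T α h L A B x) (hα : 0 ≤ α)
    (hh : 0 < h) (hB : IsBoundedDrift a T C B) (hμ : 0 ≤ μ)
    (hA : IsHolder₂ μ a T fun s t => A s t (x s)) :
    IsHolder₂ (2 / 3 + α) a T (davieError A B x) := by
  obtain ⟨M₁, hM₁⟩ := (hx.isHolder₁ hα hh).exists_norm_le hα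
  obtain ⟨M₂, hM₂⟩ := hA.exists_norm_le hμ
  obtain ⟨M₃, hM₃⟩ := (hB.isHolder₂_integral x).exists_norm_le zero_le_one
  exact isHolder₂_of_short (by positivity) hh hx.error fun s t hs hst ht =>
    norm_sub_le_of_le (norm_sub_le_of_le (hM₁ s t hs hst ht) (hM₂ s t hs hst ht))
      (hM₃ s t hs hst ht)

variable {d : ℕ} {K : ℝ} {ζ : ℝ → Vec d} {Z : ℝ → ℝ → Fin d → Fin d → ℝ}
  {σ : ℝ → E → Vec d →L[ℝ] E}

lemma IsRoughPath.isHolder₂_first_order (hζ : IsRoughPath T α ζ Z)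
    (hσ : IsRegularCoefficient T K σ) (ha : 0 ≤ a) (x : ℝ → E) :
    IsHolder₂ α a T fun s t => σ s (x s) (inc ζ s t) :=
  (hζ.holder.mono_left ha).clm_apply hσ.nonneg fun s hs =>
    (hσ.space s ⟨ha.trans hs.1, hs.2⟩).bound _

lemma IsRoughPath.isHolder₂_second_order (hζ : IsRoughPath T α ζ Z)
    (hσ : IsRegularCoefficient T K σ) (ha : 0 ≤ a) (x : ℝ → E) :
    IsHolder₂ (2 * α) a T fun s t => contract (gubinelliDeriv σ s (x s)) (Z s t) :=
  (hζ.holder_area.mono_left ha).contract (C := 6 * (K * K))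
    (mul_nonneg (by norm_num) (mul_self_nonneg K)) fun s hs =>
      (hσ.isBL₂_gubinelliDeriv ⟨ha.trans hs.1, hs.2⟩).bound _

lemma IsRoughPath.isHolder₂_roughGerm (hζ : IsRoughPath T α ζ Z)
    (hσ : IsRegularCoefficient T K σ) (hα : 0 ≤ α) (ha : 0 ≤ a) (x : ℝ → E) :
    IsHolder₂ α a T fun s t => roughGerm ζ Z σ s t (x s) :=
  (hζ.isHolder₂_first_order hσ ha x).add
    ((hζ.isHolder₂_second_order hσ ha x).mono_exponent hα (by linarith))

lemma IsDavieSolution.isHolder₂_remainder (hζ : IsRoughPath T α ζ Z)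
    (hσ : IsRegularCoefficient T K σ) (ha : 0 ≤ a) (hα : 0 ≤ α) (hh : 0 < h)
    (hB : IsBoundedDrift a T C B) (hx : IsDavieSolution a T α h L (roughGerm ζ Z σ) B x)
    (hκ : 0 ≤ κ) (hκα : κ ≤ α) (hκ' : κ ≤ 1 / 2) :
    IsHolder₂ (2 * κ) a T (remainder ζ x fun t => σ t (x t)) := by
  have second := (hζ.isHolder₂_second_order hσ ha x).mono_exponent (ν := 2 * κ) (by positivity)
    (by linarith)
  have drift := (hB.isHolder₂_integral x).mono_exponent (ν := 2 * κ) (by positivity) (by linarith)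
  have error := (hx.isHolder₂_davieError hα hh hB hα (hζ.isHolder₂_roughGerm hσ hα ha x)
    ).mono_exponent (ν := 2 * κ) (by positivity) (by linarith)
  refine ((second.add drift).add error).congr fun s t _ _ _ => ?_
  simp only [remainder, inc, davieError, roughGerm]
  abel

lemma inc₂_davieError_roughGerm (hζ : IsRoughPath T α ζ Z) (σ : ℝ → E → Vec d →L[ℝ] E)
    (ha : 0 ≤ a) (hB : IsBoundedDrift a T C B) (hx : ContinuousOn x (Icc a T)) {s u t : ℝ}
    (hs : a ≤ s) (hsu : s ≤ u) (hut : u ≤ t) (ht : t ≤ T) :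
    inc₂ (davieError (roughGerm ζ Z σ) B x) s u t
      = remainder ζ (fun t => σ t (x t)) (fun t => gubinelliDeriv σ t (x t)) s u (inc ζ u t)
        + contract (inc (fun t => gubinelliDeriv σ t (x t)) s u) (Z u t) := by
  have additive := intervalIntegral.integral_add_adjacent_intervals
    (hB.intervalIntegrable hx hs hsu (hut.trans ht))
    (hB.intervalIntegrable hx (hs.trans hsu) hut ht)
  have defect := roughGerm_defect hζ σ (ha.trans hs) hsu hut ht (x s) (x u)
  calc inc₂ (davieError (roughGerm ζ Z σ) B x) s u t
      = -(roughGerm ζ Z σ s t (x s) - roughGerm ζ Z σ s u (x s) - roughGerm ζ Z σ u t (x u)) := by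
        simp only [inc₂, davieError, ← additive]
        abel
    _ = _ := by rw [defect, neg_neg]; rfl

end Solutions

section Equation

variable {m d : ℕ} {U : Type*} [MetricSpace U] [MeasurableSpace U] {T α h L K C s : ℝ}
  {ζ : ℝ → Vec d} {Z : ℝ → ℝ → Fin d → Fin d → ℝ} {b : ℝ → Vec m → U → Vec m}
  {σ : ℝ → Vec m → Vec d →L[ℝ] Vec m} {γ γ' : ℝ → P2 U} {x : ℝ → Vec m} {y : Vec m}

theorem IsDavieSolution.isSolution (hα : 1 / 3 < α) (hζ : IsRoughPath T α ζ Z)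
    (hσ : IsRegularCoefficient T K σ) (hs : 0 ≤ s) (hh : 0 < h)
    (hB : IsBoundedDrift s T C (controlledDrift b γ))
    (hx : IsDavieSolution s T α h L (roughGerm ζ Z σ) (controlledDrift b γ) x) :
    IsSolution T α ζ Z b σ s (x s) γ x := by
  -- The largest regularity for which the drift (`2 * κ ≤ 1`) and the Davie error fit in.
  let κ := min (1 / 2) ((2 / 3 + α) / 3)
  have hκ : 1 / 3 < κ := lt_min (by norm_num) (by linarith)
  have hκ_half : κ ≤ 1 / 2 := min_le_left _ _
  have hκ_error : κ ≤ (2 / 3 + α) / 3 := min_le_right _ _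
  have hx_holder : IsHolder₁ κ s T x :=
    (hx.isHolder₁ (by linarith) hh).mono_exponent (by linarith) (by linarith)
  have hx_remainder := hx.isHolder₂_remainder hζ hσ hs (by linarith) hh hB (κ := κ)
    (by linarith) (by linarith) hκ_half
  have hσx := hσ.isHolder₁_comp hs (by linarith) (by linarith) hx_holder
  have hσx_bound : ∀ t ∈ Icc s T, ‖σ t (x t)‖ ≤ K := fun t ht =>
    (hσ.space t ⟨hs.trans ht.1, ht.2⟩).bound _
  have hσx_deriv := (hσ.isHolder₁_fderiv_comp hs (by linarith) (by linarith) hx_holder).clm_comp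
    hσx hσ.nonneg (fun t ht => (hσ.space_deriv t ⟨hs.trans ht.1, ht.2⟩).bound _) hσx_bound
  have herror := hx.isHolder₂_davieError (by linarith) hh hB (by linarith)
    (hζ.isHolder₂_roughGerm hσ (by linarith) hs x)
  refine ⟨rfl, κ, hκ, by linarith, ⟨hx_holder, hσx, hx_remainder⟩, ⟨hσx, hσx_deriv,
    hσ.isHolder₂_remainder_comp hs (by linarith) (by linarith) hx_holder hx_remainder⟩,
    davieError (roughGerm ζ Z σ) (controlledDrift b γ) x,
    ⟨herror.mono_exponent (by linarith) (by linarith), fun _ _ _ hr hru hut ht =>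
      inc₂_davieError_roughGerm hζ σ hs hB hx.continuousOn hr hru hut ht⟩, fun r t _ _ _ => ?_⟩
  simp only [inc, davieError, roughGerm, gubinelliDeriv, controlledDrift]
  abel

lemma IsSolution.congr_control (hx : IsSolution T α ζ Z b σ s y γ x)
    (h : ∀ r ∈ Icc s T, γ r = γ' r) : IsSolution T α ζ Z b σ s y γ' x := by
  obtain ⟨hy, κ, hκ, hκ', hc, hμ, Λ, hΛ, hx⟩ := hx
  refine ⟨hy, κ, hκ, hκ', hc, hμ, Λ, hΛ, fun r t hr hrt ht => ?_⟩
  rw [hx r t hr hrt ht]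
  congr 2
  refine intervalIntegral.integral_congr fun u hu => ?_
  rw [uIcc_of_le hrt] at hu
  simp only [h u ⟨hr.trans hu.1, hu.2.trans ht⟩]

lemma IsSolution.continuousOn (hx : IsSolution T α ζ Z b σ s y γ x) :
    ContinuousOn x (Icc s T) := by
  obtain ⟨-, κ, hκ, -, hc, -⟩ := hx
  obtain ⟨C, hC⟩ := hc.holder
  exact continuousOn_of_short_holder (μ := κ) (by linarith) one_pos
    fun r t hr hrt ht _ => hC r t hr hrt ht

theorem IsSolution.isFlowLine (hC : 0 ≤ C) (hB : IsBoundedDrift s T C (controlledDrift b γ))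
    (hx : IsSolution T α ζ Z b σ s y γ x) :
    IsFlowLine s T (driftGerm (roughGerm ζ Z σ) (controlledDrift b γ)) x := by
  have hcont := hx.continuousOn
  obtain ⟨-, κ, hκ, -, hc, -, Λ, ⟨hΛ, -⟩, hx⟩ := hx
  obtain ⟨C₁, hC₁, hΛ⟩ := hΛ.exists_nonneg
  obtain ⟨C₂, hC₂, hinc⟩ := IsHolder₂.exists_nonneg hc.holder
  refine ⟨min (3 * κ) (1 + κ), C₁ + C * C₂, lt_min (by linarith) (by linarith), by positivity,
    fun r t hr hrt ht h1 => ?_⟩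
  have hτ : 0 ≤ t - r := sub_nonneg.2 hrt
  have hdrift : ‖(∫ u in r..t, controlledDrift b γ u (x u))
      - ∫ u in r..t, controlledDrift b γ u (x r)‖ ≤ C * (C₂ * (t - r) ^ κ) * (t - r) :=
    hB.norm_integral_sub_le hC hcont continuousOn_const hr hrt ht fun u hu =>
      (hinc r u hr hu.1 (hu.2.trans ht)).trans (mul_le_mul_of_nonneg_left (Real.rpow_le_rpow
        (sub_nonneg.2 hu.1) (sub_le_sub_right hu.2 r) (by linarith)) hC₂)
  have herror : flowError (driftGerm (roughGerm ζ Z σ) (controlledDrift b γ)) x r t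
      = Λ r t + ((∫ u in r..t, controlledDrift b γ u (x u))
        - ∫ u in r..t, controlledDrift b γ u (x r)) := by
    have h := hx r t hr hrt ht
    simp only [inc] at h
    simp only [flowError, h, driftGerm, roughGerm, gubinelliDeriv, controlledDrift, inc]
    abel
  have hpow : (t - r) ^ (3 * κ) ≤ (t - r) ^ min (3 * κ) (1 + κ) :=
    Real.rpow_le_rpow_of_exponent_ge' hτ h1 (le_min (by linarith) (by linarith))
      (min_le_left _ _)
  have hpow' : (t - r) ^ κ * (t - r) ≤ (t - r) ^ min (3 * κ) (1 + κ) :=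
    rpow_mul_self_le hτ h1 (by linarith) (le_min (by linarith) (by linarith))
      ((min_le_right _ _).trans_eq (add_comm _ _))
  calc _ ≤ C₁ * (t - r) ^ (3 * κ) + C * (C₂ * (t - r) ^ κ) * (t - r) :=
        herror ▸ norm_add_le_of_le (hΛ r t hr hrt ht) hdrift
    _ = C₁ * (t - r) ^ (3 * κ) + C * C₂ * ((t - r) ^ κ * (t - r)) := by ring
    _ ≤ C₁ * (t - r) ^ min (3 * κ) (1 + κ) + C * C₂ * (t - r) ^ min (3 * κ) (1 + κ) := by gcongr
    _ = _ := by ring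

end Equation

/-! ### The value function -/

section Value

lemma abs_sub_le_of_isLUB {A B : Set ℝ} {p q c : ℝ} (hA : IsLUB A p) (hB : IsLUB B q)
    (hAB : ∀ u ∈ A, ∃ v ∈ B, |u - v| ≤ c) (hBA : ∀ v ∈ B, ∃ u ∈ A, |u - v| ≤ c) :
    |p - q| ≤ c := by
  rw [abs_sub_le_iff, sub_le_iff_le_add, sub_le_iff_le_add]
  refine ⟨hA.2 fun u hu => ?_, hB.2 fun v hv => ?_⟩
  · obtain ⟨v, hv, huv⟩ := hAB u hu
    linarith [(abs_le.1 huv).2, hB.1 hv]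
  · obtain ⟨u, hu, huv⟩ := hBA v hv
    linarith [(abs_le.1 huv).1, hA.1 hu]

variable {m : ℕ} {U : Type*} [MetricSpace U] [MeasurableSpace U] {T ε L s s' : ℝ}
  {K : Set (P2 U)} {F : ℝ → Vec m → P2 U → ℝ} {G : Vec m → ℝ} {γ γ' : ℝ → P2 U}
  {x x' : ℝ → Vec m}

/-- The reward `J_{sT}` which the control `γ` and the state `x` produce on `[s, T]`. -/
noncomputable def reward (T : ℝ) (F : ℝ → Vec m → P2 U → ℝ) (G : Vec m → ℝ) (s : ℝ)
    (γ : ℝ → P2 U) (x : ℝ → Vec m) : ℝ :=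
  (∫ r in s..T, F r (x r) (γ r)) + G (x T)

lemma reward_congr_control (hs : s ≤ T) (h : ∀ r ∈ Icc s T, γ r = γ' r) :
    reward T F G s γ x = reward T F G s γ' x := by
  refine congrArg (· + G (x T)) (intervalIntegral.integral_congr fun r hr => ?_)
  rw [uIcc_of_le hs] at hr
  simp only [h r hr]

lemma IsRunningReward.exists_isBL (hF : IsRunningReward T K F) :
    ∃ C, ∀ t ∈ Icc 0 T, ∀ μ ∈ K, IsBL C fun x => F t x μ := by
  obtain ⟨C₁, hC₁⟩ := hF.bounded
  obtain ⟨C₂, hC₂⟩ := hF.lipschitz_space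
  exact ⟨max C₁ C₂, fun t ht μ hμ => ⟨fun x => (hC₁ t ht x μ hμ).trans (le_max_left _ _),
    fun x y => (hC₂ t ht μ hμ x y).trans (by gcongr; exact le_max_right _ _)⟩⟩

lemma abs_reward_sub_le {C δ : ℝ} {CG : NNReal} (hF : IsRunningReward T K F)
    (hC : ∀ t ∈ Icc 0 T, ∀ μ ∈ K, IsBL C fun x => F t x μ) (hG : LipschitzWith CG G)
    (hε : 0 < ε) (hs : 0 ≤ s) (hss' : s ≤ s') (hs' : s' ≤ T) (hγ : γ ∈ admissible K ε L s T)
    (hx : ContinuousOn x (Icc s T)) (hx' : ContinuousOn x' (Icc s' T))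
    (hδ : ∀ t ∈ Icc s' T, ‖x t - x' t‖ ≤ δ) :
    |reward T F G s γ x - reward T F G s' γ x'| ≤ C * (s' - s) + (C * T + CG) * δ := by
  have hsT := hss'.trans hs'
  have hBL : ∀ r ∈ Icc s T, IsBL C fun y => F r y (γ r) :=
    fun r hr => hC r ⟨hs.trans hr.1, hr.2⟩ _ (hγ.1 r hr)
  have hC₀ : 0 ≤ C := (hBL s ⟨le_rfl, hsT⟩).nonneg
  have hδ₀ : 0 ≤ δ := (norm_nonneg _).trans (hδ T ⟨hs', le_rfl⟩)
  have hint := hF.intervalIntegrable hε hs hsT hγ hx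
  have hmem : s' ∈ uIcc s T := by rw [uIcc_of_le hsT]; exact ⟨hss', hs'⟩
  have hint_early := hint.mono_set (uIcc_subset_uIcc_left hmem)
  have hint_late := hint.mono_set (uIcc_subset_uIcc_right hmem)
  have hint' := hF.intervalIntegrable hε (hs.trans hss') hs' (admissible_mono hss' hγ) hx'
  have early : |∫ r in s..s', F r (x r) (γ r)| ≤ C * (s' - s) :=
    norm_integral_le_of_forall_mem_Icc hss' fun r hr =>
      (hBL r (Icc_subset_Icc_right hs' hr)).bound _
  have late : |(∫ r in s'..T, F r (x r) (γ r)) - ∫ r in s'..T, F r (x' r) (γ r)|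
      ≤ C * T * δ := by
    rw [← intervalIntegral.integral_sub hint_late hint']
    calc _ ≤ C * δ * (T - s') := norm_integral_le_of_forall_mem_Icc hs' fun r hr =>
          ((hBL r (Icc_subset_Icc_left hss' hr)).lip _ _).trans (by gcongr; exact hδ r hr)
      _ ≤ C * δ * T := by gcongr; linarith
      _ = C * T * δ := by ring
  have terminal : |G (x T) - G (x' T)| ≤ CG * δ := by
    rw [← Real.dist_eq]
    refine (hG.dist_le_mul _ _).trans ?_
    rw [dist_eq_norm]
    gcongr
    exact hδ T ⟨hs', le_rfl⟩
  have split : reward T F G s γ x - reward T F G s' γ x' = (∫ r in s..s', F r (x r) (γ r))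
      + ((∫ r in s'..T, F r (x r) (γ r)) - ∫ r in s'..T, F r (x' r) (γ r))
      + (G (x T) - G (x' T)) := by
    rw [reward, reward, ← intervalIntegral.integral_add_adjacent_intervals hint_early hint_late]
    ring
  rw [split]
  exact ((abs_add_three _ _ _).trans (add_le_add_three early late terminal)).trans_eq (by ring)

variable [BorelSpace U] [SecondCountableTopology U] {d : ℕ} {α : ℝ} {ζ : ℝ → Vec d}
  {Z : ℝ → ℝ → Fin d → Fin d → ℝ} {b : ℝ → Vec m → U → Vec m}
  {σ : ℝ → Vec m → Vec d →L[ℝ] Vec m} {y y' : Vec m}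

lemma exists_isSolution (hα : 1 / 3 < α) (hα' : α ≤ 1) (hζ : IsRoughPath T α ζ Z)
    (hb : IsDrift T b) (hσ : IsCb13 T σ) (hε : 0 < ε) (hs : 0 ≤ s)
    (hγ : γ ∈ admissible K ε L s T) (y : Vec m) : ∃ x, IsSolution T α ζ Z b σ s y γ x := by
  obtain ⟨Cσ, hσ⟩ := exists_isRegularCoefficient hσ.contDiff_space hσ.differentiable_time
    hσ.bounded_time hσ.bounded_space
  obtain ⟨C₁, hA⟩ := exists_isAlmostFlow_roughGerm hα hζ hσ
  obtain ⟨C₂, -, hB⟩ := hb.exists_isBoundedDrift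
  have hA := hA.mono (le_max_left C₁ C₂)
  have hB := (hB K ε L s γ hε hs hγ).mono_const (le_max_right C₁ C₂)
  obtain ⟨x, rfl, hx⟩ := (hA.isWeakFlow hB hs (by linarith) hα').exists_isFlowLine hα y
  obtain ⟨h, L, hh, -, -, hdavie⟩ := exists_forall_isDavieSolution (E := Vec m) hα hα' hA.nonneg
  exact ⟨x, (hdavie s T _ _ x hs hA hB hx).isSolution hα hζ hσ hs hh hB⟩

lemma exists_forall_isSolution_sub_le (hα : 1 / 3 < α) (hα' : α ≤ 1) (hζ : IsRoughPath T α ζ Z)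
    (hb : IsDrift T b) (hσ : IsCb13 T σ) :
    ∃ D, 0 ≤ D ∧ ∀ (K : Set (P2 U)) (ε L s s' : ℝ) (γ : ℝ → P2 U) (y y' : Vec m)
      (x x' : ℝ → Vec m), 0 < ε → 0 ≤ s → s ≤ s' → γ ∈ admissible K ε L s T →
      IsSolution T α ζ Z b σ s y γ x → IsSolution T α ζ Z b σ s' y' γ x' →
      ∀ t ∈ Icc s' T, ‖x t - x' t‖ ≤ D * (‖y - y'‖ + (s' - s) ^ α) := by
  obtain ⟨Cσ, hσ⟩ := exists_isRegularCoefficient hσ.contDiff_space hσ.differentiable_time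
    hσ.bounded_time hσ.bounded_space
  obtain ⟨C₁, hA⟩ := exists_isAlmostFlow_roughGerm hα hζ hσ
  obtain ⟨C₂, -, hB⟩ := hb.exists_isBoundedDrift
  have hA := hA.mono (le_max_left C₁ C₂)
  obtain ⟨D, hD, hstab⟩ :=
    exists_forall_isFlowLine_sub_isFlowLine_le (E := Vec m) T hα hα' hA.nonneg
  refine ⟨D, hD, fun K ε L s s' γ y y' x x' hε hs hss' hγ hx hx' t ht => ?_⟩
  have hB := (hB K ε L s γ hε hs hγ).mono_const (le_max_right C₁ C₂)
  have h := hstab s s' _ _ x x' hs hss' hA hB (hx.isFlowLine hA.nonneg hB)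
    (hx'.isFlowLine hA.nonneg (hB.mono hss')) t ht
  rwa [hx.1, hx'.1] at h

lemma exists_forall_abs_reward_sub_le (hα : 1 / 3 < α) (hα' : α ≤ 1) (hζ : IsRoughPath T α ζ Z)
    (hb : IsDrift T b) (hσ : IsCb13 T σ) (hF : IsRunningReward T K F)
    (hG : ∃ C, LipschitzWith C G) :
    ∃ D, 0 ≤ D ∧ ∀ (ε L s s' : ℝ) (γ : ℝ → P2 U) (y y' : Vec m) (x x' : ℝ → Vec m), 0 < ε →
      0 ≤ s → s ≤ s' → s' ≤ T → γ ∈ admissible K ε L s T → IsSolution T α ζ Z b σ s y γ x →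
      IsSolution T α ζ Z b σ s' y' γ x' →
      |reward T F G s γ x - reward T F G s' γ x'| ≤ D * (‖y - y'‖ + (s' - s) ^ α) := by
  obtain ⟨C, hC⟩ := hF.exists_isBL
  obtain ⟨CG, hG⟩ := hG
  obtain ⟨D, hD, hstab⟩ := exists_forall_isSolution_sub_le hα hα' hζ hb hσ
  refine ⟨|C| * |T| ^ (1 - α) + (|C| * |T| + CG) * D, by positivity,
    fun ε L s s' γ y y' x x' hε hs hss' hs'T hγ hx hx' => ?_⟩
  have hT : 0 ≤ T := hs.trans (hss'.trans hs'T)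
  have hC₀ : 0 ≤ C := (hC s ⟨hs, hss'.trans hs'T⟩ _ (hγ.1 s ⟨le_rfl, hss'.trans hs'T⟩)).nonneg
  have htime : s' - s ≤ T ^ (1 - α) * (s' - s) ^ α := by
    simpa only [Real.rpow_one] using rpow_le_rpow_sub_mul_rpow (μ := 1) (sub_nonneg.2 hss')
      (show s' - s ≤ T by linarith) (by linarith) hα'
  have hsum : (s' - s) ^ α ≤ ‖y - y'‖ + (s' - s) ^ α := le_add_of_nonneg_left (norm_nonneg _)
  rw [abs_of_nonneg hT, abs_of_nonneg hC₀]
  calc |reward T F G s γ x - reward T F G s' γ x'|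
      ≤ C * (s' - s) + (C * T + CG) * (D * (‖y - y'‖ + (s' - s) ^ α)) :=
        abs_reward_sub_le hF hC hG hε hs hss' hs'T hγ hx.continuousOn hx'.continuousOn
          (hstab K ε L s s' γ y y' x x' hε hs hss' hγ hx hx')
    _ ≤ C * (T ^ (1 - α) * (‖y - y'‖ + (s' - s) ^ α))
        + (C * T + CG) * (D * (‖y - y'‖ + (s' - s) ^ α)) := by
        gcongr
        exact htime.trans (by gcongr)
    _ = _ := by ring

lemma nonempty_rewards (hα : 1 / 3 < α) (hα' : α ≤ 1) (hζ : IsRoughPath T α ζ Z)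
    (hb : IsDrift T b) (hσ : IsCb13 T σ) (hK : K.Nonempty) (F : ℝ → Vec m → P2 U → ℝ)
    (G : Vec m → ℝ) (hε : 0 < ε) (L : ℝ) (hs : 0 ≤ s) (y : Vec m) :
    (rewards T α ε L ζ Z b σ K F G s y).Nonempty := by
  obtain ⟨μ, hμ⟩ := hK
  have hγ : (fun _ => μ) ∈ admissible K ε L s T := const_mem_admissible hμ
  obtain ⟨x, hx⟩ := exists_isSolution hα hα' hζ hb hσ hε hs hγ y
  exact ⟨_, _, hγ, x, hx, rfl⟩

/-- The reward is compared with `G y`, which is the only reward at the final time. -/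
lemma bddAbove_rewards (hα : 1 / 3 < α) (hα' : α ≤ 1) (hζ : IsRoughPath T α ζ Z)
    (hb : IsDrift T b) (hσ : IsCb13 T σ) (hF : IsRunningReward T K F)
    (hG : ∃ C, LipschitzWith C G) (hε : 0 < ε) (L : ℝ) (hs : s ∈ Icc 0 T) (y : Vec m) :
    BddAbove (rewards T α ε L ζ Z b σ K F G s y) := by
  obtain ⟨D, -, hD⟩ := exists_forall_abs_reward_sub_le hα hα' hζ hb hσ hF hG
  refine ⟨G y + D * (T - s) ^ α, ?_⟩
  rintro _ ⟨γ, hγ, x, hx, rfl⟩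
  obtain ⟨x', hx'⟩ := exists_isSolution hα hα' hζ hb hσ hε (hs.1.trans hs.2)
    (admissible_mono hs.2 hγ) y
  have hterminal : reward T F G T γ x' = G y := by
    rw [reward, intervalIntegral.integral_same, zero_add, hx'.1]
  have h := hD ε L s T γ y y x x' hε hs.1 hs.2 le_rfl hγ hx hx'
  rw [hterminal, sub_self, norm_zero, zero_add] at h
  exact sub_le_iff_le_add'.1 ((le_abs_self _).trans h)

lemma isLUB_value (hα : 1 / 3 < α) (hα' : α ≤ 1) (hζ : IsRoughPath T α ζ Z)
    (hb : IsDrift T b) (hσ : IsCb13 T σ) (hK : K.Nonempty) (hF : IsRunningReward T K F)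
    (hG : ∃ C, LipschitzWith C G) (hε : 0 < ε) (L : ℝ) (hs : s ∈ Icc 0 T) (y : Vec m) :
    IsLUB (rewards T α ε L ζ Z b σ K F G s y) (value T α ε L ζ Z b σ K F G s y) :=
  isLUB_csSup (nonempty_rewards hα hα' hζ hb hσ hK F G hε L hs.1 y)
    (bddAbove_rewards hα hα' hζ hb hσ hF hG hε L hs y)

/-- Controls on `[s, T]` are restricted to `[s', T]`, and controls on `[s', T]` are extended to
`[s, T]` by a constant. -/
lemma exists_forall_abs_value_sub_le_of_le (hα : 1 / 3 < α) (hα' : α ≤ 1)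
    (hζ : IsRoughPath T α ζ Z) (hb : IsDrift T b) (hσ : IsCb13 T σ) (hK : K.Nonempty)
    (hF : IsRunningReward T K F) (hG : ∃ C, LipschitzWith C G) :
    ∃ D, 0 ≤ D ∧ ∀ (ε L s s' : ℝ) (y y' : Vec m), 0 < ε → 0 ≤ L → 0 ≤ s → s ≤ s' → s' ≤ T →
      |value T α ε L ζ Z b σ K F G s y - value T α ε L ζ Z b σ K F G s' y'|
        ≤ D * (‖y - y'‖ + (s' - s) ^ α) := by
  obtain ⟨D, hD₀, hD⟩ := exists_forall_abs_reward_sub_le hα hα' hζ hb hσ hF hG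
  refine ⟨D, hD₀, fun ε L s s' y y' hε hL hs hss' hs'T => abs_sub_le_of_isLUB
    (isLUB_value hα hα' hζ hb hσ hK hF hG hε L ⟨hs, hss'.trans hs'T⟩ y)
    (isLUB_value hα hα' hζ hb hσ hK hF hG hε L ⟨hs.trans hss', hs'T⟩ y') ?_ ?_⟩
  · rintro _ ⟨γ, hγ, x, hx, rfl⟩
    have hγ' := admissible_mono hss' hγ
    obtain ⟨x', hx'⟩ := exists_isSolution hα hα' hζ hb hσ hε (hs.trans hss') hγ' y'
    exact ⟨_, ⟨γ, hγ', x', hx', rfl⟩, hD ε L s s' γ y y' x x' hε hs hss' hs'T hγ hx hx'⟩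
  · rintro _ ⟨γ', hγ', x', hx', rfl⟩
    have hγ : (fun r => γ' (max s' r)) ∈ admissible K ε L s T :=
      comp_max_mem_admissible hL hε.le hs'T hγ'
    have hagree : ∀ r ∈ Icc s' T, γ' r = γ' (max s' r) := fun r hr => by rw [max_eq_right hr.1]
    obtain ⟨x, hx⟩ := exists_isSolution hα hα' hζ hb hσ hε hs hγ y
    refine ⟨_, ⟨_, hγ, x, hx, rfl⟩, ?_⟩
    change |reward T F G s _ x - reward T F G s' γ' x'| ≤ _
    rw [reward_congr_control hs'T hagree]
    exact hD ε L s s' _ y y' x x' hε hs hss' hs'T hγ hx (hx'.congr_control hagree)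

end Value

end RoughControl

theorem mainTheorem6_general {m d : ℕ} {U : Type*} [MetricSpace U] [SecondCountableTopology U]
    [MeasurableSpace U] [BorelSpace U] (T α : ℝ) (hα : 1 / 3 < α) (hα' : α ≤ 1)
    (ζ : ℝ → RoughControl.Vec d) (Z : ℝ → ℝ → Fin d → Fin d → ℝ)
    (hζ : RoughControl.IsRoughPath T α ζ Z)
    (b : ℝ → RoughControl.Vec m → U → RoughControl.Vec m)
    (hb : RoughControl.IsDrift T b)
    (σ : ℝ → RoughControl.Vec m → RoughControl.Vec d →L[ℝ] RoughControl.Vec m)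
    (hσ : RoughControl.IsCb13 T σ)
    (K : Set (RoughControl.P2 U)) (hK : K.Nonempty)
    (F : ℝ → RoughControl.Vec m → RoughControl.P2 U → ℝ)
    (hF : RoughControl.IsRunningReward T K F)
    (G : RoughControl.Vec m → ℝ) (hG : ∃ C, LipschitzWith C G) :
    ∃ C : ℝ, 0 ≤ C ∧ ∀ ε L : ℝ, 0 < ε → 0 ≤ L →
      (∀ s ∈ Icc 0 T, ∀ y : RoughControl.Vec m,
        IsLUB (RoughControl.rewards T α ε L ζ Z b σ K F G s y)
          (RoughControl.value T α ε L ζ Z b σ K F G s y)) ∧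
      ∀ s₁ ∈ Icc 0 T, ∀ s₂ ∈ Icc 0 T, ∀ y₁ y₂ : RoughControl.Vec m,
        |RoughControl.value T α ε L ζ Z b σ K F G s₂ y₂
            - RoughControl.value T α ε L ζ Z b σ K F G s₁ y₁|
          ≤ C * (‖y₁ - y₂‖ + |s₁ - s₂| ^ α) := by
  obtain ⟨C, hC₀, hC⟩ :=
    RoughControl.exists_forall_abs_value_sub_le_of_le hα hα' hζ hb hσ hK hF hG
  refine ⟨C, hC₀, fun ε L hε hL =>
    ⟨fun s hs y => RoughControl.isLUB_value hα hα' hζ hb hσ hK hF hG hε L hs y,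
      fun s₁ hs₁ s₂ hs₂ y₁ y₂ => ?_⟩⟩
  rcases le_total s₁ s₂ with h | h
  · rw [abs_sub_comm, abs_sub_comm s₁, abs_of_nonneg (sub_nonneg.2 h)]
    exact hC ε L s₁ s₂ y₁ y₂ hε hL hs₁.1 h hs₂.2
  · rw [norm_sub_rev, abs_of_nonneg (sub_nonneg.2 h)]
    exact hC ε L s₂ s₁ y₂ y₁ hε hL hs₂.1 h hs₁.2

theorem mainTheorem6 {m d : ℕ} {U : Type*} [MetricSpace U] [SecondCountableTopology U]
    [MeasurableSpace U] [BorelSpace U]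
    (T α : ℝ) (hT : 0 < T) (hα : 1 / 3 < α) (hα' : α < 1)
    (ζ : ℝ → RoughControl.Vec d) (Z : ℝ → ℝ → Fin d → Fin d → ℝ)
    (hζ : RoughControl.IsGeometricRoughPath T α ζ Z)
    (b : ℝ → RoughControl.Vec m → U → RoughControl.Vec m)
    (hb : RoughControl.IsDrift T b)
    (σ : ℝ → RoughControl.Vec m → RoughControl.Vec d →L[ℝ] RoughControl.Vec m)
    (hσ : RoughControl.IsCb13 T σ)
    (K : Set (RoughControl.P2 U)) (hK : IsCompact K) (hK' : K.Nonempty)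
    (F : ℝ → RoughControl.Vec m → RoughControl.P2 U → ℝ)
    (hF : RoughControl.IsRunningReward T K F)
    (G : RoughControl.Vec m → ℝ) (hG : RoughControl.IsTerminalReward G)
    (hG' : ∃ C, LipschitzWith C G) :
    ∃ C : ℝ, ∀ ε L : ℝ, 0 < ε → 0 < L →
      (∀ s ∈ Icc 0 T, ∀ y : RoughControl.Vec m,
        IsLUB (RoughControl.rewards T α ε L ζ Z b σ K F G s y)
          (RoughControl.value T α ε L ζ Z b σ K F G s y)) ∧
      ∀ s₁ ∈ Icc 0 T, ∀ s₂ ∈ Icc 0 T, ∀ y₁ y₂ : RoughControl.Vec m,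
        |RoughControl.value T α ε L ζ Z b σ K F G s₂ y₂
            - RoughControl.value T α ε L ζ Z b σ K F G s₁ y₁|
          ≤ C * (‖y₁ - y₂‖ + (1 + ‖y₁‖ + ‖y₂‖) * |s₁ - s₂| ^ α) := by
  obtain ⟨C, hC₀, hC⟩ := mainTheorem6_general T α hα hα'.le ζ Z hζ.isRoughPath b hb σ hσ K hK' F hF
    G hG'
  refine ⟨C, fun ε L hε hL => ⟨(hC ε L hε hL.le).1, fun s₁ hs₁ s₂ hs₂ y₁ y₂ => ?_⟩⟩
  have hweight : 1 ≤ 1 + ‖y₁‖ + ‖y₂‖ := by linarith [norm_nonneg y₁, norm_nonneg y₂]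
  refine ((hC ε L hε hL.le).2 s₁ hs₁ s₂ hs₂ y₁ y₂).trans ?_
  gcongr
  exact le_mul_of_one_le_left (Real.rpow_nonneg (abs_nonneg _) α) hweight
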